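/- **Satisfiability of linear integer arithmetic with sum cardinalities ($\mathrm{LIA}^{card}$) is in NP.** Quantifier-free Presburger formulas are built with $\neg,\wedge,\vee$ from atoms $s\le t$ and $s=t$, where $s,t$ are linear terms formed from variables and integer constants by addition and by multiplication with integer constants. For a set $A$ of integer vectors and $m\in\mathbb N$ let $$A^m=\Big\{\textstyle\sum_{i=1}^m y_i \;:\; y_1,\dots,y_m\in A\Big\}$$ be the set of sums of exactly $m$ elements of $A$ (repetitions allowed, $A^0=\{0\}$). A formula of $\mathrm{LIA}^{card}$ has the form $$F_0\;\wedge\;\bigwedge_{i=1}^n u\in\{y \mid F_i(y)\}^{x_i},$$ where $k,n\ge 0$, $u=(u_1,\dots,u_k)$ is a vector of variables, $x_1,\dots,x_n$ are variables for natural numbers, $F_0$ is a quantifier-free Presburger formula over $u_1,\dots,u_k$, $x_1,\dots,x_n$ and any further variables, and each $F_i$ ($1\le i\le n$) is a quantifier-free Presburger formula whose only variables are the components of the $k$-dimensional vector $y$. The formula is satisfiable over $D$ (where $D=\mathbb N$ or $D=\mathbb Z$) if there are values in $D$ for $u$ and the further variables and values in $\mathbb N$ for $x_1,\dots,x_n$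 such that $F_0$ holds and, for every $i$, $u$ is a sum of exactly $x_i$ vectors $y\in D^k$ that satisfy $F_i$. Formulas are given as strings over a finite alphabet, in prefix notation, with integer constants in sign and binary; variable indices and the numbers $k$ and $n$ are in unary. **Proposition.** The set of strings encoding $\mathrm{LIA}^{card}$ formulas satisfiable over $\mathbb N$ is in NP, and so is the set of strings encoding those satisfiable over $\mathbb Z$. Here a language $L$ is in NP if there are a polynomial $p$ and a verifier $V$, decided by a deterministic multi-stack Turing machine in time polynomial in the total length of its two inputs, such that $s\in L$ if and only if $V$ accepts $(s,w)$ for some certificate string $w$, over a finite alphabet, with $|w|\le p(|s|)$. -/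

import Mathlib

/-! ## Quantifier-free Presburger arithmetic -/

/-- Linear terms over variables of type `α`, with integer constants and multiplication by integer
constants. -/
inductive LinTerm (α : Type) : Type
  | const (c : ℤ) : LinTerm α
  | var (a : α) : LinTerm α
  | add (s t : LinTerm α) : LinTerm α
  | smul (c : ℤ) (t : LinTerm α) : LinTerm α

/-- Quantifier-free Presburger formulas over variables of type `α`. -/
inductive QFPA (α : Type) : Type
  | le (s t : LinTerm α) : QFPA α
  | eq (s t : LinTerm α) : QFPA α
  | not (F : QFPA α) : QFPA α
  | and (F G : QFPA α) : QFPA α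
  | or (F G : QFPA α) : QFPA α

/-- The integer value of a linear term under an assignment. -/
def LinTerm.value {α : Type} (ρ : α → ℤ) : LinTerm α → ℤ
  | .const c => c
  | .var a => ρ a
  | .add s t => s.value ρ + t.value ρ
  | .smul c t => c * t.value ρ

/-- Truth of a quantifier-free Presburger formula under an assignment. -/
def QFPA.Holds {α : Type} (ρ : α → ℤ) : QFPA α → Prop
  | .le s t => s.value ρ ≤ t.value ρ
  | .eq s t => s.value ρ = t.value ρ
  | .not F => ¬ F.Holds ρ
  | .and F G => F.Holds ρ ∧ G.Holds ρ
  | .or F G => F.Holds ρ ∨ G.Holds ρ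

/-! ## Linear arithmetic with sum cardinalities -/

/-- The set `A ^ m` of all sums of exactly `m` elements of `A` (repetitions allowed). -/
def sumPow {V : Type} [AddCommMonoid V] (A : Set V) (m : ℕ) : Set V :=
  {u | ∃ y : Fin m → V, (∀ i, y i ∈ A) ∧ u = ∑ i, y i}

/-- The variables of the Presburger part `F₀`: the components of the vector `u`, the exponents
`x₁, …, xₙ`, and further variables. -/
inductive CardVar (k n : ℕ) : Type
  | u (j : Fin k) : CardVar k n
  | x (i : Fin n) : CardVar k n
  | v (l : ℕ) : CardVar k n

/-- The formula `F₀ ∧ ⋀ i, u ∈ {y | Fᵢ(y)} ^ xᵢ`, where `u` is a vector of `k` variables and there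
are `n` sum constraints; the only variables of `Fᵢ` are the `k` components of `y`. -/
structure LIACard : Type where
  k : ℕ
  n : ℕ
  F₀ : QFPA (CardVar k n)
  F : Fin n → QFPA (Fin k)

/-- The assignment to the variables of `F₀` given by values of `u`, of the exponents and of the
further variables. -/
def CardVar.assign {k n : ℕ} (u : Fin k → ℤ) (x : Fin n → ℕ) (v : ℕ → ℤ) : CardVar k n → ℤ
  | .u j => u j
  | .x i => (x i : ℤ)
  | .v l => v l

/-- Satisfiability with all variables ranging over `D ⊆ ℤ`, where exponents are always natural
numbers. Here `D` will be `{z | 0 ≤ z}`, that is `ℕ`, or all of `ℤ`. -/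
def LIACard.Satisfiable (D : Set ℤ) (φ : LIACard) : Prop :=
  ∃ (u : Fin φ.k → ℤ) (x : Fin φ.n → ℕ) (v : ℕ → ℤ),
    (∀ j, u j ∈ D) ∧ (∀ l, v l ∈ D) ∧
    φ.F₀.Holds (CardVar.assign u x v) ∧
    ∀ i, u ∈ sumPow {y : Fin φ.k → ℤ | (∀ j, y j ∈ D) ∧ (φ.F i).Holds y} (x i)

/-! ## Formulas as strings

Formulas are written in prefix notation over a finite alphabet. Integers are written in sign and
binary; variables are written as a letter followed by their index in unary. -/

inductive Token : Type
  | plus | minus | bit0 | bit1 | sep | tick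
  | varU | varX | varV
  | const | add | smul
  | le | eq | not | and | or
  deriving DecidableEq

instance : Fintype Token where
  elems := {.plus, .minus, .bit0, .bit1, .sep, .tick, .varU, .varX, .varV, .const, .add, .smul,
    .le, .eq, .not, .and, .or}
  complete a := by cases a <;> decide

/-- Binary digits, least significant first, without leading zeros. -/
def encodeBits (m : ℕ) : List Token :=
  m.bits.map fun b => bif b then Token.bit1 else Token.bit0

def encodeInt (c : ℤ) : List Token :=
  (if c < 0 then Token.minus else Token.plus) :: (encodeBits c.natAbs ++ [Token.sep])

def encodeUnary (m : ℕ) : List Token :=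
  List.replicate m Token.tick ++ [Token.sep]

def CardVar.encode {k n : ℕ} : CardVar k n → List Token
  | .u j => Token.varU :: encodeUnary j
  | .x i => Token.varX :: encodeUnary i
  | .v l => Token.varV :: encodeUnary l

/-- The components of the bound vector of `Fᵢ` are written like those of `u`. -/
def encodeFin {k : ℕ} (j : Fin k) : List Token :=
  Token.varU :: encodeUnary j

def LinTerm.encode {α : Type} (var : α → List Token) : LinTerm α → List Token
  | .const c => Token.const :: encodeInt c
  | .var a => var a
  | .add s t => Token.add :: (s.encode var ++ t.encode var)
  | .smul c t => Token.smul :: (encodeInt c ++ t.encode var)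

def QFPA.encode {α : Type} (var : α → List Token) : QFPA α → List Token
  | .le s t => Token.le :: (s.encode var ++ t.encode var)
  | .eq s t => Token.eq :: (s.encode var ++ t.encode var)
  | .not F => Token.not :: F.encode var
  | .and F G => Token.and :: (F.encode var ++ G.encode var)
  | .or F G => Token.or :: (F.encode var ++ G.encode var)

/-- The string of a formula: the numbers `k` and `n` in unary, then `F₀, F₁, …, Fₙ`. -/
def LIACard.encode (φ : LIACard) : List Token :=
  encodeUnary φ.k ++ encodeUnary φ.n ++ φ.F₀.encode CardVar.encode ++
    (List.ofFn fun i => (φ.F i).encode encodeFin).flatten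

/-! The encoding is injective: a string determines the formula that it encodes. -/

theorem encodeUnary_append_inj {m m' : ℕ} {s t : List Token}
    (h : encodeUnary m ++ s = encodeUnary m' ++ t) : m = m' ∧ s = t := by
  induction m generalizing m' with
  | zero => cases m' <;> simp_all [encodeUnary, List.replicate_succ]
  | succ m ih =>
    cases m' with
    | zero => simp [encodeUnary, List.replicate_succ] at h
    | succ m' =>
      have h' : encodeUnary m ++ s = encodeUnary m' ++ t := by
        simpa [encodeUnary, List.replicate_succ] using h
      exact ⟨congrArg _ (ih h').1, (ih h').2⟩

theorem encodeBits_append_inj {m m' : ℕ} {s t : List Token}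
    (h : encodeBits m ++ Token.sep :: s = encodeBits m' ++ Token.sep :: t) :
    m = m' ∧ s = t := by
  have key : ∀ l l' : List Bool,
      (l.map fun b => bif b then Token.bit1 else Token.bit0) ++ Token.sep :: s =
        (l'.map fun b => bif b then Token.bit1 else Token.bit0) ++ Token.sep :: t →
      l = l' ∧ s = t := by
    intro l
    induction l with
    | nil =>
      rintro (_ | ⟨_ | _, l'⟩) <;> simp
    | cons b l ih =>
      rintro (_ | ⟨b', l'⟩) hl
      · cases b <;> simp at hl
      · have h2 := ih l' (by simpa using (List.cons.inj hl).2)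
        have h1 := (List.cons.inj hl).1
        refine ⟨?_, h2.2⟩
        rw [h2.1]
        cases b <;> cases b' <;> simp_all
  have := key _ _ h
  refine ⟨?_, this.2⟩
  have h3 := congrArg (fun l : List Bool => l.foldr Nat.bit 0) this.1
  have e : ∀ n : ℕ, n.bits.foldr Nat.bit 0 = n := by
    intro n
    induction n using Nat.binaryRec' with
    | zero => simp
    | bit b n hn ih => rw [Nat.bits_append_bit n b hn]; simp [ih]
  simpa [e] using h3

theorem encodeInt_append_inj {c c' : ℤ} {s t : List Token}
    (h : encodeInt c ++ s = encodeInt c' ++ t) : c = c' ∧ s = t := by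
  simp only [encodeInt, List.cons_append, List.append_assoc, List.cons.injEq,
    List.nil_append] at h
  obtain ⟨h1, h2⟩ := h
  obtain ⟨h3, h4⟩ := encodeBits_append_inj h2
  refine ⟨?_, h4⟩
  split_ifs at h1 <;> omega

theorem CardVar.encode_append_inj {k n : ℕ} {a b : CardVar k n} {s t : List Token}
    (h : a.encode ++ s = b.encode ++ t) : a = b ∧ s = t := by
  cases a <;> cases b <;> simp [CardVar.encode] at h <;>
    have := encodeUnary_append_inj h <;> simp_all [Fin.ext_iff]

theorem encodeFin_append_inj {k : ℕ} {a b : Fin k} {s t : List Token}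
    (h : encodeFin a ++ s = encodeFin b ++ t) : a = b ∧ s = t := by
  simp [encodeFin] at h
  have := encodeUnary_append_inj h
  simp_all [Fin.ext_iff]

theorem CardVar.encode_head {k n : ℕ} (a : CardVar k n) :
    ∃ x ∈ ({.varU, .varX, .varV} : Set Token), ∃ l, a.encode = x :: l := by
  cases a <;> simp [CardVar.encode]

theorem encodeFin_head {k : ℕ} (a : Fin k) :
    ∃ x ∈ ({.varU, .varX, .varV} : Set Token), ∃ l, encodeFin a = x :: l := by
  simp [encodeFin]

theorem LinTerm.encode_append_inj {α : Type} {var : α → List Token}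
    (hv : ∀ a : α, ∃ x ∈ ({.varU, .varX, .varV} : Set Token), ∃ l, var a = x :: l)
    (hi : ∀ (a b : α) (s t : List Token), var a ++ s = var b ++ t → a = b ∧ s = t)
    {p q : LinTerm α} {s t : List Token}
    (h : p.encode var ++ s = q.encode var ++ t) : p = q ∧ s = t := by
  induction p generalizing q s t with
  | const c =>
    cases q with
    | const c' =>
      have := encodeInt_append_inj (List.cons.inj h).2
      simp_all
    | var b => obtain ⟨x, hx, l, e⟩ := hv b; simp [LinTerm.encode, e] at h; simp [← h.1] at hx
    | add => simp [LinTerm.encode] at h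
    | smul => simp [LinTerm.encode] at h
  | var a =>
    obtain ⟨x, hx, l, e⟩ := hv a
    cases q with
    | const c' => simp [LinTerm.encode, e] at h; simp [h.1] at hx
    | var b => have := hi a b s t h; simp_all
    | add => simp [LinTerm.encode, e] at h; simp [h.1] at hx
    | smul => simp [LinTerm.encode, e] at h; simp [h.1] at hx
  | add p₁ p₂ ih₁ ih₂ =>
    cases q with
    | const c' => simp [LinTerm.encode] at h
    | var b => obtain ⟨x, hx, l, e⟩ := hv b; simp [LinTerm.encode, e] at h; simp [← h.1] at hx
    | add q₁ q₂ =>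
      simp only [LinTerm.encode, List.cons_append, List.append_assoc, List.cons.injEq,
        true_and] at h
      obtain ⟨h1, h2⟩ := ih₁ h
      obtain ⟨h3, h4⟩ := ih₂ h2
      exact ⟨by rw [h1, h3], h4⟩
    | smul => simp [LinTerm.encode] at h
  | smul c p ih =>
    cases q with
    | const c' => simp [LinTerm.encode] at h
    | var b => obtain ⟨x, hx, l, e⟩ := hv b; simp [LinTerm.encode, e] at h; simp [← h.1] at hx
    | add => simp [LinTerm.encode] at h
    | smul c' q =>
      simp only [LinTerm.encode, List.cons_append, List.append_assoc, List.cons.injEq,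
        true_and] at h
      obtain ⟨h1, h2⟩ := encodeInt_append_inj h
      obtain ⟨h3, h4⟩ := ih h2
      exact ⟨by rw [h1, h3], h4⟩

theorem QFPA.encode_append_inj {α : Type} {var : α → List Token}
    (hv : ∀ a : α, ∃ x ∈ ({.varU, .varX, .varV} : Set Token), ∃ l, var a = x :: l)
    (hi : ∀ (a b : α) (s t : List Token), var a ++ s = var b ++ t → a = b ∧ s = t)
    {F G : QFPA α} {s t : List Token}
    (h : F.encode var ++ s = G.encode var ++ t) : F = G ∧ s = t := by
  induction F generalizing G s t with
  | le p₁ p₂ | eq p₁ p₂ =>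
    cases G <;> simp only [QFPA.encode, List.cons_append, List.append_assoc, List.cons.injEq,
        true_and, reduceCtorEq, false_and] at h
    obtain ⟨h1, h2⟩ := LinTerm.encode_append_inj hv hi h
    obtain ⟨h3, h4⟩ := LinTerm.encode_append_inj hv hi h2
    exact ⟨by rw [h1, h3], h4⟩
  | not F ih =>
    cases G <;> simp only [QFPA.encode, List.cons_append, List.append_assoc, List.cons.injEq,
        true_and, reduceCtorEq, false_and] at h
    obtain ⟨h1, h2⟩ := ih h
    exact ⟨by rw [h1], h2⟩
  | and F₁ F₂ ih₁ ih₂ | or F₁ F₂ ih₁ ih₂ =>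
    cases G <;> simp only [QFPA.encode, List.cons_append, List.append_assoc, List.cons.injEq,
        true_and, reduceCtorEq, false_and] at h
    obtain ⟨h1, h2⟩ := ih₁ h
    obtain ⟨h3, h4⟩ := ih₂ h2
    exact ⟨by rw [h1, h3], h4⟩

theorem LIACard.encode_injective : Function.Injective LIACard.encode := by
  rintro ⟨k, n, F₀, F⟩ ⟨k', n', F₀', F'⟩ h
  simp only [LIACard.encode, List.append_assoc] at h
  obtain ⟨rfl, h⟩ := encodeUnary_append_inj h
  obtain ⟨rfl, h⟩ := encodeUnary_append_inj h
  obtain ⟨rfl, h'⟩ := QFPA.encode_append_inj CardVar.encode_head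
    (fun _ _ _ _ => CardVar.encode_append_inj) h
  have key : ∀ (m : ℕ) (f g : Fin m → QFPA (Fin k)),
      (List.ofFn fun i => (f i).encode encodeFin).flatten =
        (List.ofFn fun i => (g i).encode encodeFin).flatten → f = g := by
    intro m
    induction m with
    | zero => intro f g _; exact Subsingleton.elim _ _
    | succ m ih =>
      intro f g hfg
      simp only [List.ofFn_succ, List.flatten_cons] at hfg
      obtain ⟨h1, h2⟩ := QFPA.encode_append_inj encodeFin_head
        (fun _ _ _ _ => encodeFin_append_inj) hfg
      have h3 := ih (fun i => f i.succ) (fun i => g i.succ) h2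
      funext i
      refine Fin.cases h1 (fun i => congrFun h3 i) i
  rw [key n F F' h']

/-- The satisfiability problem, as a language over the alphabet `Token`. -/
def LIACard.satLanguage (D : Set ℤ) : Language Token :=
  {s | ∃ φ : LIACard, φ.encode = s ∧ φ.Satisfiable D}

/-! ## The class NP -/

/-- The string of a pair of an input and a certificate. -/
def encodePair {Γ Δ : Type} (p : List Γ × List Δ) : List (Γ ⊕ Δ) :=
  p.1.map Sum.inl ++ p.2.map Sum.inr

/-- A language over a finite alphabet is in NP if there are a polynomial `p` and a verifier, a
predicate of pairs of strings that a (deterministic, multi-stack) Turing machine decides in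
polynomial time, such that a word `s` belongs to the language exactly if the verifier accepts
`(s, w)` for some certificate `w`, over a finite alphabet, of length at most `p (|s|)`. -/
def InNP {Γ : Type} [Fintype Γ] (L : Language Γ) : Prop :=
  ∃ (Δ : Type) (_ : Fintype Δ) (V : List Γ × List Δ → Bool) (p : Polynomial ℕ),
    Nonempty (Turing.TM2ComputableInPolyTime encodePair (fun b : Bool => [b]) V) ∧
    ∀ s : List Γ, s ∈ L ↔ ∃ w : List Δ, w.length ≤ p.eval s.length ∧ V (s, w) = true

/-! A certificate amounts to binary values for all variables and, for every constraint, a short list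
of pairs of a multiplicity and a solution of `Fᵢ` whose weighted sum is `u` and whose multiplicities
add up to `xᵢ`. Checking it is mere arithmetic. The point is that a satisfiable formula has such a
witness of polynomial size, although the number of summands need not be polynomial and the summands
need not be small.

Consider one constraint and the summands `y p` of `u`. The truth of `Fᵢ` is constant on a polyhedron
around `y p` that is cut out by its atoms or their negations (`QFPA.exists_system`). There `y p` is
a small integer point `a p` plus small integer directions of recession, all of which respect the
signs of `y p` (`exists_generators`). This rests on a Carathéodory argument for non-negative
solutions of homogeneous systems (`exists_ray`, `exists_sum_rays`), and the sizes are controlled by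
Siegel's lemma.

The directions of all summands are then pooled. By an exchange argument in the style of Eisenbrand
and Shmonin (`exists_sparse_sum`), their sum needs only polynomially many distinct directions, with
multiplicities. Each of these is given to one summand from which it came. The few summands that own
directions are kept individually and can absorb their directions with arbitrary multiplicities. The
other summands contribute only the points `a p`, and a second exchange, with an additional
coordinate `1` that counts summands, leaves few distinct points (`exists_template`).

In the resulting expression the multiplicities are free: every choice of them gives a sum of
solutions. So each constraint may be replaced by linear equations between `u`, `xᵢ` and the
multiplicities. Together with a polyhedron for `F₀` this is a linear system of polynomial size, and
`exists_generators` provides a small integer point of it (`exists_small_witness`).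

The verifier is a recursive nondeterministic program on stacks, and its certificate is the sequence
of rules that the program chooses. One generic Turing machine checks such sequences in linear time,
so no running time of the program has to be analysed (`inNP_of_rules`). What remains is partial
correctness, rule by rule (`Eval.sem`, `sound`), and a polynomial bound on the number of rules in a
run that is guided by a small witness (`run_main`). -/

/-! ## Nondeterministic stack programs -/

namespace StackProgram

/-- Instructions of a stack program with stacks `K`, stack alphabet `A` and procedures `N`. -/
inductive Instr (K A N : Type) : Type
  | push (k : K) (a : A)
  | pop (k : K) (a : A)
  | empty (k : K)
  | call (n : N)

def Instr.equivSum (K A N : Type) : Instr K A N ≃ ((K × A) ⊕ (K × A)) ⊕ (K ⊕ N) where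
  toFun
    | .push k a => .inl (.inl (k, a))
    | .pop k a => .inl (.inr (k, a))
    | .empty k => .inr (.inl k)
    | .call n => .inr (.inr n)
  invFun
    | .inl (.inl (k, a)) => .push k a
    | .inl (.inr (k, a)) => .pop k a
    | .inr (.inl k) => .empty k
    | .inr (.inr n) => .call n
  left_inv i := by cases i <;> rfl
  right_inv i := by rcases i with ((_ | _) | (_ | _)) <;> rfl

noncomputable instance {K A N : Type} [Fintype K] [Fintype A] [Fintype N] :
    Fintype (Instr K A N) :=
  Fintype.ofEquiv _ (Instr.equivSum K A N).symm

/-- A recursive nondeterministic program: every rule is a possible body of the procedure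
`lhs r`. -/
structure Rules (K A N R : Type) : Type where
  lhs : R → N
  rhs : R → List (Instr K A N)

section Eval

variable {K A N R : Type} [DecidableEq K]

/-- `Eval G p c w c'`: the instructions `p`, with the choice of rules `w`, lead from the stacks `c`
to the stacks `c'`. -/
inductive Eval (G : Rules K A N R) :
    List (Instr K A N) → (K → List A) → List R → (K → List A) → Prop
  | nil (c) : Eval G [] c [] c
  | push {k a p c w c'} (h : Eval G p (Function.update c k (a :: c k)) w c') :
      Eval G (.push k a :: p) c w c'
  | pop {k a l p c w c'} (hk : c k = a :: l) (h : Eval G p (Function.update c k l) w c') :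
      Eval G (.pop k a :: p) c w c'
  | empty {k p c w c'} (hk : c k = []) (h : Eval G p c w c') : Eval G (.empty k :: p) c w c'
  | call {r p c w c'} (h : Eval G (G.rhs r ++ p) c w c') :
      Eval G (.call (G.lhs r) :: p) c (r :: w) c'

theorem Eval.append {G : Rules K A N R} {p q c w c₁ w' c'} (h : Eval G p c w c₁)
    (h' : Eval G q c₁ w' c') : Eval G (p ++ q) c (w ++ w') c' := by
  induction h with
  | nil => simpa using h'
  | push _ ih => exact .push (ih h')
  | pop hk _ ih => exact .pop hk (ih h')
  | empty hk _ ih => exact .empty hk (ih h')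
  | call _ ih => exact .call (by simpa using ih h')

/-- A call puts its body in front of the pending instructions. Cutting the run where the body is
used up is what allows a call to be summarized by a relation between stacks. -/
theorem Eval.of_append {G : Rules K A N R} {p q c w c'} (h : Eval G (p ++ q) c w c') :
    ∃ w₁ w₂ c₁, w = w₁ ++ w₂ ∧ Eval G p c w₁ c₁ ∧ Eval G q c₁ w₂ c' := by
  generalize hs : p ++ q = s at h
  induction h generalizing p with
  | nil =>
    obtain ⟨rfl, rfl⟩ := List.append_eq_nil_iff.1 hs
    exact ⟨[], [], _, rfl, .nil _, .nil _⟩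
  | @push k a s c w c' h ih =>
    cases p with
    | nil => subst hs; exact ⟨[], _, _, rfl, .nil _, .push h⟩
    | cons i p =>
      obtain ⟨rfl, rfl⟩ := List.cons.inj hs
      obtain ⟨w₁, w₂, c₁, rfl, h₁, h₂⟩ := ih rfl
      exact ⟨w₁, w₂, c₁, rfl, .push h₁, h₂⟩
  | @pop k a l s c w c' hk h ih =>
    cases p with
    | nil => subst hs; exact ⟨[], _, _, rfl, .nil _, .pop hk h⟩
    | cons i p =>
      obtain ⟨rfl, rfl⟩ := List.cons.inj hs
      obtain ⟨w₁, w₂, c₁, rfl, h₁, h₂⟩ := ih rfl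
      exact ⟨w₁, w₂, c₁, rfl, .pop hk h₁, h₂⟩
  | @empty k s c w c' hk h ih =>
    cases p with
    | nil => subst hs; exact ⟨[], _, _, rfl, .nil _, .empty hk h⟩
    | cons i p =>
      obtain ⟨rfl, rfl⟩ := List.cons.inj hs
      obtain ⟨w₁, w₂, c₁, rfl, h₁, h₂⟩ := ih rfl
      exact ⟨w₁, w₂, c₁, rfl, .empty hk h₁, h₂⟩
  | @call r s c w c' h ih =>
    cases p with
    | nil => subst hs; exact ⟨[], _, _, rfl, .nil _, .call h⟩
    | cons i p =>
      obtain ⟨rfl, rfl⟩ := List.cons.inj hs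
      obtain ⟨w₁, w₂, c₁, rfl, h₁, h₂⟩ := ih (p := G.rhs r ++ p) (by simp)
      exact ⟨r :: w₁, w₂, c₁, rfl, .call h₁, h₂⟩

/-- The relation between stacks given by a list of instructions, when procedure calls are
interpreted by `S`. -/
def Sem (S : N → (K → List A) → (K → List A) → Prop) :
    List (Instr K A N) → (K → List A) → (K → List A) → Prop
  | [], c, c' => c' = c
  | .push k a :: p, c, c' => Sem S p (Function.update c k (a :: c k)) c'
  | .pop k a :: p, c, c' => ∃ l, c k = a :: l ∧ Sem S p (Function.update c k l) c'
  | .empty k :: p, c, c' => c k = [] ∧ Sem S p c c'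
  | .call n :: p, c, c' => ∃ c₁, S n c c₁ ∧ Sem S p c₁ c'

/-- Partial correctness: a specification that is preserved by every rule holds for every run. -/
theorem Eval.sem {G : Rules K A N R} {S : N → (K → List A) → (K → List A) → Prop}
    (hS : ∀ r c c', Sem S (G.rhs r) c c' → S (G.lhs r) c c') {p c w c'}
    (h : Eval G p c w c') : Sem S p c c' := by
  generalize hn : w.length = n
  -- A call consumes one choice, so its body and the rest of the run have strictly fewer choices.
  -- The inner induction on the derivation handles the instructions that consume none.
  induction n using Nat.strong_induction_on generalizing p c w c' with
  | _ n ih =>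
    subst hn
    induction h with
    | nil => rfl
    | push _ ih' => exact ih' ih
    | pop hk _ ih' => exact ⟨_, hk, ih' ih⟩
    | empty hk _ ih' => exact ⟨hk, ih' ih⟩
    | @call r p c w c' h ih' =>
      obtain ⟨w₁, w₂, c₁, rfl, h₁, h₂⟩ := h.of_append
      exact ⟨c₁, hS _ _ _ (ih _ (by simp) h₁ rfl), ih _ (by simp) h₂ rfl⟩

end Eval

/-! ### A Turing machine that checks runs of stack programs -/

/-- The stacks of the machine. -/
inductive Stk (K : Type) : Type
  | inp | ctl | out
  | data (k : K)
  deriving DecidableEq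

def Stk.equivSum (K : Type) : Stk K ≃ Fin 3 ⊕ K where
  toFun
    | .inp => .inl 0
    | .ctl => .inl 1
    | .out => .inl 2
    | .data k => .inr k
  invFun
    | .inl 0 => .inp
    | .inl 1 => .ctl
    | .inl 2 => .out
    | .inr k => .data k
  left_inv i := by cases i <;> rfl
  right_inv i := by
    rcases i with i | _
    · fin_cases i <;> rfl
    · rfl

noncomputable instance {K : Type} [Fintype K] : Fintype (Stk K) :=
  Fintype.ofEquiv _ (Stk.equivSum K).symm

/-- The labels of the machine. -/
inductive Lbl (K A N R : Type) : Type
  | load | exec | accept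
  | instr (i : Instr K A N)
  | rule (r : R)
  | clean (b : Bool)

def Lbl.equivSum (K A N R : Type) : Lbl K A N R ≃ (Fin 3 ⊕ Instr K A N) ⊕ (R ⊕ Bool) where
  toFun
    | .load => .inl (.inl 0)
    | .exec => .inl (.inl 1)
    | .accept => .inl (.inl 2)
    | .instr i => .inl (.inr i)
    | .rule r => .inr (.inl r)
    | .clean b => .inr (.inr b)
  invFun
    | .inl (.inl 0) => .load
    | .inl (.inl 1) => .exec
    | .inl (.inl 2) => .accept
    | .inl (.inr i) => .instr i
    | .inr (.inl r) => .rule r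
    | .inr (.inr b) => .clean b
  left_inv i := by cases i <;> rfl
  right_inv i := by
    rcases i with (i | _) | (_ | _)
    · fin_cases i <;> rfl
    all_goals rfl

noncomputable instance {K A N R : Type} [Fintype K] [Fintype A] [Fintype N] [Fintype R] :
    Fintype (Lbl K A N R) :=
  Fintype.ofEquiv _ (Lbl.equivSum K A N R).symm

section Machine

variable (K A N R : Type)

abbrev Alph : Stk K → Type
  | .inp => A ⊕ R
  | .ctl => Instr K A N
  | .out => Bool
  | .data _ => A

/-- The registers: the last symbols read from the input, the control stack and the data stacks,
and a flag. -/
abbrev Reg : Type := Option (A ⊕ R) × Option (Instr K A N) × Option A × Bool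

abbrev MStmt : Type := Turing.TM2.Stmt (Alph K A N R) (Lbl K A N R) (Reg K A N R)

variable {K A N R}

-- The recursion wraps the statement from the inside, so the first instruction is pushed last and
-- ends up on top.
open Turing.TM2.Stmt in
def pushCtl : List (Instr K A N) → MStmt K A N R → MStmt K A N R
  | [], q => q
  | i :: p, q => pushCtl p (.push .ctl (fun _ => i) q)

/-- The flag survives only if every stack was already empty when it was popped. -/
def popAll : List (Stk K) → MStmt K A N R → MStmt K A N R
  | [], q => q
  | k :: ks, q =>
    .pop k (fun v x => (v.1, v.2.1, v.2.2.1, v.2.2.2 && x.isNone)) (popAll ks q)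

open Classical in
open Turing.TM2.Stmt in
noncomputable def code [Fintype K] [Inhabited A] (G : Rules K A N R) (kin : K) (main : N) :
    Lbl K A N R → MStmt K A N R
  | .load =>
    peek .inp (fun v x => (x, v.2)) <|
      branch (fun v => v.1.elim false Sum.isLeft)
        (pop .inp (fun v _ => v) <|
          -- The branch has just seen a letter of the input word in the register, so the default
          -- symbols are never pushed.
          push (.data kin) (fun v => v.1.elim default (Sum.elim id fun _ => default)) <|
          goto fun _ => .load)
        (push .ctl (fun _ => .call main) <| goto fun _ => .exec)
  | .exec =>
    pop .ctl (fun v x => (v.1, x, v.2.2)) <|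
      goto fun v => v.2.1.elim .accept .instr
  -- Unused rules in the certificate lead to rejection, in accordance with `Eval`, which uses up the
  -- list of choices exactly.
  | .accept =>
    peek .inp (fun v x => (x, v.2)) <| goto fun v => .clean v.1.isNone
  | .instr (.push k a) => push (.data k) (fun _ => a) <| goto fun _ => .exec
  | .instr (.pop k a) =>
    pop (.data k) (fun v x => (v.1, v.2.1, x, v.2.2.2)) <|
      goto fun v => if v.2.2.1 = some a then .exec else .clean false
  | .instr (.empty k) =>
    peek (.data k) (fun v x => (v.1, v.2.1, x, v.2.2.2)) <|
      goto fun v => if v.2.2.1 = none then .exec else .clean false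
  | .instr (.call n) =>
    pop .inp (fun v x => (x, v.2)) <|
      goto fun v => v.1.elim (.clean false)
        (Sum.elim (fun _ => .clean false) fun r => if G.lhs r = n then .rule r else .clean false)
  | .rule r => pushCtl (G.rhs r) <| goto fun _ => .exec
  -- A halting configuration must be empty except for the output, with the registers reset. All
  -- other stacks are popped in parallel until one round finds them all empty.
  | .clean b =>
    load (fun v => (v.1, v.2.1, v.2.2.1, true)) <|
      popAll (.inp :: .ctl :: (Finset.univ.toList.map .data)) <|
      branch (fun v => v.2.2.2)
        (load (fun _ => (none, none, none, true)) <| push .out (fun _ => b) halt)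
        (goto fun _ => .clean b)

noncomputable def machine [Fintype K] [DecidableEq K] [Fintype A] [Inhabited A] [Fintype N]
    [Fintype R] (G : Rules K A N R) (kin : K) (main : N) : Turing.FinTM2 where
  K := Stk K
  k₀ := .inp
  k₁ := .out
  Γ := Alph K A N R
  Λ := Lbl K A N R
  main := .load
  σ := Reg K A N R
  initialState := (none, none, none, true)
  Γk₀Fin := inferInstanceAs (Fintype (A ⊕ R))
  m := code G kin main

/-- The stacks of the machine, all together. -/
def stks (i : List (A ⊕ R)) (p : List (Instr K A N)) (c : K → List A) (o : List Bool) :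
    ∀ k : Stk K, List (Alph K A N R k)
  | .inp => i
  | .ctl => p
  | .out => o
  | .data k => c k

section

variable (i : List (A ⊕ R)) (p : List (Instr K A N)) (c : K → List A) (o : List Bool)

@[simp] theorem stks_inp : stks i p c o .inp = i := rfl
@[simp] theorem stks_ctl : stks i p c o .ctl = p := rfl
@[simp] theorem stks_out : stks i p c o .out = o := rfl
@[simp] theorem stks_data (k) : stks i p c o (.data k) = c k := rfl

variable [DecidableEq K]

@[simp] theorem update_stks_inp (l : List (A ⊕ R)) :
    Function.update (stks i p c o) .inp l = stks l p c o := by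
  funext k; cases k <;> simp [Function.update, stks]

@[simp] theorem update_stks_ctl (l : List (Instr K A N)) :
    Function.update (stks i p c o) .ctl l = stks i l c o := by
  funext k; cases k <;> simp [Function.update, stks]

@[simp] theorem update_stks_out (l : List Bool) :
    Function.update (stks i p c o) .out l = stks i p c l := by
  funext k; cases k <;> simp [Function.update, stks]

@[simp] theorem update_stks_data (k : K) (l : List A) :
    Function.update (stks i p c o) (.data k) l = stks i p (Function.update c k l) o := by
  funext k'
  cases k' with
  | data k' =>
    by_cases h : k' = k
    · subst h; simp
    · simp [Function.update, h]
  | _ => simp [Function.update]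

end

abbrev MCfg (K A N R : Type) : Type :=
  Turing.TM2.Cfg (Alph K A N R) (Lbl K A N R) (Reg K A N R)

variable [DecidableEq K]

theorem stepAux_pushCtl (q : MStmt K A N R) (v i p c o) (l : List (Instr K A N)) :
    Turing.TM2.stepAux (pushCtl l q) v (stks i p c o) =
      Turing.TM2.stepAux q v (stks i (l ++ p) c o) := by
  induction l generalizing q p with
  | nil => rfl
  | cons a l ih => simp [pushCtl, ih]

variable [Fintype K] [Inhabited A]

/-- The machine gets from `a` to `b` in at most `n` steps. -/
def Within (G : Rules K A N R) (kin : K) (main : N) (n : ℕ) (a b : MCfg K A N R) : Prop :=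
  ∃ m ≤ n, (flip bind (Turing.TM2.step (code G kin main)))^[m] (some a) = some b

variable {G : Rules K A N R} {kin : K} {main : N}

theorem Within.refl (n : ℕ) (a : MCfg K A N R) : Within G kin main n a a := ⟨0, n.zero_le, rfl⟩

theorem Within.step {n : ℕ} {l v S} {b : MCfg K A N R}
    (h : Within G kin main n (Turing.TM2.stepAux (code G kin main l) v S) b) :
    Within G kin main (n + 1) ⟨some l, v, S⟩ b := by
  obtain ⟨m, hm, h⟩ := h
  exact ⟨m + 1, by omega, by simpa [flip] using h⟩

theorem Within.mono {n n' : ℕ} {a b : MCfg K A N R} (h : Within G kin main n a b) (hn : n ≤ n') :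
    Within G kin main n' a b := by
  obtain ⟨m, hm, h⟩ := h
  exact ⟨m, hm.trans hn, h⟩

theorem stepAux_popAll_data (q : MStmt K A N R) (x y z b i p o) (ks : List K) (hks : ks.Nodup)
    (c : K → List A) :
    Turing.TM2.stepAux (popAll (ks.map .data) q) (x, y, z, b) (stks i p c o) =
      Turing.TM2.stepAux q (x, y, z, b && decide (∀ k ∈ ks, c k = []))
        (stks i p (fun k => if k ∈ ks then (c k).tail else c k) o) := by
  induction ks generalizing b c with
  | nil => simp [popAll]
  | cons k ks ih =>
    rw [List.nodup_cons] at hks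
    simp only [List.map_cons, popAll, Turing.TM2.stepAux, stks_data, update_stks_data,
      ih _ hks.2]
    have h1 : (fun j => if j ∈ ks then ((Function.update c k (c k).tail) j).tail
        else (Function.update c k (c k).tail) j) =
        fun j => if j ∈ k :: ks then (c j).tail else c j := by
      funext j
      by_cases hj : j = k
      · subst hj; simp [hks.1]
      · simp [hj]
    have h2 : (∀ j ∈ ks, (Function.update c k (c k).tail) j = []) ↔ ∀ j ∈ ks, c j = [] :=
      forall₂_congr fun j hj => by
        rw [Function.update_of_ne (by rintro rfl; exact hks.1 hj)]
    rw [h1]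
    congr 4
    rw [Bool.and_assoc]
    congr 1
    cases hc : c k with
    | nil =>
      rw [hc] at h2
      simp only [List.mem_cons, forall_eq_or_imp, hc, true_and, List.head?_nil,
        Option.isNone_none, Bool.true_and]
      exact decide_eq_decide.2 h2
    | cons a l => simp [hc]

/-- The number `n` bounds all heights, and the additional step is the round that finds everything
empty. -/
theorem within_clean (b : Bool) (n : ℕ) (v) (i : List (A ⊕ R)) (p : List (Instr K A N))
    (c : K → List A) (hi : i.length ≤ n) (hp : p.length ≤ n) (hc : ∀ k, (c k).length ≤ n) :
    Within G kin main (n + 1) ⟨some (.clean b), v, stks i p c []⟩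
      ⟨none, (none, none, none, true), stks [] [] (fun _ => []) [b]⟩ := by
  induction n generalizing v i p c with
  | zero =>
    apply Within.step
    obtain rfl : i = [] := by simpa using hi
    obtain rfl : p = [] := by simpa using hp
    obtain rfl : c = fun _ => [] := by funext k; simpa using hc k
    simp only [code, Turing.TM2.stepAux, popAll]
    simp [stepAux_popAll_data _ _ _ _ _ _ _ _ _ (Finset.nodup_toList _)]
    exact Within.refl _ _
  | succ n ih =>
    apply Within.step
    simp only [code, Turing.TM2.stepAux, popAll]
    simp only [stks_inp, update_stks_inp, stks_ctl, update_stks_ctl]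
    rw [stepAux_popAll_data _ _ _ _ _ _ _ _ _ (Finset.nodup_toList _)]
    simp only [Turing.TM2.stepAux, Finset.mem_toList, Finset.mem_univ, if_true]
    rcases Bool.eq_false_or_eq_true (true && i.head?.isNone && p.head?.isNone &&
      decide (∀ k : K, True → c k = [])) with h | h
    · rw [h]
      simp only [Bool.and_eq_true, decide_eq_true_eq, true_and, Option.isNone_iff_eq_none,
        List.head?_eq_none_iff] at h
      obtain ⟨⟨rfl, rfl⟩, h3⟩ := h
      obtain rfl : c = fun _ => [] := by funext k; simpa using h3 k
      simp
      exact Within.refl _ _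
    · rw [h]
      apply ih <;> simp <;> omega

-- The potential `p.length + (C + 1) * w.length` drops with every instruction: a call adds at most
-- `C` instructions but consumes a rule. Each instruction takes at most three machine steps. The
-- height `h` grows only at a push, which needs two steps, so the third one pays for the later
-- cleaning.
open Classical in
theorem within_exec {C : ℕ} (hC : ∀ r, (G.rhs r).length ≤ C) (n : ℕ) (v) (w : List R)
    (p : List (Instr K A N)) (c : K → List A) (h : ℕ) (hc : ∀ k, (c k).length ≤ h)
    (hn : p.length + (C + 1) * w.length ≤ n) :
    Within G kin main (3 * n + w.length + h + 4) ⟨some .exec, v, stks (w.map .inr) p c []⟩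
      ⟨none, (none, none, none, true),
        stks [] [] (fun _ => []) [decide (∃ c', Eval G p c w c')]⟩ := by
  induction n using Nat.strong_induction_on generalizing v w p c h with
  | _ n ih =>
  have hw : w.length ≤ (C + 1) * w.length := Nat.le_mul_of_pos_left _ (by omega)
  apply Within.step
  cases p with
  | nil =>
    simp only [code, Turing.TM2.stepAux, stks_ctl, List.head?_nil, Option.elim, List.tail_nil,
      update_stks_ctl]
    apply Within.step
    simp only [code, Turing.TM2.stepAux, stks_inp]
    have : decide (∃ c', Eval G [] c w c') = (w.map (Sum.inr (α := A))).head?.isNone := by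
      cases w with
      | nil => simpa using ⟨c, .nil c⟩
      | cons r w => simp; rintro x ⟨⟩
    rw [this]
    refine Within.mono (within_clean _ (w.length + h) _ _ _ _ ?_ ?_ ?_) (by omega)
    · simp
    · simp
    · intro k; have := hc k; omega
  | cons i p =>
    simp only [code, Turing.TM2.stepAux, stks_ctl, List.head?_cons, Option.elim, List.tail_cons,
      update_stks_ctl]
    simp only [List.length_cons] at hn
    apply Within.step
    cases i with
    | push k a =>
      simp only [code, Turing.TM2.stepAux, stks_data, update_stks_data]
      have e : (∃ c', Eval G (.push k a :: p) c w c') ↔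
          ∃ c', Eval G p (Function.update c k (a :: c k)) w c' :=
        ⟨fun ⟨c', h⟩ => by cases h with | push h => exact ⟨c', h⟩, fun ⟨c', h⟩ => ⟨c', .push h⟩⟩
      simp only [e]
      refine Within.mono (ih (n - 1) (by omega) _ _ _ _ (h + 1) ?_ (by omega)) (by omega)
      intro j
      have := hc j
      by_cases hj : j = k
      · subst hj; simpa using this
      · simp [hj]; omega
    | pop k a =>
      simp only [code, Turing.TM2.stepAux, stks_data, update_stks_data]
      by_cases hk : (c k).head? = some a
      · obtain ⟨l, hl⟩ : ∃ l, c k = a :: l := by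
          cases hck : c k <;> simp_all
        have e : (∃ c', Eval G (.pop k a :: p) c w c') ↔
            ∃ c', Eval G p (Function.update c k l) w c' := by
          refine ⟨fun ⟨c', h⟩ => ?_, fun ⟨c', h⟩ => ⟨c', .pop hl h⟩⟩
          cases h with
          | pop hk' h => rw [hl] at hk'; cases hk'; exact ⟨c', h⟩
        simp only [e, hl, if_true, List.tail_cons, List.head?_cons]
        refine Within.mono (ih (n - 1) (by omega) _ _ _ _ h ?_ (by omega)) (by omega)
        intro j
        have := hc j
        by_cases hj : j = k
        · subst hj; simp [hl] at this ⊢; omega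
        · simp [hj]; omega
      · have e : ¬ ∃ c', Eval G (.pop k a :: p) c w c' := by
          rintro ⟨c', h⟩
          cases h with
          | pop hk' h => simp [hk'] at hk
        simp only [e, hk, if_false, decide_false]
        refine Within.mono (within_clean _ (n + h) _ _ _ _ ?_ ?_ ?_) (by omega)
        · simp; omega
        · omega
        · intro j
          have := hc j
          by_cases hj : j = k
          · subst hj; simp; omega
          · simp [hj]; omega
    | empty k =>
      simp only [code, Turing.TM2.stepAux, stks_data]
      by_cases hk : c k = []
      · have e : (∃ c', Eval G (.empty k :: p) c w c') ↔ ∃ c', Eval G p c w c' := by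
          refine ⟨fun ⟨c', h⟩ => ?_, fun ⟨c', h⟩ => ⟨c', .empty hk h⟩⟩
          cases h with
          | empty hk' h => exact ⟨c', h⟩
        simp only [e, hk, if_true, List.head?_nil]
        exact Within.mono (ih (n - 1) (by omega) _ _ _ _ h hc (by omega)) (by omega)
      · have e : ¬ ∃ c', Eval G (.empty k :: p) c w c' := by
          rintro ⟨c', h⟩
          cases h with
          | empty hk' h => exact hk hk'
        simp only [e, List.head?_eq_none_iff, hk, if_false, decide_false]
        refine Within.mono (within_clean _ (n + h) _ _ _ _ ?_ ?_ ?_) (by omega)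
        · simp; omega
        · omega
        · intro j; have := hc j; omega
    | call m =>
      simp only [code, Turing.TM2.stepAux, stks_inp, update_stks_inp]
      have fail (hf : ¬ ∃ c', Eval G (.call m :: p) c w c') (v) (w' : List R)
          (hw' : w'.length ≤ w.length) :
          Within G kin main (3 * n + w.length + h + 2)
            ⟨some (.clean false), v, stks (w'.map .inr) p c []⟩
            ⟨none, (none, none, none, true),
              stks [] [] (fun _ => []) [decide (∃ c', Eval G (.call m :: p) c w c')]⟩ := by
        simp only [hf, decide_false]
        refine Within.mono (within_clean _ (n + h) _ _ _ _ ?_ ?_ ?_) (by omega)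
        · simp; omega
        · omega
        · intro j; have := hc j; omega
      cases w with
      | nil => exact fail (by rintro ⟨c', h⟩; cases h) _ [] le_rfl
      | cons r w =>
        simp only [List.map_cons, List.head?_cons, Option.elim, Sum.elim_inr, List.tail_cons]
        by_cases hr : G.lhs r = m
        · subst hr
          simp only [if_true]
          apply Within.step
          simp only [code, stepAux_pushCtl, Turing.TM2.stepAux]
          have e : (∃ c', Eval G (.call (G.lhs r) :: p) c (r :: w) c') ↔
              ∃ c', Eval G (G.rhs r ++ p) c w c' := by
            refine ⟨fun ⟨c', h⟩ => ?_, fun ⟨c', h⟩ => ⟨c', .call h⟩⟩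
            generalize hm : Instr.call (G.lhs r) :: p = q, hw : r :: w = w' at h
            cases h <;> simp_all
            exact ⟨c', by assumption⟩
          simp only [e]
          have := hC r
          simp only [List.length_cons, Nat.mul_add] at hn ⊢
          refine Within.mono (ih (n - 1) (by omega) _ _ _ _ h hc ?_) (by omega)
          simp only [List.length_append]
          omega
        · simp only [if_neg hr]
          refine fail ?_ _ w (by simp)
          rintro ⟨c', h⟩
          generalize hm : Instr.call m :: p = q, hw : r :: w = w' at h
          cases h <;> simp_all

/-- The initial stacks of a stack program, with the input on the stack `kin`, last symbol on
top. -/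
def start (kin : K) (s : List A) : K → List A := Function.update (fun _ => []) kin s.reverse

open Classical in
theorem within_load {C : ℕ} (hC : ∀ r, (G.rhs r).length ≤ C) (v) (s t : List A) (w : List R) :
    Within G kin main (s.length + (3 * (1 + (C + 1) * w.length) + w.length +
        (s.length + t.length) + 4) + 1)
      ⟨some .load, v, stks (s.map .inl ++ w.map .inr) []
        (Function.update (fun _ => []) kin t) []⟩
      ⟨none, (none, none, none, true), stks [] [] (fun _ => [])
        [decide (∃ c', Eval G [.call main]
          (Function.update (fun _ => []) kin (s.reverse ++ t)) w c')]⟩ := by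
  induction s generalizing t v with
  | nil =>
    apply Within.step
    have : (Option.elim (List.map (Sum.inr (α := A)) w).head? false Sum.isLeft) = false := by
      cases w <;> simp
    simp only [code, Turing.TM2.stepAux, stks_inp, List.map_nil, List.nil_append, this]
    simp only [cond_false, stks_ctl, update_stks_ctl, List.reverse_nil, List.nil_append,
      List.length_nil]
    refine Within.mono (within_exec hC _ _ _ _ _ t.length ?_ le_rfl) ?_
    · intro k
      by_cases hk : k = kin
      · subst hk; simp
      · simp [hk]
    · simp
  | cons a s ih =>
    apply Within.step
    simp only [code, Turing.TM2.stepAux, stks_inp, List.map_cons, List.cons_append,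
      List.head?_cons, Option.elim, Sum.isLeft, cond_true, update_stks_inp, List.tail_cons,
      stks_data, update_stks_data, Sum.elim_inl, id, Function.update_self, Function.update_idem]
    refine Within.mono (by simpa using ih _ (a :: t)) ?_
    simp
    omega

open Classical in
/-- The verifier of a stack program. -/
noncomputable def verifier (G : Rules K A N R) (kin : K) (main : N)
    (x : List A × List R) : Bool :=
  decide (∃ c', Eval G [.call main] (start kin x.1) x.2 c')

/-- The running time is linear, because the certificate lists all calls and the rules have bodies of
bounded length. -/
theorem nonempty_computable_verifier [Fintype A] [Fintype N] [Fintype R] (G : Rules K A N R)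
    (kin : K) (main : N) :
    Nonempty (Turing.TM2ComputableInPolyTime encodePair (fun b : Bool => [b])
      (verifier G kin main)) := by
  classical
  obtain ⟨C, hC⟩ : ∃ C, ∀ r, (G.rhs r).length ≤ C :=
    ⟨Finset.univ.sup fun r => (G.rhs r).length,
      fun r => Finset.le_sup (f := fun r => (G.rhs r).length) (Finset.mem_univ r)⟩
  have key (x : List A × List R) :
      ∃ m ≤ ((3 * (C + 1) + 3) * (encodePair x).length + 8 : ℕ),
        (flip bind (machine G kin main).step)^[m]
          (some (Turing.initList (machine G kin main) (encodePair x))) =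
        some (Turing.haltList (machine G kin main) [verifier G kin main x]) := by
    obtain ⟨m, hm, h⟩ := within_load (kin := kin) (main := main) hC (none, none, none, true) x.1 []
      x.2
    refine ⟨m, hm.trans ?_, ?_⟩
    · simp [encodePair]
      nlinarith
    · have e1 : Turing.initList (machine G kin main) (encodePair x) =
          (⟨some .load, (none, none, none, true), stks (x.1.map .inl ++ x.2.map .inr) []
            (Function.update (fun _ => []) kin []) []⟩ : MCfg K A N R) := by
        simp only [Turing.initList]
        congr 1
        funext k
        cases k with
        | data k => by_cases hk : k = kin <;> simp [machine, stks, Function.update, hk]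
        | _ => rfl
      have e2 : Turing.haltList (machine G kin main) [verifier G kin main x] =
          (⟨none, (none, none, none, true), stks [] [] (fun _ => [])
            [verifier G kin main x]⟩ : MCfg K A N R) := by
        simp only [Turing.haltList]
        congr 1
        funext k
        cases k with
        | out => rfl
        | _ => simp [machine, stks]
      rw [e1, e2]
      rw [List.append_nil] at h
      exact h
  choose m hm h using key
  exact ⟨{
    tm := machine G kin main
    inputAlphabet := Equiv.refl _
    outputAlphabet := Equiv.refl _
    time := Polynomial.C (3 * (C + 1) + 3) * Polynomial.X + 8
    outputsFun := fun x =>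
      { steps := m x
        evals_in_steps := by
          refine Eq.trans (congrArg (fun l => (flip bind (machine G kin main).step)^[m x]
            (some (Turing.initList (machine G kin main) l))) (List.map_id _)) ((h x).trans ?_)
          exact congrArg (fun l => some (Turing.haltList (machine G kin main) l))
            (List.map_id _).symm
        steps_le_m := by simpa using hm x } }⟩

/-- Languages that are accepted by stack programs with certificates of polynomial length are in
NP. -/
theorem inNP_of_rules [Fintype A] [Fintype N] [Fintype R] (G : Rules K A N R)
    (kin : K) (main : N) (L : Language A) (p : Polynomial ℕ)
    (sound : ∀ s w c', Eval G [.call main] (start kin s) w c' → s ∈ L)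
    (complete : ∀ s ∈ L, ∃ w c', w.length ≤ p.eval s.length ∧
      Eval G [.call main] (start kin s) w c') :
    InNP L := by
  refine ⟨R, inferInstance, verifier G kin main, p, nonempty_computable_verifier G kin main,
    fun s => ⟨fun hs => ?_, ?_⟩⟩
  · obtain ⟨w, c', hw, h⟩ := complete s hs
    exact ⟨w, hw, by simpa [verifier] using ⟨c', h⟩⟩
  · rintro ⟨w, -, h⟩
    obtain ⟨c', h⟩ : ∃ c', Eval G [.call main] (start kin s) w c' := by simpa [verifier] using h
    exact sound s w c' h

end Machine

end StackProgram

/-! ## The verifier for linear arithmetic with sum cardinalities -/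

namespace CardVerifier

open StackProgram Token

/-- The stacks of the verifier: `I` holds the text that is being read and `J` a copy of it; `U`,
`X`, `W` hold the values of the variables; `US`, `XS` save the values of `u` and of the exponents;
`R` holds what remains to be represented as a sum; `A`, `B` are for arithmetic, `T` for
multiplicands and `M` for multiplicities. -/
inductive Stack : Type
  | I | J | U | X | W | US | XS | R | A | B | T | M
  deriving DecidableEq

instance : Fintype Stack where
  elems := {.I, .J, .U, .X, .W, .US, .XS, .R, .A, .B, .T, .M}
  complete a := by cases a <;> decide

/-- Comparisons of an integer with zero. -/
inductive Rel : Type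
  | le | gt | eq | lt
  deriving DecidableEq

instance : Fintype Rel where
  elems := {.le, .gt, .eq, .lt}
  complete a := by cases a <;> decide

def Rel.Holds : Rel → ℤ → Prop
  | .le, z => z ≤ 0
  | .gt, z => 0 < z
  | .eq, z => z = 0
  | .lt, z => z < 0

instance (r : Rel) (z : ℤ) : Decidable (r.Holds z) := by
  cases r <;> unfold Rel.Holds <;> infer_instance

/-- The sources of multiplicands: the number `±1`, a term up to sign, a negated component of the
vector on the stack `U`. -/
inductive Mode : Type
  | const (neg : Bool) | term (neg : Bool) | vec
  deriving DecidableEq, Fintype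

inductive Proc : Type
  | main | rev | fail
  | guess (nn : Bool) (k : Stack)
  | init (nn : Bool) (k : Stack)
  | guessAll (k : Stack)
  | lookup (k : Stack)
  | skip (k : Stack)
  | copyNum (s d : Stack)
  | moveNum (neg : Bool) (s d : Stack)
  | dropNum (s : Stack)
  | add (c : SignType)
  | chk (r : Rel) (c : SignType)
  | mul (m : Mode) (ok : Bool)
  | base (m : Mode)
  | term
  | tf (b : Bool)
  | copyAll (s d : Stack)
  | moveAll (s d : Stack)
  | clearAll (s : Stack)
  | vecUpd | allZero | loop | phases
  deriving Fintype

set_option synthInstance.maxSize 1000 in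
set_option synthInstance.maxHeartbeats 200000 in
inductive Rule : Type
  | main
  | revStep (a : Token) | revDone
  | guessStep (nn : Bool) (k : Stack) (d : SignType) | guessDone (nn : Bool) (k : Stack)
  | initStep (nn : Bool) (k : Stack) | initDone (nn : Bool) (k : Stack)
  | guessAllStep (k : Stack) | guessAllDone (k : Stack)
  | lookupStep (k : Stack) | lookupDone (k : Stack)
  | skipStep (k : Stack) (d : SignType) | skipDone (k : Stack)
  | copyNumStep (s d : Stack) (e : SignType) | copyNumDone (s d : Stack)
  | moveNumStep (neg : Bool) (s d : Stack) (e : SignType) | moveNumDone (neg : Bool) (s d : Stack)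
  | dropNumStep (s : Stack) (e : SignType) | dropNumDone (s : Stack)
  | addStep (c x y : SignType) | addPadA (c : SignType) | addPadB (c : SignType)
  | addDone (c : SignType)
  | chkStep (r : Rel) (c d : SignType) | chkDone (r : Rel) (c : SignType)
  | mulStep (m : Mode) (ok : Bool) (b : Bool) | mulDone (m : Mode) (ok : Bool)
  | base (m : Mode)
  | const (neg : Bool) | smul (neg : Bool) | sum | varU | varX | varV
  | le (b : Bool) | eq (r : Rel) | not (b : Bool) | and (b₁ b₂ : Bool) | or (b₁ b₂ : Bool)
  | copyAllStep (s d : Stack) (a : Token) | copyAllDone (s d : Stack)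
  | moveAllStep (s d : Stack) (a : Token) | moveAllDone (s d : Stack)
  | clearAllStep (s : Stack) (a : Token) | clearAllDone (s : Stack)
  | vecUpdStep | vecUpdDone
  | allZeroStep | allZeroDone
  | item | finish (b : Bool)
  | phase | phasesDone
  deriving Fintype

/-- Numbers are written with the digits `-1, 0, 1`, least significant first. -/
def dig : SignType → Token
  | .neg => minus
  | .zero => bit0
  | .pos => bit1

def bit (b : Bool) : Token := bif b then bit1 else bit0

def sgn (neg : Bool) : Token := bif neg then minus else plus

def flipDig (neg : Bool) (d : SignType) : SignType := bif neg then -d else d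

/-- Sum digit and carry. -/
def sumDig (c x y : SignType) : SignType :=
  match (c : ℤ) + x + y with
  | -3 => -1
  | -1 => -1
  | 1 => 1
  | 3 => 1
  | _ => 0

def carry (c x y : SignType) : SignType :=
  match (c : ℤ) + x + y with
  | -3 => -1
  | -2 => -1
  | 2 => 1
  | 3 => 1
  | _ => 0

/-- The carry in the comparison of a number with zero. -/
def Rel.next : Rel → SignType → SignType → Option SignType
  | .le, c, d | .gt, c, d =>
      some (if (c : ℤ) + d ≤ -2 then -1 else if (c : ℤ) + d ≤ 0 then 0 else 1)
  | .lt, c, d => some (if (c : ℤ) + d < 0 then -1 else if (c : ℤ) + d < 2 then 0 else 1)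
  | .eq, c, d => if c = d then some c else if (c : ℤ) + d = 0 then some 0 else none

open Stack Proc Instr in
/-- The program of the verifier. If `nat` holds, then all numbers are natural numbers. -/
def prog (nat : Bool) : Rules Stack Token Proc Rule where
  lhs
    | .main => .main
    | .revStep _ | .revDone => .rev
    | .guessStep nn k _ | .guessDone nn k => .guess nn k
    | .initStep nn k | .initDone nn k => .init nn k
    | .guessAllStep k | .guessAllDone k => .guessAll k
    | .lookupStep k | .lookupDone k => .lookup k
    | .skipStep k _ | .skipDone k => .skip k
    | .copyNumStep s d _ | .copyNumDone s d => .copyNum s d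
    | .moveNumStep neg s d _ | .moveNumDone neg s d => .moveNum neg s d
    | .dropNumStep s _ | .dropNumDone s => .dropNum s
    | .addStep c _ _ | .addPadA c | .addPadB c | .addDone c => .add c
    | .chkStep r c _ | .chkDone r c => .chk r c
    | .mulStep m ok _ | .mulDone m ok => .mul m ok
    | .base m => .base m
    | .const _ | .smul _ | .sum | .varU | .varX | .varV => .term
    | .le b => .tf b
    | .eq r => .tf (r = .eq)
    | .not b => .tf b
    | .and b₁ b₂ => .tf (b₁ && b₂)
    | .or b₁ b₂ => .tf (b₁ || b₂)
    | .copyAllStep s d _ | .copyAllDone s d => .copyAll s d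
    | .moveAllStep s d _ | .moveAllDone s d => .moveAll s d
    | .clearAllStep s _ | .clearAllDone s => .clearAll s
    | .vecUpdStep | .vecUpdDone => .vecUpd
    | .allZeroStep | .allZeroDone => .allZero
    | .item | .finish _ => .loop
    | .phase | .phasesDone => .phases
  rhs
    -- The loader leaves the last symbol on top, hence the reversal. The unary numbers `k` and `n`
    -- then determine how many values are guessed on `U` and `X`. After `F₀` has been checked, `W`
    -- is discarded and `u` and the exponents are saved, since `U` is needed for the summands.
    | .main => [call rev, call (.init nat U), call (.init true X), call (guessAll W),
        call (tf true), call (clearAll W), call (moveAll U US), call (moveAll X XS), call phases]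
    | .revStep a => [pop J a, push I a, call rev]
    | .revDone => [empty J]
    -- Squaring a digit excludes `-1`, so that the number is non-negative.
    | .guessStep nn k d =>
        [call (guess nn k), push k (dig (if nn then d * d else d))]
    | .guessDone _ k => [push k sep]
    | .initStep nn k => [pop I tick, call (.init nn k), call (guess nn k)]
    | .initDone _ _ => [pop I sep]
    | .guessAllStep k => [call (guessAll k), call (guess nat k)]
    | .guessAllDone _ => []
    | .lookupStep k => [pop I tick, call (skip k)]
    | .lookupDone k => [pop I sep, call (copyNum k A)]
    | .skipStep k d => [pop k (dig d), call (skip k), push k (dig d)]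
    | .skipDone k => [pop k sep, call (lookup k), push k sep]
    | .copyNumStep s d e => [pop s (dig e), call (copyNum s d), push s (dig e), push d (dig e)]
    | .copyNumDone s d => [pop s sep, push s sep, push d sep]
    | .moveNumStep neg s d e =>
        [pop s (dig e), call (moveNum neg s d), push d (dig (flipDig neg e))]
    | .moveNumDone _ s d => [pop s sep, push d sep]
    | .dropNumStep s e => [pop s (dig e), call (dropNum s)]
    | .dropNumDone s => [pop s sep]
    -- Sum digits are pushed after the recursive call, so the least significant one ends on top. An
    -- exhausted number is padded with zeros, and the last carry becomes the leading digit.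
    | .addStep c x y =>
        [pop A (dig x), pop B (dig y), call (.add (carry c x y)), push A (dig (sumDig c x y))]
    | .addPadA c => [pop A sep, push A sep, push A bit0, call (.add c)]
    | .addPadB c => [pop B sep, push B sep, push B bit0, call (.add c)]
    | .addDone c => [pop A sep, pop B sep, push A sep, push A (dig c)]
    | .chkStep r c d => [pop A (dig d), call ((r.next c d).elim fail (chk r))]
    | .chkDone r c => if r.Holds c then [pop A sep] else [call fail]
    -- Horner's scheme: the multiplicand follows the digits in the text, so it is obtained at the
    -- bottom of the recursion, and each return doubles the product and possibly adds the
    -- multiplicand. The flag records whether the digits may end here, that is, whether the last one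
    -- was `1`. Initially it is true only for the sign plus, so neither leading zeros nor a negative
    -- zero is accepted. Multiplicities, in mode `vec`, need not be canonical.
    | .mulStep m _ b => [pop I (bit b), call (mul m b), push A bit0] ++
        bif b then [call (copyNum T B), call (.add 0)] else []
    | .mulDone m ok => if ok || m = .vec then [pop I sep, call (base m), push A sep]
        else [call fail]
    | .base (.const neg) => [push T sep, push T (dig (flipDig neg 1))]
    | .base (.term neg) => [call term, call (moveNum neg A T)]
    -- The negation turns the later addition into a subtraction from the residue.
    | .base .vec => [call (moveNum true U T)]
    | .const neg => [pop I Token.const, pop I (sgn neg), call (mul (.const neg) !neg),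
        call (dropNum T)]
    | .smul neg => [pop I Token.smul, pop I (sgn neg), call (mul (.term neg) !neg),
        call (dropNum T)]
    | .sum => [pop I Token.add, call term, call term, call (moveNum false A B), call (.add 0)]
    | .varU => [pop I Token.varU, call (lookup U)]
    | .varX => [pop I Token.varX, call (lookup X)]
    | .varV => [pop I Token.varV, call (lookup W)]
    | .le b => [pop I Token.le, call term, call term, call (moveNum true A B), call (.add 0),
        call (chk (bif b then .le else .gt) 0)]
    -- An equation is confirmed by `eq` and refuted by `lt` or `gt`. The relation `le` decides
    -- neither, so this rule is blocked.
    | .eq .le => [call fail]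
    | .eq r => [pop I Token.eq, call term, call term, call (moveNum true A B), call (.add 0),
        call (chk r 0)]
    | .not b => [pop I Token.not, call (tf !b)]
    -- The certificate chooses the truth values of both subformulas. Both are always evaluated,
    -- because the text has to be consumed and parsed.
    | .and b₁ b₂ => [pop I Token.and, call (tf b₁), call (tf b₂)]
    | .or b₁ b₂ => [pop I Token.or, call (tf b₁), call (tf b₂)]
    | .copyAllStep s d a => [pop s a, call (copyAll s d), push s a, push d a]
    | .copyAllDone s _ => [empty s]
    | .moveAllStep s d a => [pop s a, call (moveAll s d), push d a]
    | .moveAllDone s _ => [empty s]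
    | .clearAllStep s a => [pop s a, call (clearAll s)]
    | .clearAllDone s => [empty s]
    | .vecUpdStep => [call (copyNum M I), call (mul .vec true), call (dropNum T),
        call (moveNum false R B), call (.add 0), call vecUpd, call (moveNum false A R)]
    | .vecUpdDone => [empty U, empty R]
    | .allZeroStep => [call (moveNum false R A), call (chk .eq 0), call (dropNum U), call allZero]
    | .allZeroDone => [empty U, empty R]
    -- Reading `Fᵢ` destroys its text, so a copy is kept on `J` for the next round. The component
    -- `1` in front of the solution makes the subtraction from the residue `(xᵢ, u)` count the
    -- summands as well.
    | .item => [call (copyAll I J), call (guessAll U), call (tf true), call (clearAll I),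
        call (moveAll J I), push U sep, push U bit1, call (guess true M), call vecUpd,
        call (dropNum M), call loop]
    -- The text of `Fᵢ` is consumed by an evaluation at an arbitrary vector with an arbitrary
    -- result. This parses the formula even if the sum is empty. The empty number in front of the
    -- vector only equalizes the lengths for `allZero`.
    | .finish b => [call (guessAll U), call (tf b), push U sep, call allZero]
    | .phase => [call (copyAll US R), call (moveNum false XS R), call loop, call phases]
    | .phasesDone => [empty XS, empty I]

/-! ### Numbers on the stacks -/

/-- The value of a list of digits, least significant first. -/
def val : List SignType → ℤ
  | [] => 0
  | d :: l => d + 2 * val l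

def num (l : List SignType) : List Token := l.map dig ++ [sep]

def nums (L : List (List SignType)) : List Token := L.flatMap num

@[simp] theorem val_nil : val [] = 0 := rfl
@[simp] theorem val_cons (d l) : val (d :: l) = d + 2 * val l := rfl
@[simp] theorem num_nil : num [] = [sep] := rfl
@[simp] theorem num_cons (d l) : num (d :: l) = dig d :: num l := rfl
@[simp] theorem nums_nil : nums [] = [] := rfl
@[simp] theorem nums_cons (l L) : nums (l :: L) = num l ++ nums L := rfl

@[simp] theorem dig_inj {d e : SignType} : dig d = dig e ↔ d = e := by
  cases d <;> cases e <;> simp [dig]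

@[simp] theorem dig_ne_sep (d : SignType) : dig d ≠ sep := by cases d <;> simp [dig]
@[simp] theorem sep_ne_dig (d : SignType) : sep ≠ dig d := by cases d <;> simp [dig]

theorem carry_spec : ∀ c x y : SignType,
    (c : ℤ) + x + y = sumDig c x y + 2 * carry c x y := by decide

theorem val_flip (neg : Bool) (l : List SignType) :
    val (l.map (flipDig neg)) = (bif neg then -1 else 1) * val l := by
  induction l with
  | nil => simp
  | cons d l ih =>
    have : ((flipDig neg d : SignType) : ℤ) = (bif neg then -1 else 1) * d := by
      cases neg <;> cases d <;> rfl
    simp only [List.map_cons, val_cons, ih, this]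
    ring

theorem val_nonneg {l : List SignType} (h : ∀ d ∈ l, 0 ≤ d) : 0 ≤ val l := by
  induction l with
  | nil => simp
  | cons d l ih =>
    simp only [List.mem_cons, forall_eq_or_imp] at h
    have h0 : ∀ d : SignType, 0 ≤ d → (0 : ℤ) ≤ d := by decide
    have := h0 d h.1
    have := ih h.2
    simp only [val_cons]
    omega

/-- The new carry is half of `c + d`, rounded up for comparisons with `≤ 0` and `> 0` and down for
`< 0`. For equality the sum must be even. -/
theorem Rel.next_spec {r : Rel} {c d e : SignType} (h : r.next c d = some e) (v : ℤ) :
    r.Holds (d + 2 * v + c) ↔ r.Holds (v + e) := by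
  cases r <;> cases c <;> cases d <;> simp [Rel.next] at h <;> subst h <;>
    simp [Rel.Holds] <;> omega

end CardVerifier

/-! ### Specifications of the procedures; soundness of stack operations, addition and comparison. -/

namespace CardVerifier

open StackProgram Token
open Function (update)

/-- The values of the variables are on the stacks `U`, `X` and `W`. -/
def Env {α : Type} (c : Stack → List Token) (var : α → List Token) (ρ : α → ℤ) : Prop :=
  ∃ LU LX LW, c .U = nums LU ∧ c .X = nums LX ∧ c .W = nums LW ∧
    (∀ j d, LU[j]? = some d → ∃ a, var a = varU :: encodeUnary j ∧ ρ a = val d) ∧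
    (∀ j d, LX[j]? = some d → ∃ a, var a = varX :: encodeUnary j ∧ ρ a = val d) ∧
    (∀ j d, LW[j]? = some d → ∃ a, var a = varV :: encodeUnary j ∧ ρ a = val d)

theorem Env.congr {α : Type} {c c' : Stack → List Token} {var : α → List Token} {ρ : α → ℤ}
    (h : Env c var ρ) (hU : c' .U = c .U) (hX : c' .X = c .X) (hW : c' .W = c .W) :
    Env c' var ρ := by
  rw [Env, hU, hX, hW]
  exact h

/-- The domain of the variables. -/
def dom (nat : Bool) : Set ℤ := {z | nat = true → 0 ≤ z}

/-- The vector of the values of a list of numbers. -/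
def vec (k : ℕ) (L : List (List SignType)) : Fin k → ℤ := fun j => val (L.getD j [])

def solutions (nat : Bool) {k : ℕ} (F : QFPA (Fin k)) : Set (Fin k → ℤ) :=
  {y | (∀ j, y j ∈ dom nat) ∧ F.Holds y}

/-- What the source of multiplicands provides. -/
def BaseSpec (m : Mode) (t : List SignType) (c c' : Stack → List Token) : Prop :=
  (∃ r, c' .T = num t ++ r) ∧ match m with
  | .const neg => val t = (bif neg then -1 else 1) ∧ c' = update c .T (num t ++ c .T)
  | .term neg => ∀ (α : Type) (var : α → List Token) (ρ : α → ℤ), Env c var ρ →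
      ∃ s : LinTerm α, c .I = s.encode var ++ c' .I ∧
        val t = (bif neg then -1 else 1) * s.value ρ ∧
        c' = update (update c .I (c' .I)) .T (num t ++ c .T)
  | .vec => ∃ y r, c .U = num y ++ r ∧ val t = -val y ∧
      c' = update (update c .U r) .T (num t ++ c .T)

/-- The binary digits of a number, as they are written in a formula. -/
def IsBits (ok : Bool) (l : List Bool) : Prop := (∃ n : ℕ, l = n.bits) ∧ (l = [] → ok = true)

def bitsVal (l : List Bool) : ℕ := l.foldr Nat.bit 0

/-- The partial correctness specification of the procedures. -/
def Spec (nat : Bool) : Proc → (Stack → List Token) → (Stack → List Token) → Prop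
  | .main, c, _ => ∀ s, c = start .J s → s ∈ LIACard.satLanguage (dom nat)
  | .rev, c, c' => c' = update (update c .I ((c .J).reverse ++ c .I)) .J []
  | .fail, _, _ => False
  | .guess nn k, c, c' => ∃ d, (nn = true → ∀ e ∈ d, 0 ≤ e) ∧ c' = update c k (num d ++ c k)
  | .init nn k, c, c' => k ≠ .I → ∃ L, (nn = true → ∀ d ∈ L, ∀ e ∈ d, 0 ≤ e) ∧
      c .I = encodeUnary L.length ++ c' .I ∧ c' = update (update c .I (c' .I)) k (nums L ++ c k)
  | .guessAll k, c, c' => ∃ L, (nat = true → ∀ d ∈ L, ∀ e ∈ d, 0 ≤ e) ∧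
      c' = update c k (nums L ++ c k)
  | .lookup k, c, c' => k ≠ .I → k ≠ .A → ∀ L, c k = nums L → ∃ j d, L[j]? = some d ∧
      c .I = encodeUnary j ++ c' .I ∧ c' = update (update c .I (c' .I)) .A (num d ++ c .A)
  | .skip k, c, c' => k ≠ .I → k ≠ .A → ∃ e r, c k = num e ++ r ∧ ∀ L, r = nums L →
      ∃ j d, L[j]? = some d ∧ c .I = encodeUnary j ++ c' .I ∧
        c' = update (update c .I (c' .I)) .A (num d ++ c .A)
  | .copyNum s d, c, c' => s ≠ d → ∃ e r, c s = num e ++ r ∧ c' = update c d (num e ++ c d)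
  | .moveNum neg s d, c, c' => s ≠ d → ∃ e r, c s = num e ++ r ∧
      c' = update (update c s r) d (num (e.map (flipDig neg)) ++ c d)
  | .dropNum s, c, c' => ∃ e r, c s = num e ++ r ∧ c' = update c s r
  | .add x, c, c' => ∀ a r b q, c .A = num a ++ r → c .B = num b ++ q →
      ∃ z, val z = val a + val b + x ∧ c' = update (update c .A (num z ++ r)) .B q
  | .chk rel x, c, c' => ∀ a r, c .A = num a ++ r → rel.Holds (val a + x) ∧ c' = update c .A r
  | .mul m ok, c, c' => ∃ (l : List Bool) (r : List Token) (t : List SignType)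
      (c₁ : Stack → List Token) (z : List SignType), c .I = l.map bit ++ sep :: r ∧
      (m ≠ .vec → IsBits ok l) ∧ BaseSpec m t (update c .I r) c₁ ∧
      val z = bitsVal l * val t ∧ c' = update c₁ .A (num z ++ c₁ .A)
  | .base m, c, c' => ∃ t, BaseSpec m t c c'
  -- Quantifying over the type of variables lets one procedure serve both `F₀` and the `Fᵢ`, and
  -- lets one run be interpreted twice, as in `sound_item`.
  | .term, c, c' => ∀ (α : Type) (var : α → List Token) (ρ : α → ℤ), Env c var ρ →
      ∃ (s : LinTerm α) (z : List SignType), c .I = s.encode var ++ c' .I ∧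
        val z = s.value ρ ∧ c' = update (update c .I (c' .I)) .A (num z ++ c .A)
  | .tf b, c, c' => ∀ (α : Type) (var : α → List Token) (ρ : α → ℤ), Env c var ρ →
      ∃ F : QFPA α, c .I = F.encode var ++ c' .I ∧ (F.Holds ρ ↔ b = true) ∧
        c' = update c .I (c' .I)
  | .copyAll s d, c, c' => s ≠ d → c' = update c d (c s ++ c d)
  | .moveAll s d, c, c' => s ≠ d → c' = update (update c d (c s ++ c d)) s []
  | .clearAll s, c, c' => c' = update c s []
  | .vecUpd, c, c' => ∀ Y L l r, c .U = nums Y → c .R = nums L → c .M = num l ++ r →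
      ∃ Z, c' = update (update c .U []) .R (nums Z) ∧ Y.length = L.length ∧
        Z.map val = List.zipWith (fun y x => val x - val l * val y) Y L
  | .allZero, c, c' => ∀ Y L, c .U = nums Y → c .R = nums L → Y.length = L.length ∧
      (∀ d ∈ L, val d = 0) ∧ c' = update (update c .U []) .R []
  | .loop, c, c' => ∀ k x L, L.length = k → c .J = [] → c .U = [] → c .X = [] → c .W = [] →
      c .R = nums (x :: L) → ∃ (F : QFPA (Fin k)) (m : ℕ),
        c .I = F.encode encodeFin ++ c' .I ∧ val x = m ∧
        vec k L ∈ sumPow (solutions nat F) m ∧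
        c' = update (update c .I (c' .I)) .R []
  | .phases, c, _ => ∀ L LX, c .J = [] → c .U = [] → c .X = [] → c .W = [] → c .R = [] →
      c .US = nums L → c .XS = nums LX → ∃ Fs : List (QFPA (Fin L.length)),
        c .I = (Fs.map (QFPA.encode encodeFin)).flatten ∧
        List.Forall₂ (fun x F => ∃ m : ℕ, val x = m ∧
          vec L.length L ∈ sumPow (solutions nat F) m) LX Fs

/-- Digits differ from the separator, so numbers form a prefix code. This identifies the numbers
that the specifications only assert to exist. -/
theorem num_inj {a b : List SignType} {r q : List Token} (h : num a ++ r = num b ++ q) :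
    a = b ∧ r = q := by
  induction a generalizing b with
  | nil => cases b <;> simp_all
  | cons d a ih =>
    cases b with
    | nil => simp at h
    | cons e b =>
      simp only [num_cons, List.cons_append, List.cons.injEq, dig_inj] at h
      simpa [h.1] using ih h.2

variable {nat : Bool} {c c' : Stack → List Token}

/-- A rule is sound if its body satisfies the specification of its procedure. -/
def Sound (nat : Bool) (r : Rule) : Prop :=
  ∀ c c', Sem (Spec nat) ((prog nat).rhs r) c c' → Spec nat ((prog nat).lhs r) c c'

theorem sound_revStep (a) : Sound nat (.revStep a) := by
  rintro c c' ⟨l, hl, _, h, rfl⟩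
  rw [show c' = _ from h]
  funext j
  cases j <;> simp [hl]

theorem sound_revDone : Sound nat .revDone := by
  rintro c _ ⟨hl, rfl⟩
  simp [Spec, prog, hl]

theorem sound_guessStep (nn k e) : Sound nat (.guessStep nn k e) := by
  rintro c _ ⟨_, ⟨d, hd, rfl⟩, rfl⟩
  refine ⟨(if nn then e * e else e) :: d, ?_, by simp⟩
  have : ∀ e : SignType, 0 ≤ e * e := by decide
  rintro rfl
  simpa [this] using hd

theorem sound_guessDone (nn k) : Sound nat (.guessDone nn k) := by
  rintro c _ ⟨⟩
  exact ⟨[], by simp, by simp⟩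

theorem sound_initStep (nn k) : Sound nat (.initStep nn k) := by
  rintro c _ ⟨l, hl, c₁, h, _, ⟨d, hd, rfl⟩, rfl⟩ hk
  obtain ⟨L, hL, h1, h2⟩ := h hk
  refine ⟨d :: L, ?_, ?_, ?_⟩
  · intro h; simpa using ⟨hd h, hL h⟩
  · simp [Function.update_of_ne hk.symm, hl, encodeUnary, List.replicate_succ] at h1 ⊢
    exact h1
  · generalize c₁ .I = q at h2
    subst h2
    funext j
    simp only [Function.update_apply]
    split_ifs <;> simp_all

theorem sound_initDone (nn k) : Sound nat (.initDone nn k) := by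
  rintro c _ ⟨l, hl, rfl⟩ hk
  exact ⟨[], by simp, by simp [hl, encodeUnary], by simp [hk, Function.update_of_ne]⟩

theorem sound_guessAllStep (k) : Sound nat (.guessAllStep k) := by
  rintro c _ ⟨_, ⟨L, hL, rfl⟩, _, ⟨d, hd, rfl⟩, rfl⟩
  exact ⟨d :: L, fun h => by simpa using ⟨hd h, hL h⟩, by simp⟩

theorem sound_guessAllDone (k) : Sound nat (.guessAllDone k) := by
  rintro c _ ⟨⟩
  exact ⟨[], by simp, by simp⟩

theorem sound_lookupStep (k) : Sound nat (.lookupStep k) := by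
  rintro c _ ⟨l, hl, _, h, rfl⟩ hI hA L hL
  obtain ⟨e, r, h, h'⟩ := h hI hA
  cases L with
  | nil => simp [hI, hL] at h; simp [num] at h
  | cons e' L =>
    simp [hI, hL] at h
    obtain ⟨rfl, rfl⟩ := num_inj h
    obtain ⟨j, d, hd, h1, h2⟩ := h' L rfl
    refine ⟨j + 1, d, by simpa using hd, ?_, ?_⟩
    · simpa [hl, encodeUnary, List.replicate_succ] using h1
    · simpa using h2

theorem sound_lookupDone (k) : Sound nat (.lookupDone k) := by
  rintro c _ ⟨l, hl, _, h, rfl⟩ hI hA L hL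
  obtain ⟨e, r, h, h2⟩ := h hA
  cases L with
  | nil => simp [hI, hL] at h; simp [num] at h
  | cons e' L =>
    simp [hI, hL] at h
    obtain ⟨rfl, rfl⟩ := num_inj h
    refine ⟨0, e', by simp, ?_, ?_⟩
    · simp [hl, encodeUnary, h2]
    · simp [h2]

theorem sound_skipStep (k d) : Sound nat (.skipStep k d) := by
  rintro c _ ⟨l, hl, c₁, h, rfl⟩ hI hA
  obtain ⟨e, r, h1, h⟩ := h hI hA
  refine ⟨d :: e, r, by simpa [hl] using h1, fun L hL => ?_⟩
  obtain ⟨j, d, hd, h1, h2⟩ := h L hL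
  refine ⟨j, d, hd, ?_, ?_⟩
  · simpa [hI.symm] using h1
  · generalize c₁ .I = q at h2
    subst h2
    funext i
    simp only [Function.update_apply]
    split_ifs <;> simp_all

theorem sound_skipDone (k) : Sound nat (.skipDone k) := by
  rintro c _ ⟨l, hl, c₁, h, rfl⟩ hI hA
  refine ⟨[], l, by simpa using hl, fun L hL => ?_⟩
  obtain ⟨j, d, hd, h1, h2⟩ := h hI hA L (by simp [hL])
  refine ⟨j, d, hd, ?_, ?_⟩
  · simpa [hI.symm] using h1
  · generalize c₁ .I = q at h2
    subst h2
    funext i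
    simp only [Function.update_apply]
    split_ifs <;> simp_all

theorem sound_copyNumStep (s d e) : Sound nat (.copyNumStep s d e) := by
  rintro c _ ⟨l, hl, _, h, rfl⟩ hs
  obtain ⟨a, r, h1, rfl⟩ := h hs
  refine ⟨e :: a, r, by simpa [hl] using h1, ?_⟩
  funext i
  simp only [Function.update_apply]
  split_ifs <;> simp_all

theorem sound_copyNumDone (s d) : Sound nat (.copyNumDone s d) := by
  rintro c _ ⟨l, hl, rfl⟩ hs
  refine ⟨[], l, by simpa using hl, ?_⟩
  funext i
  simp only [Function.update_apply]
  split_ifs <;> simp_all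

theorem sound_moveNumStep (neg s d e) : Sound nat (.moveNumStep neg s d e) := by
  rintro c _ ⟨l, hl, _, h, rfl⟩ hs
  obtain ⟨a, r, h1, rfl⟩ := h hs
  refine ⟨e :: a, r, by simpa [hl] using h1, ?_⟩
  funext i
  simp only [Function.update_apply]
  split_ifs <;> simp_all

theorem sound_moveNumDone (neg s d) : Sound nat (.moveNumDone neg s d) := by
  rintro c _ ⟨l, hl, rfl⟩ hs
  refine ⟨[], l, by simpa using hl, ?_⟩
  funext i
  simp only [Function.update_apply]
  split_ifs <;> simp_all

theorem sound_dropNumStep (s e) : Sound nat (.dropNumStep s e) := by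
  rintro c _ ⟨l, hl, _, ⟨a, r, ha, rfl⟩, rfl⟩
  exact ⟨e :: a, r, by simpa [hl] using ha, by simp⟩

theorem sound_dropNumDone (s) : Sound nat (.dropNumDone s) := by
  rintro c _ ⟨l, hl, rfl⟩
  exact ⟨[], l, by simpa using hl, rfl⟩

theorem dropNum_eq {s : Stack} (h : Spec nat (.dropNum s) c c') {e r} (hs : c s = num e ++ r) :
    c' = update c s r := by
  obtain ⟨a, q, ha, rfl⟩ := h
  rw [hs] at ha
  rw [(num_inj ha).2]

theorem sound_addStep (x d e) : Sound nat (.addStep x d e) := by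
  rintro c _ ⟨l, hl, l', hl', _, h, rfl⟩ a r b q ha hb
  cases a with
  | nil => simp [hl] at ha
  | cons d' a =>
    cases b with
    | nil => simp at hl'; simp [hl'] at hb
    | cons e' b =>
      simp at hl'
      simp [hl, hl'] at ha hb
      obtain ⟨rfl, rfl⟩ := ha
      obtain ⟨rfl, rfl⟩ := hb
      obtain ⟨z, hz, rfl⟩ := h a r b q (by simp) (by simp)
      refine ⟨sumDig x d e :: z, ?_, ?_⟩
      · have := carry_spec x d e
        simp only [val_cons, hz]
        linarith
      · funext i
        cases i <;> simp

theorem sound_addPadA (x) : Sound nat (.addPadA x) := by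
  rintro c _ ⟨l, hl, _, h, rfl⟩ a r b q ha hb
  cases a with
  | cons => simp [hl] at ha
  | nil =>
    simp [hl] at ha
    subst ha
    obtain ⟨z, hz, rfl⟩ := h [0] l b q (by simp; rfl) (by simp [hb])
    exact ⟨z, by simpa using hz, by simp⟩

theorem sound_addPadB (x) : Sound nat (.addPadB x) := by
  rintro c _ ⟨l, hl, _, h, rfl⟩ a r b q ha hb
  cases b with
  | cons => simp [hl] at hb
  | nil =>
    simp [hl] at hb
    subst hb
    obtain ⟨z, hz, rfl⟩ := h a r [0] l (by simp [ha]) (by simp; rfl)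
    refine ⟨z, by simpa using hz, ?_⟩
    funext i
    cases i <;> simp

theorem sound_addDone (x) : Sound nat (.addDone x) := by
  rintro c _ ⟨l, hl, l', hl', rfl⟩ a r b q ha hb
  simp at hl'
  cases a with
  | cons => simp [hl] at ha
  | nil =>
    cases b with
    | cons => simp [hl'] at hb
    | nil =>
      simp [hl, hl'] at ha hb
      subst ha hb
      refine ⟨[x], by simp, ?_⟩
      funext i
      cases i <;> simp

theorem sound_chkStep (rel x d) : Sound nat (.chkStep rel x d) := by
  rintro c _ ⟨l, hl, _, h, rfl⟩ a r ha
  cases hn : rel.next x d with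
  | none => simp [hn, Spec] at h
  | some y =>
    rw [hn] at h
    cases a with
    | nil => simp [hl] at ha
    | cons d' a =>
      simp [hl] at ha
      obtain ⟨rfl, rfl⟩ := ha
      obtain ⟨h1, rfl⟩ := h a r (by simp)
      exact ⟨(Rel.next_spec hn _).2 h1, by simp⟩

theorem sound_chkDone (rel x) : Sound nat (.chkDone rel x) := by
  intro c c' h
  change Sem _ (if rel.Holds x then _ else _) _ _ at h
  split_ifs at h with hx
  · obtain ⟨l, hl, rfl⟩ := h
    intro a r ha
    cases a with
    | cons => simp [hl] at ha
    | nil =>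
      simp [hl] at ha
      subst ha
      exact ⟨by simpa using hx, rfl⟩
  · obtain ⟨_, h, -⟩ := h
    exact h.elim

theorem sound_copyAllStep (s d a) : Sound nat (.copyAllStep s d a) := by
  rintro c _ ⟨l, hl, _, h, rfl⟩ hs
  rw [h hs]
  funext i
  simp only [Function.update_apply]
  split_ifs <;> simp_all

theorem sound_copyAllDone (s d) : Sound nat (.copyAllDone s d) := by
  rintro c _ ⟨hl, rfl⟩ hs
  simp [hl]

theorem sound_moveAllStep (s d a) : Sound nat (.moveAllStep s d a) := by
  rintro c _ ⟨l, hl, _, h, rfl⟩ hs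
  rw [h hs]
  funext i
  simp only [Function.update_apply]
  split_ifs <;> simp_all

theorem sound_moveAllDone (s d) : Sound nat (.moveAllDone s d) := by
  rintro c _ ⟨hl, rfl⟩ hs
  funext i
  simp only [Function.update_apply]
  split_ifs <;> simp_all

theorem sound_clearAllStep (s a) : Sound nat (.clearAllStep s a) := by
  rintro c c' ⟨l, hl, _, h, rfl⟩
  rw [show c' = _ from h]
  exact Function.update_idem ..

theorem sound_clearAllDone (s) : Sound nat (.clearAllDone s) := by
  rintro c _ ⟨hl, rfl⟩
  simp [Spec, prog, ← hl]

end CardVerifier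

/-! ### Soundness of multiplication and of the reading of terms and formulas. -/

namespace CardVerifier

open StackProgram Token
open Function (update)

variable {nat : Bool} {c c' : Stack → List Token}

theorem bitsVal_bits (n : ℕ) : bitsVal n.bits = n := by
  induction n using Nat.binaryRec' with
  | zero => simp [bitsVal]
  | bit b n hn ih =>
    rw [Nat.bits_append_bit n b hn]
    simp only [bitsVal, List.foldr_cons] at ih ⊢
    rw [ih]

/-- The flag of the tail is the digit in front of it, so the digits cannot end with a leading zero.
-/
theorem IsBits.cons {b ok : Bool} {l : List Bool} (h : IsBits b l) : IsBits ok (b :: l) := by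
  obtain ⟨⟨n, rfl⟩, h⟩ := h
  exact ⟨⟨Nat.bit b n, (Nat.bits_append_bit n b fun hn => h (by simp [hn])).symm⟩, by simp⟩

theorem IsBits.encodeInt {neg : Bool} {l : List Bool} (h : IsBits (!neg) l) :
    encodeInt ((bif neg then -1 else 1) * bitsVal l) = sgn neg :: (l.map bit ++ [sep]) := by
  obtain ⟨⟨n, rfl⟩, h⟩ := h
  rw [bitsVal_bits]
  have hb : encodeBits n = n.bits.map bit := rfl
  cases neg with
  | false => simp [_root_.encodeInt, sgn, hb]
  | true =>
    have hn : n ≠ 0 := by rintro rfl; simp at h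
    simp [_root_.encodeInt, sgn, hb, Nat.pos_of_ne_zero hn]

theorem val_map_neg (l : List SignType) : val (l.map (flipDig true)) = -val l := by
  simp [val_flip]

theorem map_flip_false (l : List SignType) : l.map (flipDig false) = l := by
  have : flipDig false = id := rfl
  simp [this]

theorem sound_mulStep (m ok b) : Sound nat (.mulStep m ok b) := by
  intro c c' h
  obtain ⟨l, hl, _, ⟨bs, r, t, c₁, z, h1, h2, h3, h4, rfl⟩, h⟩ := h
  simp only [Function.update_self, Function.update_idem] at h1 h3
  have hT : ∃ q, c₁ .T = num t ++ q := h3.1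
  refine ⟨b :: bs, r, t, c₁, ?_⟩
  cases b with
  | false =>
    cases h
    refine ⟨0 :: z, by simp [hl, h1], fun hm => (h2 hm).cons, h3, ?_, ?_⟩
    · simp [h4, bitsVal, Nat.bit_val]; ring
    · simp; rfl
  | true =>
    obtain ⟨_, h5, _, h6, rfl⟩ := h
    obtain ⟨e, q, he, rfl⟩ := h5 (by decide)
    obtain ⟨q', hq⟩ := hT
    simp [hq] at he
    obtain ⟨rfl, rfl⟩ := num_inj he
    obtain ⟨z', hz', rfl⟩ := h6 (0 :: z) (c₁ .A) t (c₁ .B) (by simp; rfl) (by simp)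
    refine ⟨z', by simp [hl, h1], fun hm => (h2 hm).cons, h3, ?_, ?_⟩
    · simp [h4, bitsVal, Nat.bit_val] at hz' ⊢; rw [hz']; ring
    · funext i
      cases i <;> simp

theorem sound_mulDone (m ok) : Sound nat (.mulDone m ok) := by
  intro c c' h
  change Sem _ (if ok || m = .vec then _ else _) _ _ at h
  split_ifs at h with hx
  · obtain ⟨l, hl, c₁, ⟨t, ht⟩, rfl⟩ := h
    refine ⟨[], l, t, c₁, [], by simp [hl], fun hm => ⟨⟨0, by simp⟩, fun _ => ?_⟩, ht, ?_, ?_⟩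
    · simpa [hm] using hx
    · simp [bitsVal]
    · simp
  · obtain ⟨_, h, -⟩ := h
    exact h.elim

theorem sound_base (m) : Sound nat (.base m) := by
  intro c c' h
  match m with
  | .const neg =>
    cases h
    refine ⟨[flipDig neg 1], ⟨c .T, by simp⟩, ?_, by simp⟩
    cases neg <;> rfl
  | .term neg =>
    obtain ⟨c₁, h1, _, h2, rfl⟩ := h
    obtain ⟨e, r, he, rfl⟩ := h2 (by decide)
    refine ⟨_, ⟨_, Function.update_self ..⟩, fun α var ρ hρ => ?_⟩
    obtain ⟨s, z, h3, h4, h5⟩ := h1 α var ρ hρ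
    generalize c₁ .I = q at h3 h5
    subst h5
    simp at he
    obtain ⟨rfl, rfl⟩ := num_inj he
    refine ⟨s, by simpa using h3, by rw [val_flip, h4], ?_⟩
    funext i
    cases i <;> simp
  | .vec =>
    obtain ⟨_, h2, rfl⟩ := h
    obtain ⟨e, r, he, rfl⟩ := h2 (by decide)
    exact ⟨_, ⟨_, Function.update_self ..⟩, e, r, he, val_map_neg e, rfl⟩

theorem sound_const (neg) : Sound nat (.const neg) := by
  rintro c _ ⟨l, hl, l', hl', _, ⟨bs, r, t, c₁, z, h1, h2, h3, h4, rfl⟩, c₂, h5, rfl⟩ α var ρ hρ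
  simp at hl' h1 h3
  subst hl' h1
  obtain ⟨-, h6, rfl⟩ := h3
  have h7 := dropNum_eq h5 (e := t) (r := c .T) (by simp)
  refine ⟨.const ((bif neg then -1 else 1) * bitsVal bs), z, ?_, ?_, ?_⟩
  · simp [h7, hl, LinTerm.encode, (h2 (by simp)).encodeInt]
  · rw [h4, h6, LinTerm.value, mul_comm]
  · rw [h7]
    funext i
    cases i <;> simp

theorem sound_smul (neg) : Sound nat (.smul neg) := by
  rintro c _ ⟨l, hl, l', hl', _, ⟨bs, r, t, c₁, z, h1, h2, h3, h4, rfl⟩, c₂, h5, rfl⟩ α var ρ hρ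
  simp at hl' h1 h3
  subst hl' h1
  obtain ⟨s, h6, h7, h8⟩ := h3.2 α var ρ (hρ.congr (by simp) (by simp) (by simp))
  generalize c₁ .I = q at h6 h8
  subst h8
  have h9 := dropNum_eq h5 (e := t) (r := c .T) (by simp)
  refine ⟨.smul ((bif neg then -1 else 1) * bitsVal bs) s, z, ?_, ?_, ?_⟩
  · simp at h6
    simp [h9, hl, LinTerm.encode, (h2 (by simp)).encodeInt, h6]
  · rw [h4, h7, LinTerm.value]; ring
  · rw [h9]
    funext i
    cases i <;> simp

/-- Two terms, whose values are combined on the stack `A`. -/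
theorem sem_terms {neg : Bool} {p : List (Instr Stack Token Proc)}
    (h : Sem (Spec nat) ([.call .term, .call .term, .call (.moveNum neg .A .B),
      .call (.add 0)] ++ p) c c')
    {α : Type} {var : α → List Token} {ρ : α → ℤ} (hρ : Env c var ρ) :
    ∃ (s t : LinTerm α) (z : List SignType) (q : List Token),
      c .I = s.encode var ++ t.encode var ++ q ∧
      val z = s.value ρ + (bif neg then -1 else 1) * t.value ρ ∧
      Sem (Spec nat) p (update (update c .I q) .A (num z ++ c .A)) c' := by
  obtain ⟨c₁, h1, c₂, h2, _, h3, _, h4, h⟩ := h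
  obtain ⟨s, z, h5, h6, h7⟩ := h1 α var ρ hρ
  generalize c₁ .I = q at h5 h7
  subst h7
  obtain ⟨t, y, h8, h9, h10⟩ := h2 α var ρ (hρ.congr (by simp) (by simp) (by simp))
  generalize c₂ .I = q' at h8 h10
  subst h10
  obtain ⟨e, r, he, rfl⟩ := h3 (by decide)
  simp at he
  obtain ⟨rfl, rfl⟩ := num_inj he
  obtain ⟨z', hz', rfl⟩ := h4 z (c .A) _ (c .B) (by simp) (by simp; rfl)
  simp at h8
  subst h8
  refine ⟨s, t, z', q', by simpa using h5, ?_, ?_⟩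
  · rw [hz', val_flip, h6, h9]; simp
  · refine Eq.subst (motive := fun x => Sem (Spec nat) p x c') ?_ h
    funext i
    cases i <;> simp

theorem sound_sum : Sound nat .sum := by
  rintro c c' ⟨l, hl, h⟩ α var ρ hρ
  obtain ⟨s, t, z, q, h1, h2, rfl⟩ :=
    sem_terms (p := []) h (hρ.congr (by simp) (by simp) (by simp))
  refine ⟨.add s t, z, ?_, by simpa [LinTerm.value] using h2, ?_⟩
  · simp at h1
    simp [hl, LinTerm.encode, h1]
  · funext i
    cases i <;> simp

theorem sound_varU : Sound nat .varU := by
  rintro c c₁ ⟨l, hl, _, h, rfl⟩ α var ρ ⟨LU, LX, LW, hU, hX, hW, h1, h2, h3⟩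
  obtain ⟨j, d, hd, h4, h5⟩ := h (by decide) (by decide) LU (by simpa using hU)
  generalize c₁ .I = q at h4 h5
  subst h5
  obtain ⟨a, ha, ha'⟩ := h1 j d hd
  refine ⟨.var a, d, ?_, by simp [LinTerm.value, ha'], ?_⟩
  · simp at h4
    simp [hl, LinTerm.encode, ha, h4]
  · funext i
    cases i <;> simp

theorem sound_varX : Sound nat .varX := by
  rintro c c₁ ⟨l, hl, _, h, rfl⟩ α var ρ ⟨LU, LX, LW, hU, hX, hW, h1, h2, h3⟩
  obtain ⟨j, d, hd, h4, h5⟩ := h (by decide) (by decide) LX (by simpa using hX)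
  generalize c₁ .I = q at h4 h5
  subst h5
  obtain ⟨a, ha, ha'⟩ := h2 j d hd
  refine ⟨.var a, d, ?_, by simp [LinTerm.value, ha'], ?_⟩
  · simp at h4
    simp [hl, LinTerm.encode, ha, h4]
  · funext i
    cases i <;> simp

theorem sound_varV : Sound nat .varV := by
  rintro c c₁ ⟨l, hl, _, h, rfl⟩ α var ρ ⟨LU, LX, LW, hU, hX, hW, h1, h2, h3⟩
  obtain ⟨j, d, hd, h4, h5⟩ := h (by decide) (by decide) LW (by simpa using hW)
  generalize c₁ .I = q at h4 h5
  subst h5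
  obtain ⟨a, ha, ha'⟩ := h3 j d hd
  refine ⟨.var a, d, ?_, by simp [LinTerm.value, ha'], ?_⟩
  · simp at h4
    simp [hl, LinTerm.encode, ha, h4]
  · funext i
    cases i <;> simp

theorem sound_le (b) : Sound nat (.le b) := by
  rintro c c' ⟨l, hl, h⟩ α var ρ hρ
  obtain ⟨s, t, z, q, h1, h2, _, h3, rfl⟩ :=
    sem_terms (p := [.call (.chk (bif b then .le else .gt) 0)]) h
      (hρ.congr (by simp) (by simp) (by simp))
  obtain ⟨h4, rfl⟩ := h3 z (c .A) (by simp)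
  refine ⟨.le s t, ?_, ?_, ?_⟩
  · simp at h1
    simp [hl, QFPA.encode, h1]
  · cases b <;> simp [Rel.Holds, QFPA.Holds, h2] at h4 ⊢ <;> linarith
  · funext i
    cases i <;> simp

theorem sound_eq (r) : Sound nat (.eq r) := by
  rintro c c' h α var ρ hρ
  have key : ∀ (h' : Sem (Spec nat) [.pop .I Token.eq, .call .term, .call .term,
      .call (.moveNum true .A .B), .call (.add 0), .call (.chk r 0)] c c') (b : Bool)
      (_ : ∀ z, r.Holds z → (z = 0 ↔ b = true)),
      ∃ F : QFPA α, c .I = F.encode var ++ c' .I ∧ (F.Holds ρ ↔ b = true) ∧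
        c' = update c .I (c' .I) := by
    rintro ⟨l, hl, h⟩ b hb
    obtain ⟨s, t, z, q, h1, h2, _, h3, rfl⟩ :=
      sem_terms (p := [.call (.chk r 0)]) h (hρ.congr (by simp) (by simp) (by simp))
    obtain ⟨h4, rfl⟩ := h3 z (c .A) (by simp)
    refine ⟨.eq s t, ?_, ?_, ?_⟩
    · simp at h1
      simp [hl, QFPA.encode, h1]
    · rw [← hb _ h4, h2]
      simp only [QFPA.Holds, cond_true]
      constructor <;> intro h
      · rw [h]; simp
      · simp at h; linarith
    · funext i
      cases i <;> simp
  cases r with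
  | le => obtain ⟨_, h, -⟩ := h; exact h.elim
  | eq => exact key h _ (by simp [Rel.Holds])
  | gt => exact key h _ (by simp only [Rel.Holds]; intro z hz; simpa using by omega)
  | lt => exact key h _ (by simp only [Rel.Holds]; intro z hz; simpa using by omega)

theorem sound_not (b) : Sound nat (.not b) := by
  rintro c _ ⟨l, hl, c₁, h, rfl⟩ α var ρ hρ
  obtain ⟨F, h1, h2, h3⟩ := h α var ρ (hρ.congr (by simp) (by simp) (by simp))
  refine ⟨.not F, ?_, ?_, ?_⟩
  · simp at h1
    simp [hl, QFPA.encode, ← h1]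
  · simp only [QFPA.Holds, h2]; cases b <;> simp
  · simpa using h3

theorem sem_two {b₁ b₂ : Bool}
    (h : Sem (Spec nat) [.call (.tf b₁), .call (.tf b₂)] c c')
    {α : Type} {var : α → List Token} {ρ : α → ℤ} (hρ : Env c var ρ) :
    ∃ (F G : QFPA α), c .I = F.encode var ++ G.encode var ++ c' .I ∧
      (F.Holds ρ ↔ b₁ = true) ∧ (G.Holds ρ ↔ b₂ = true) ∧ c' = update c .I (c' .I) := by
  obtain ⟨c₁, h1, c₂, h2, rfl⟩ := h
  obtain ⟨F, h3, h4, h5⟩ := h1 α var ρ hρ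
  generalize c₁ .I = q at h3 h5
  subst h5
  obtain ⟨G, h6, h7, h8⟩ := h2 α var ρ (hρ.congr (by simp) (by simp) (by simp))
  refine ⟨F, G, ?_, h4, h7, by simpa using h8⟩
  simp at h6
  simp [h3, h6]

theorem sound_and (b₁ b₂) : Sound nat (.and b₁ b₂) := by
  rintro c c' ⟨l, hl, h⟩ α var ρ hρ
  obtain ⟨F, G, h1, h2, h3, h4⟩ := sem_two h (hρ.congr (by simp) (by simp) (by simp))
  refine ⟨.and F G, ?_, ?_, by simpa using h4⟩
  · simp at h1
    simp [hl, QFPA.encode, ← h1]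
  · simp [QFPA.Holds, h2, h3]

theorem sound_or (b₁ b₂) : Sound nat (.or b₁ b₂) := by
  rintro c c' ⟨l, hl, h⟩ α var ρ hρ
  obtain ⟨F, G, h1, h2, h3, h4⟩ := sem_two h (hρ.congr (by simp) (by simp) (by simp))
  refine ⟨.or F G, ?_, ?_, by simpa using h4⟩
  · simp at h1
    simp [hl, QFPA.encode, ← h1]
  · simp [QFPA.Holds, h2, h3]

end CardVerifier

/-! ### Soundness of the sum constraints and of the whole program. -/

namespace CardVerifier

open StackProgram Token
open Function (update)

variable {nat : Bool} {c c' : Stack → List Token}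

/-- A multiplicity is copied to the text stack `I` and read there like a binary constant; both
readings agree. -/
theorem num_eq_bits {l : List SignType} {q r : List Token} {bs : List Bool}
    (h : num l ++ q = bs.map bit ++ sep :: r) : q = r ∧ val l = bitsVal bs := by
  induction bs generalizing l with
  | nil =>
    cases l with
    | nil => simpa [bitsVal] using h
    | cons => simp at h
  | cons b bs ih =>
    cases l with
    | nil => cases b <;> simp [bit] at h
    | cons d l =>
      simp at h
      obtain ⟨h1, h2⟩ := ih (by simpa using h.2)
      refine ⟨h1, ?_⟩
      have h3 := h.1
      have : (d : ℤ) = b.toNat := by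
        cases b <;> cases d <;> simp [bit, dig] at h3 <;> rfl
      simp [h2, this, bitsVal, Nat.bit_val]
      ring

theorem nums_eq_num {L : List (List SignType)} {e r} (h : nums L = num e ++ r) :
    ∃ L', L = e :: L' ∧ r = nums L' := by
  cases L with
  | nil => simp [num] at h
  | cons d L =>
    obtain ⟨rfl, rfl⟩ := num_inj h
    exact ⟨L, rfl, rfl⟩

theorem nums_eq_nil {L : List (List SignType)} (h : nums L = []) : L = [] := by
  cases L with
  | nil => rfl
  | cons d L => simp [num] at h

theorem sound_vecUpdStep : Sound nat .vecUpdStep := by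
  rintro c _ ⟨_, h1, _, ⟨bs, r, t, c₁, z, h2, -, h3, h4, rfl⟩, _, h5, _, h6, _, h7, _, h8, _, h9,
    rfl⟩ Y L l q hY hL hl
  obtain ⟨e, r', he, rfl⟩ := h1 (by decide)
  rw [hl] at he
  obtain ⟨rfl, rfl⟩ := num_inj he
  simp at h2
  obtain ⟨rfl, hlb⟩ := num_eq_bits h2
  simp at h3
  obtain ⟨-, y, r, h10, h11, rfl⟩ := h3
  rw [hY] at h10
  obtain ⟨Y, rfl, rfl⟩ := nums_eq_num h10
  obtain rfl := dropNum_eq h5 (e := t) (r := c .T) (by simp)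
  obtain ⟨x, r, h12, rfl⟩ := h6 (by decide)
  simp [hL] at h12
  obtain ⟨L, rfl, rfl⟩ := nums_eq_num h12
  obtain ⟨z', hz', rfl⟩ := h7 z (c .A) x (c .B) (by simp) (by simp [map_flip_false])
  obtain ⟨Z, rfl, hlen, hZ⟩ := h8 Y L l q (by simp) (by simp) (by simp [hl])
  obtain ⟨e, r, h13, rfl⟩ := h9 (by decide)
  simp at h13
  obtain ⟨rfl, rfl⟩ := num_inj h13
  refine ⟨z' :: Z, ?_, by simp [hlen], ?_⟩
  · funext i
    cases i <;> simp [map_flip_false]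
  · simp [hZ, hz', h4, h11, hlb]
    ring

theorem sound_vecUpdDone : Sound nat .vecUpdDone := by
  rintro c _ ⟨h1, h2, rfl⟩ Y L l q hY hL hl
  rw [h1] at hY
  rw [h2] at hL
  obtain rfl := nums_eq_nil hY.symm
  obtain rfl := nums_eq_nil hL.symm
  refine ⟨[], ?_, rfl, by simp⟩
  funext i
  cases i <;> simp [h1, h2]

theorem sound_allZeroStep : Sound nat .allZeroStep := by
  rintro c _ ⟨_, h1, _, h2, _, h3, _, h4, rfl⟩ Y L hY hL
  obtain ⟨x, r, h5, rfl⟩ := h1 (by decide)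
  rw [hL] at h5
  obtain ⟨L, rfl, rfl⟩ := nums_eq_num h5
  obtain ⟨h6, rfl⟩ := h2 x (c .A) (by simp [map_flip_false])
  obtain ⟨y, r, h7, rfl⟩ := h3
  simp [hY] at h7
  obtain ⟨Y, rfl, rfl⟩ := nums_eq_num h7
  obtain ⟨h8, h9, rfl⟩ := h4 Y L (by simp) (by simp)
  refine ⟨by simp [h8], by simpa using ⟨by simpa [Rel.Holds] using h6, h9⟩, ?_⟩
  funext i
  cases i <;> simp

theorem sound_allZeroDone : Sound nat .allZeroDone := by
  rintro c _ ⟨h1, h2, rfl⟩ Y L hY hL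
  rw [h1] at hY
  rw [h2] at hL
  obtain rfl := nums_eq_nil hY.symm
  obtain rfl := nums_eq_nil hL.symm
  refine ⟨rfl, by simp, ?_⟩
  funext i
  cases i <;> simp [h1, h2]

theorem env_vec {k : ℕ} {Y : List (List SignType)} (hk : Y.length = k) (hU : c .U = nums Y)
    (hX : c .X = []) (hW : c .W = []) : Env c (encodeFin (k := k)) (vec k Y) := by
  refine ⟨Y, [], [], hU, hX, hW, fun j d hd => ?_, by simp, by simp⟩
  have hj := (List.getElem?_eq_some_iff.1 hd).1
  exact ⟨⟨j, hk ▸ hj⟩, rfl, by simp [vec, hd]⟩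

theorem vec_mem_dom {k : ℕ} {Y : List (List SignType)}
    (hY : nat = true → ∀ d ∈ Y, ∀ e ∈ d, 0 ≤ e) (j : Fin k) : vec k Y j ∈ dom nat := by
  intro h
  unfold vec
  rcases lt_or_ge (j : ℕ) Y.length with hj | hj
  · rw [List.getD_eq_getElem _ _ hj]
    exact val_nonneg (hY h _ (List.getElem_mem hj))
  · simp [hj]

theorem sumPow_zero {V : Type} [AddCommMonoid V] (A : Set V) : (0 : V) ∈ sumPow A 0 :=
  ⟨Fin.elim0, fun i => i.elim0, by simp⟩

theorem sumPow_add {V : Type} [AddCommMonoid V] {A : Set V} {u v : V} {m n : ℕ}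
    (hu : u ∈ sumPow A m) (hv : v ∈ sumPow A n) : u + v ∈ sumPow A (m + n) := by
  obtain ⟨y, hy, rfl⟩ := hu
  obtain ⟨z, hz, rfl⟩ := hv
  refine ⟨Fin.append y z, fun i => ?_, by simp [Fin.sum_univ_add]⟩
  refine Fin.addCases (fun i => ?_) (fun i => ?_) i
  · simpa using hy i
  · simpa using hz i

theorem sumPow_nsmul {V : Type} [AddCommMonoid V] {A : Set V} {y : V} (hy : y ∈ A) (m : ℕ) :
    m • y ∈ sumPow A m :=
  ⟨fun _ => y, fun _ => hy, by simp⟩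

theorem getD_zipWith (m : ℤ) (Y L : List (List SignType)) (Z : List (List SignType)) (j : ℕ)
    (h : Y.length = L.length)
    (hZ : Z.map val = List.zipWith (fun y x => val x - m * val y) Y L) :
    val (Z.getD j []) = val (L.getD j []) - m * val (Y.getD j []) := by
  induction Y generalizing L Z j with
  | nil =>
    obtain rfl : L = [] := by simpa using h.symm
    obtain rfl : Z = [] := by simpa using hZ
    simp
  | cons y Y ih =>
    cases L with
    | nil => simp at h
    | cons x L =>
      cases Z with
      | nil => simp at hZ
      | cons z Z =>
        simp at hZ h
        cases j with
        | zero => simpa using hZ.1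
        | succ j => simpa using ih L Z j h hZ.2

theorem encodeFin_inj {k : ℕ} {F G : QFPA (Fin k)} {s t : List Token}
    (h : F.encode encodeFin ++ s = G.encode encodeFin ++ t) : F = G ∧ s = t :=
  QFPA.encode_append_inj encodeFin_head (fun _ _ _ _ => encodeFin_append_inj) h

theorem sound_item : Sound nat .item := by
  rintro c c' ⟨_, h1, _, ⟨Y, hY, rfl⟩, c₁, h2, _, rfl, _, h3, _, ⟨l, hl, rfl⟩, _, h4, _, h5, _, h6,
    rfl⟩ k x L hk hJ hU hX hW hR
  obtain rfl := h1 (by decide)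
  -- The guessed vector is not yet known to have length `k`. The evaluation is first interpreted
  -- over its actual length, only to see that nothing but the text stack changes. The subtraction
  -- then forces the length to be `k`, and the same run is interpreted again over `Fin k`.
  obtain ⟨_, -, -, h7⟩ := h2 _ _ _
    (env_vec (Y := Y) rfl (by simp [hU]) (by simp [hX]) (by simp [hW]))
  obtain rfl := h3 (by decide)
  obtain ⟨Z, rfl, hlen, hZ⟩ := h4 ([.pos] :: Y) (x :: L) l (c .M)
    (by rw [h7]; simp [hU]; rfl) (by rw [h7]; simp [hR]) (by rw [h7]; simp)
  obtain rfl := dropNum_eq h5 (e := l) (r := c .M) (by rw [h7]; simp)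
  have hlen' : Y.length = L.length := by simpa using hlen
  obtain ⟨F₁, h8, h9, h10⟩ := h2 (Fin k) encodeFin (vec k Y)
    (env_vec (hlen'.trans hk) (by simp [hU]) (by simp [hX]) (by simp [hW]))
  generalize c₁ .I = q at h7 h8
  subst h7
  cases Z with
  | nil => simp at hZ
  | cons z Z =>
    simp at hZ
    have hlen₂ : Z.length = k := by simpa [hlen', hk] using congrArg List.length hZ.2
    obtain ⟨F, m, h11, h12, h13, h14⟩ := h6 k z Z hlen₂ (by simp) (by simp) (by simp [hX])
      (by simp [hW]) (by simp)
    simp [hJ] at h8 h11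
    -- Every round parses the same text, so by unique readability all rounds speak about the same
    -- formula.
    obtain ⟨rfl, rfl⟩ := encodeFin_inj (h8.symm.trans h11)
    have h15 : 0 ≤ val l := val_nonneg (hl rfl)
    refine ⟨F₁, m + (val l).toNat, h8, ?_, ?_, ?_⟩
    · have := hZ.1
      push_cast
      rw [Int.toNat_of_nonneg h15, ← h12, this]
      simp
    · have e : vec k L = vec k Z + (val l).toNat • vec k Y := by
        funext j
        have := getD_zipWith (val l) Y L Z j hlen' hZ.2
        change vec k L j = vec k Z j + (val l).toNat • vec k Y j
        rw [nsmul_eq_mul, Int.toNat_of_nonneg h15]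
        simp only [vec, this]
        ring
      rw [e]
      exact sumPow_add h13 (sumPow_nsmul (A := solutions nat F₁) ⟨vec_mem_dom hY, h9.2 rfl⟩ _)
    · generalize c' .I = q at *
      rw [h14]
      funext i
      cases i <;> simp [hU, hJ]

theorem sound_finish (b) : Sound nat (.finish b) := by
  rintro c c' ⟨_, ⟨Y, hY, rfl⟩, c₁, h2, _, h3, rfl⟩ k x L hk hJ hU hX hW hR
  -- As for an item, the length of the vector becomes known only after the evaluation, here by
  -- `allZero`.
  obtain ⟨_, -, -, h7⟩ := h2 _ _ _
    (env_vec (Y := Y) rfl (by simp [hU]) (by simp [hX]) (by simp [hW]))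
  obtain ⟨hlen, h0, h8⟩ := h3 ([] :: Y) (x :: L) (by rw [h7]; simp [hU]) (by rw [h7]; simp [hR])
  obtain ⟨F, h9, h10, h11⟩ := h2 (Fin k) encodeFin (vec k Y)
    (env_vec (by simpa [hk] using hlen) (by simp [hU]) (by simp [hX]) (by simp [hW]))
  generalize c₁ .I = q at h7 h9
  subst h7 h8
  refine ⟨F, 0, by simpa using h9, by simpa using h0 x, ?_, ?_⟩
  · have : vec k L = 0 := by
      funext j
      have hj : (j : ℕ) < L.length := hk ▸ j.2
      rw [vec, List.getD_eq_getElem _ _ hj]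
      exact h0 _ (List.mem_cons_of_mem _ (List.getElem_mem hj))
    rw [this]
    exact sumPow_zero _
  · funext i
    cases i <;> simp [hU]

theorem sound_phase : Sound nat .phase := by
  rintro c c' ⟨_, h1, _, h2, c₁, h3, _, h4, rfl⟩ L LX hJ hU hX hW hR hUS hXS
  obtain rfl := h1 (by decide)
  obtain ⟨x, r, h5, rfl⟩ := h2 (by decide)
  simp [hXS] at h5
  obtain ⟨LX, rfl, rfl⟩ := nums_eq_num h5
  obtain ⟨F, m, h6, h7, h8, h9⟩ := h3 _ x L rfl (by simp [hJ]) (by simp [hU]) (by simp [hX])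
    (by simp [hW]) (by simp [hR, hUS, map_flip_false])
  generalize c₁ .I = q at h6 h9
  subst h9
  obtain ⟨Fs, h10, h11⟩ := h4 L LX (by simp [hJ]) (by simp [hU]) (by simp [hX])
    (by simp [hW]) (by simp) (by simp [hUS]) (by simp)
  refine ⟨F :: Fs, ?_, .cons ⟨m, h7, h8⟩ h11⟩
  simp at h6 h10
  simp [h6, h10]

theorem sound_phasesDone : Sound nat .phasesDone := by
  rintro c _ ⟨h1, h2, rfl⟩ L LX hJ hU hX hW hR hUS hXS
  rw [h1] at hXS
  obtain rfl := nums_eq_nil hXS.symm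
  exact ⟨[], by simpa using h2, .nil⟩

theorem sound_main : Sound nat .main := by
  rintro c c' ⟨_, rfl, c₁, h1, c₂, h2, _, ⟨LW, hLW, rfl⟩, c₃, h3, _, rfl, _, h4, _, h5, _, h6, rfl⟩
    s rfl
  obtain ⟨LU, hLU, h7, h8⟩ := h1 (by decide)
  generalize c₁ .I = q at h7 h8
  subst h8
  obtain ⟨LX, hLX, h9, h10⟩ := h2 (by decide)
  generalize c₂ .I = q' at h9 h10
  subst h10
  simp [start] at h7 h9
  subst h9
  -- Only finitely many values are guessed; the remaining further variables get the value `val [] =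
  -- 0`.
  let ρ : CardVar LU.length LX.length → ℤ := CardVar.assign (vec LU.length LU)
    (fun i => (vec LX.length LX i).toNat) (fun l => val (LW.getD l []))
  obtain ⟨F₀, h11, h12, h13⟩ := h3 (CardVar LU.length LX.length) CardVar.encode ρ
    ⟨LU, LX, LW, by simp [start], by simp [start], by simp [start],
      fun j d hd => ⟨.u ⟨j, (List.getElem?_eq_some_iff.1 hd).1⟩, rfl,
        by simp [ρ, CardVar.assign, vec, hd]⟩,
      fun j d hd => ⟨.x ⟨j, (List.getElem?_eq_some_iff.1 hd).1⟩, rfl, by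
        have : 0 ≤ val d := val_nonneg (hLX rfl d (List.mem_of_getElem? hd))
        have hj : LX.getD j [] = d := by simp [hd]
        simp only [ρ, CardVar.assign, vec, hj]
        exact Int.toNat_of_nonneg this⟩,
      fun j d hd => ⟨.v j, rfl, by simp [ρ, CardVar.assign, hd]⟩⟩
  generalize c₃ .I = q at h11 h13
  subst h13
  obtain rfl := h4 (by decide)
  obtain rfl := h5 (by decide)
  obtain ⟨Fs, h14, h15⟩ := h6 LU LX (by simp [start]) (by simp [start]) (by simp [start])
    (by simp [start]) (by simp [start]) (by simp [start]) (by simp [start])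
  simp [start] at h11 h14
  have hlen : LX.length = Fs.length := h15.length_eq
  refine ⟨⟨LU.length, LX.length, F₀, fun i => Fs[i]⟩, ?_, vec _ LU,
    fun i => (vec LX.length LX i).toNat, fun l => val (LW.getD l []), vec_mem_dom hLU, ?_,
    h12.2 rfl, ?_⟩
  · simp only [LIACard.encode, h7, h11, h14, List.append_assoc]
    congr 5
    apply List.ext_getElem <;> simp [hlen]
  · intro l h
    change 0 ≤ val (LW.getD l [])
    rcases lt_or_ge l LW.length with hj | hj
    · rw [List.getD_eq_getElem _ _ hj]
      exact val_nonneg (hLW h _ (List.getElem_mem hj))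
    · simp [hj]
  · intro i
    obtain ⟨m, h16, h17⟩ := (List.forall₂_iff_get.1 h15).2 i i.2 (lt_of_lt_of_eq i.2 hlen)
    have h16 : val LX[(i : ℕ)] = m := h16
    have : (vec LX.length LX i).toNat = m := by simp [vec, h16]
    change vec LU.length LU ∈ sumPow (solutions nat Fs[(i : ℕ)]) (vec LX.length LX i).toNat
    rw [this]
    exact h17

theorem sound (nat : Bool) (r : Rule) : Sound nat r := by
  cases r with
  | main => exact sound_main
  | revStep a => exact sound_revStep a
  | revDone => exact sound_revDone
  | guessStep nn k d => exact sound_guessStep nn k d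
  | guessDone nn k => exact sound_guessDone nn k
  | initStep nn k => exact sound_initStep nn k
  | initDone nn k => exact sound_initDone nn k
  | guessAllStep k => exact sound_guessAllStep k
  | guessAllDone k => exact sound_guessAllDone k
  | lookupStep k => exact sound_lookupStep k
  | lookupDone k => exact sound_lookupDone k
  | skipStep k d => exact sound_skipStep k d
  | skipDone k => exact sound_skipDone k
  | copyNumStep s d e => exact sound_copyNumStep s d e
  | copyNumDone s d => exact sound_copyNumDone s d
  | moveNumStep neg s d e => exact sound_moveNumStep neg s d e
  | moveNumDone neg s d => exact sound_moveNumDone neg s d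
  | dropNumStep s e => exact sound_dropNumStep s e
  | dropNumDone s => exact sound_dropNumDone s
  | addStep c x y => exact sound_addStep c x y
  | addPadA c => exact sound_addPadA c
  | addPadB c => exact sound_addPadB c
  | addDone c => exact sound_addDone c
  | chkStep r c d => exact sound_chkStep r c d
  | chkDone r c => exact sound_chkDone r c
  | mulStep m ok b => exact sound_mulStep m ok b
  | mulDone m ok => exact sound_mulDone m ok
  | base m => exact sound_base m
  | const neg => exact sound_const neg
  | smul neg => exact sound_smul neg
  | sum => exact sound_sum
  | varU => exact sound_varU
  | varX => exact sound_varX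
  | varV => exact sound_varV
  | le b => exact sound_le b
  | eq r => exact sound_eq r
  | not b => exact sound_not b
  | and b₁ b₂ => exact sound_and b₁ b₂
  | or b₁ b₂ => exact sound_or b₁ b₂
  | copyAllStep s d a => exact sound_copyAllStep s d a
  | copyAllDone s d => exact sound_copyAllDone s d
  | moveAllStep s d a => exact sound_moveAllStep s d a
  | moveAllDone s d => exact sound_moveAllDone s d
  | clearAllStep s a => exact sound_clearAllStep s a
  | clearAllDone s => exact sound_clearAllDone s
  | vecUpdStep => exact sound_vecUpdStep
  | vecUpdDone => exact sound_vecUpdDone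
  | allZeroStep => exact sound_allZeroStep
  | allZeroDone => exact sound_allZeroDone
  | item => exact sound_item
  | finish b => exact sound_finish b
  | phase => exact sound_phase
  | phasesDone => exact sound_phasesDone

theorem mem_satLanguage_of_eval {s : List Token} {w : List Rule}
    (h : Eval (prog nat) [.call .main] (start .J s) w c') : s ∈ LIACard.satLanguage (dom nat) := by
  obtain ⟨_, h, -⟩ := h.sem (sound nat)
  exact h s rfl

end CardVerifier

/-! ### Completeness of the verifier -/

namespace CardVerifier

open StackProgram Token
open Function (update)

/-- The instructions `p` can lead from `c` to `c'` with at most `n` procedure calls. -/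
def Run (nat : Bool) (p : List (Instr Stack Token Proc)) (c : Stack → List Token) (n : ℕ)
    (c' : Stack → List Token) : Prop :=
  ∃ w : List Rule, w.length ≤ n ∧ Eval (prog nat) p c w c'

variable {nat : Bool} {c c' c₁ : Stack → List Token} {p : List (Instr Stack Token Proc)} {n m : ℕ}

theorem Run.nil : Run nat [] c n c := ⟨[], by simp, .nil c⟩

theorem Run.push {k a} (h : Run nat p (update c k (a :: c k)) n c') :
    Run nat (.push k a :: p) c n c' := by
  obtain ⟨w, hw, h⟩ := h
  exact ⟨w, hw, .push h⟩

theorem Run.pop {k a l} (hk : c k = a :: l) (h : Run nat p (update c k l) n c') :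
    Run nat (.pop k a :: p) c n c' := by
  obtain ⟨w, hw, h⟩ := h
  exact ⟨w, hw, .pop hk h⟩

theorem Run.empty {k} (hk : c k = []) (h : Run nat p c n c') :
    Run nat (.empty k :: p) c n c' := by
  obtain ⟨w, hw, h⟩ := h
  exact ⟨w, hw, .empty hk h⟩

theorem Run.rule (r : Rule) (h : Run nat ((prog nat).rhs r) c n c') :
    Run nat [.call ((prog nat).lhs r)] c (n + 1) c' := by
  obtain ⟨w, hw, h⟩ := h
  exact ⟨r :: w, by simpa using hw, .call (by simpa using h)⟩

theorem Run.append {q} (h₁ : Run nat p c n c₁) (h₂ : Run nat q c₁ m c') :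
    Run nat (p ++ q) c (n + m) c' := by
  obtain ⟨w₁, hw₁, h₁⟩ := h₁
  obtain ⟨w₂, hw₂, h₂⟩ := h₂
  exact ⟨w₁ ++ w₂, by simp; omega, h₁.append h₂⟩

theorem Run.seq {q} (h₁ : Run nat [.call q] c n c₁) (h₂ : Run nat p c₁ m c') :
    Run nat (.call q :: p) c (n + m) c' := h₁.append h₂

theorem Run.of_eq {N : ℕ} (h : Run nat p c n c₁) (hn : n ≤ N) (hc : c₁ = c') :
    Run nat p c N c' := by
  obtain ⟨w, hw, h⟩ := h
  exact ⟨w, hw.trans hn, hc ▸ h⟩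

theorem run_rev (a : List Token) (hc : c .J = a) :
    Run nat [.call .rev] c (a.length + 1) (update (update c .I (a.reverse ++ c .I)) .J []) := by
  induction a generalizing c with
  | nil =>
    refine (Run.rule .revDone (n := 0) (.empty hc .nil)).of_eq (by simp) ?_
    simp only [List.reverse_nil, List.nil_append, Function.update_eq_self]
    rw [← hc, Function.update_eq_self]
  | cons t a ih =>
    refine (Run.rule (.revStep t) (.pop hc (.push (ih (by simp))))).of_eq (by simp) ?_
    funext i
    cases i <;> simp

theorem run_guess {nn k} (d : List SignType) (hd : nn = true → ∀ e ∈ d, 0 ≤ e) :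
    Run nat [.call (.guess nn k)] c (d.length + 1) (update c k (num d ++ c k)) := by
  induction d with
  | nil => exact Run.rule (.guessDone nn k) (n := 0) (.push .nil)
  | cons e d ih =>
    simp only [List.mem_cons, forall_eq_or_imp] at hd
    refine (Run.rule (.guessStep nn k e) (.seq (ih fun h => (hd h).2) (.push (n := 0) .nil))).of_eq
      (by simp) ?_
    have : ∀ e : SignType, 0 ≤ e → e * e = e := by decide
    have : (if nn = true then e * e else e) = e := by
      split_ifs with h
      · exact this e (hd h).1
      · rfl
    simp [this]

theorem run_init {nn k} (hk : k ≠ .I) (L : List (List SignType)) (r : List Token)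
    (hL : nn = true → ∀ d ∈ L, ∀ e ∈ d, 0 ≤ e) (hc : c .I = encodeUnary L.length ++ r) :
    Run nat [.call (.init nn k)] c (2 * (nums L).length + 1)
      (update (update c .I r) k (nums L ++ c k)) := by
  induction L generalizing c with
  | nil =>
    exact (Run.rule (.initDone nn k) (n := 0) (.pop hc .nil)).of_eq (by simp)
      (by simp [Function.update_of_ne hk])
  | cons d L ih =>
    simp only [List.mem_cons, forall_eq_or_imp] at hL
    refine (Run.rule (.initStep nn k) (.pop (l := encodeUnary L.length ++ r) ?_
      (.seq (ih (fun h => (hL h).2) (by simp))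
      (run_guess d fun h => (hL h).1)))).of_eq ?_ ?_
    · simp [hc, encodeUnary, List.replicate_succ]
    · simp [num]; omega
    · funext i
      simp only [Function.update_apply]
      split_ifs <;> simp_all

theorem run_guessAll {k} (L : List (List SignType))
    (hL : nat = true → ∀ d ∈ L, ∀ e ∈ d, 0 ≤ e) :
    Run nat [.call (.guessAll k)] c (2 * (nums L).length + 1) (update c k (nums L ++ c k)) := by
  induction L with
  | nil => exact (Run.rule (.guessAllDone k) (n := 0) .nil).of_eq (by simp) (by simp)
  | cons d L ih =>
    simp only [List.mem_cons, forall_eq_or_imp] at hL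
    refine (Run.rule (.guessAllStep k) (.seq (ih fun h => (hL h).2)
      (run_guess d fun h => (hL h).1))).of_eq ?_ ?_
    · simp [num]; omega
    · simp

theorem run_copyNum {s d} (hs : s ≠ d) (e : List SignType) (r : List Token)
    (hc : c s = num e ++ r) :
    Run nat [.call (.copyNum s d)] c (e.length + 1) (update c d (num e ++ c d)) := by
  induction e generalizing c with
  | nil =>
    refine (Run.rule (.copyNumDone s d) (n := 0) (.pop hc (.push (.push .nil)))).of_eq (by simp) ?_
    funext i
    simp only [Function.update_apply]
    split_ifs <;> simp_all
  | cons a e ih =>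
    refine (Run.rule (.copyNumStep s d a) (.pop (l := num e ++ r) (by simpa using hc)
      (.seq (ih (by simp))
      (.push (.push (n := 0) .nil))))).of_eq (by simp) ?_
    funext i
    simp only [Function.update_apply]
    split_ifs <;> simp_all

theorem run_moveNum {neg s d} (hs : s ≠ d) (e : List SignType) (r : List Token)
    (hc : c s = num e ++ r) :
    Run nat [.call (.moveNum neg s d)] c (e.length + 1)
      (update (update c s r) d (num (e.map (flipDig neg)) ++ c d)) := by
  induction e generalizing c with
  | nil =>
    refine (Run.rule (.moveNumDone neg s d) (n := 0) (.pop hc (.push .nil))).of_eq (by simp) ?_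
    funext i
    simp only [Function.update_apply]
    split_ifs <;> simp_all
  | cons a e ih =>
    refine (Run.rule (.moveNumStep neg s d a) (.pop (l := num e ++ r) (by simpa using hc)
      (.seq (ih (by simp))
      (.push (n := 0) .nil)))).of_eq (by simp) ?_
    funext i
    simp only [Function.update_apply]
    split_ifs <;> simp_all

theorem run_dropNum {s} (e : List SignType) (r : List Token) (hc : c s = num e ++ r) :
    Run nat [.call (.dropNum s)] c (e.length + 1) (update c s r) := by
  induction e generalizing c with
  | nil => exact Run.rule (.dropNumDone s) (n := 0) (.pop hc .nil)
  | cons a e ih =>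
    exact (Run.rule (.dropNumStep s a) (.pop (l := num e ++ r) (by simpa using hc)
      (ih (by simp)))).of_eq (by simp) (by simp)

theorem run_lookup {k} (hI : k ≠ .I) (hA : k ≠ .A) (j : ℕ) (L : List (List SignType))
    (d : List SignType) (r : List Token) (hc : c k = nums L) (hd : L[j]? = some d)
    (hj : c .I = encodeUnary j ++ r) :
    Run nat [.call (.lookup k)] c (2 * (nums L).length + 1)
      (update (update c .I r) .A (num d ++ c .A)) := by
  induction j generalizing c L with
  | zero =>
    cases L with
    | nil => simp at hd
    | cons e L =>
      obtain rfl : e = d := by simpa using hd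
      refine (Run.rule (.lookupDone k) (.pop hj (run_copyNum hA e (nums L)
        (by simp [hI, hc])))).of_eq ?_ (by simp)
      simp [num]; omega
  | succ j ih =>
    cases L with
    | nil => simp at hd
    | cons e L =>
      have key (e : List SignType) (c : Stack → List Token) (hc : c k = num e ++ nums L)
          (hj : c .I = encodeUnary j ++ r) :
          Run nat [.call (.skip k)] c (e.length + 1 + (2 * (nums L).length + 1))
            (update (update c .I r) .A (num d ++ c .A)) := by
        induction e generalizing c with
        | nil =>
          refine (Run.rule (.skipDone k) (.pop (l := nums L) (by simpa using hc)
            (.seq (ih L (by simp)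
            (by simpa using hd) (by simpa [hI.symm] using hj)) (.push (n := 0) .nil)))).of_eq
            (by simp [add_comm]; try omega) ?_
          funext i
          simp only [Function.update_apply]
          split_ifs <;> simp_all
        | cons a e ihe =>
          refine (Run.rule (.skipStep k a) (.pop (l := num e ++ nums L) (by simpa using hc)
            (.seq (ihe _ (by simp)
            (by simpa [hI.symm] using hj)) (.push (n := 0) .nil)))).of_eq
            (by simp [add_comm]; try omega) ?_
          funext i
          simp only [Function.update_apply]
          split_ifs <;> simp_all
      refine (Run.rule (.lookupStep k) (.pop (l := encodeUnary j ++ r) ?_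
        (key e _ (by simp [hI, hc]) (by simp)))).of_eq ?_ (by simp)
      · simp [hj, encodeUnary, List.replicate_succ]
      · simp [num]; omega

/-- Both numbers are padded to exactly `N` digits. A position costs at most two paddings and one
addition step, and the final carry is the digit `N + 1`. -/
theorem run_add {N : ℕ} {x : SignType} (a b : List SignType) (r q : List Token)
    (ha : a.length ≤ N) (hb : b.length ≤ N) (hA : c .A = num a ++ r) (hB : c .B = num b ++ q) :
    ∃ z, val z = val a + val b + x ∧ z.length = N + 1 ∧
      Run nat [.call (.add x)] c (3 * N + 1) (update (update c .A (num z ++ r)) .B q) := by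
  induction N generalizing x a b c with
  | zero =>
    obtain rfl : a = [] := by simpa using ha
    obtain rfl : b = [] := by simpa using hb
    refine ⟨[x], by simp, rfl, (Run.rule (.addDone x) (n := 0) (.pop hA (.pop (by simpa using hB)
      (.push (.push .nil))))).of_eq (by simp) ?_⟩
    funext i
    cases i <;> simp
  | succ N ih =>
    have key (d e : SignType) (a b : List SignType) (ha : a.length ≤ N) (hb : b.length ≤ N)
        (c : Stack → List Token) (hA : c .A = num (d :: a) ++ r)
        (hB : c .B = num (e :: b) ++ q) :
        ∃ z, val z = val (d :: a) + val (e :: b) + x ∧ z.length = N + 1 + 1 ∧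
          Run nat [.call (.add x)] c (3 * N + 2) (update (update c .A (num z ++ r)) .B q) := by
      obtain ⟨z, h1, h2, h3⟩ := ih (c := update (update c .A (num a ++ r)) .B (num b ++ q))
        (x := carry x d e) a b ha hb (by simp) (by simp)
      refine ⟨sumDig x d e :: z, ?_, by simp [h2], (Run.rule (.addStep x d e) (.pop hA
        (.pop (l := num b ++ q) (by simpa using hB) (.seq h3 (.push (n := 0) .nil))))).of_eq
        (by omega) ?_⟩
      · have := carry_spec x d e
        simp only [val_cons, h1]
        linarith
      · funext i
        cases i <;> simp
    have padA {n c'} {c : Stack → List Token} (hA : c .A = sep :: r)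
        (h : Run nat [.call (.add x)] (update c .A (num [0] ++ r)) n c') :
        Run nat [.call (.add x)] c (n + 1) c' :=
      Run.rule (.addPadA x) (.pop hA (.push (.push (by
        simpa [show dig 0 = bit0 from rfl] using h))))
    have padB {n c'} {c : Stack → List Token} (hB : c .B = sep :: q)
        (h : Run nat [.call (.add x)] (update c .B (num [0] ++ q)) n c') :
        Run nat [.call (.add x)] c (n + 1) c' :=
      Run.rule (.addPadB x) (.pop hB (.push (.push (by
        simpa [show dig 0 = bit0 from rfl] using h))))
    have key₂ (d : SignType) (a b : List SignType) (ha : a.length ≤ N) (hb : b.length ≤ N + 1)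
        (c : Stack → List Token) (hA : c .A = num (d :: a) ++ r)
        (hB : c .B = num b ++ q) :
        ∃ z, val z = val (d :: a) + val b + x ∧ z.length = N + 1 + 1 ∧
          Run nat [.call (.add x)] c (3 * N + 3) (update (update c .A (num z ++ r)) .B q) := by
      cases b with
      | nil =>
        obtain ⟨z, h1, h2, h3⟩ := key d 0 a [] ha (by simp) (update c .B (num [0] ++ q))
          (by simpa using hA) (by simp)
        refine ⟨z, by simpa using h1, h2, (padB hB h3).of_eq le_rfl ?_⟩
        funext i
        cases i <;> simp
      | cons e b =>
        obtain ⟨z, h1, h2, h3⟩ := key d e a b ha (by simpa using hb) c hA hB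
        exact ⟨z, h1, h2, h3.of_eq (by omega) rfl⟩
    cases a with
    | nil =>
      obtain ⟨z, h1, h2, h3⟩ := key₂ 0 [] b (by simp) hb (update c .A (num [0] ++ r))
        (by simp) (by simpa using hB)
      refine ⟨z, by simpa using h1, h2, (padA hA h3).of_eq (by omega) ?_⟩
      simp
    | cons d a =>
      obtain ⟨z, h1, h2, h3⟩ := key₂ d a b (by simpa using ha) hb c hA hB
      exact ⟨z, h1, h2, h3.of_eq (by omega) rfl⟩

theorem run_chk {rel : Rel} {x : SignType} (a : List SignType) (r : List Token)
    (hc : c .A = num a ++ r) (h : rel.Holds (val a + x)) :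
    Run nat [.call (.chk rel x)] c (a.length + 1) (update c .A r) := by
  induction a generalizing c x with
  | nil =>
    refine (Run.rule (.chkDone rel x) (n := 0) ?_).of_eq (by simp) rfl
    change Run nat (if rel.Holds x then _ else _) _ _ _
    rw [if_pos (by simpa using h)]
    exact .pop hc .nil
  | cons d a ih =>
    -- A missing carry would mean that an odd number is compared with zero for equality, which `h`
    -- excludes.
    obtain ⟨y, hy⟩ : ∃ y, rel.next x d = some y := by
      cases rel <;> cases x <;> cases d <;> simp [Rel.next] <;>
        simp [Rel.Holds] at h <;> omega
    have h2 : Run nat [.call ((rel.next x d).elim .fail (.chk rel))]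
        (update c .A (num a ++ r)) (a.length + 1) (update (update c .A (num a ++ r)) .A r) := by
      rw [hy]
      exact ih (by simp) ((Rel.next_spec hy _).1 h)
    exact (Run.rule (.chkStep rel x d) (.pop hc h2)).of_eq (by simp) (by simp)

theorem run_copyAll {s d} (hs : s ≠ d) (a : List Token) (hc : c s = a) :
    Run nat [.call (.copyAll s d)] c (a.length + 1) (update c d (a ++ c d)) := by
  induction a generalizing c with
  | nil => exact (Run.rule (.copyAllDone s d) (n := 0) (.empty hc .nil)).of_eq (by simp) (by simp)
  | cons t a ih =>
    refine (Run.rule (.copyAllStep s d t) (.pop hc (.seq (ih (by simp))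
      (.push (.push (n := 0) .nil))))).of_eq (by simp) ?_
    funext i
    simp only [Function.update_apply]
    split_ifs <;> simp_all

theorem run_moveAll {s d} (hs : s ≠ d) (a : List Token) (hc : c s = a) :
    Run nat [.call (.moveAll s d)] c (a.length + 1) (update (update c d (a ++ c d)) s []) := by
  induction a generalizing c with
  | nil =>
    refine (Run.rule (.moveAllDone s d) (n := 0) (.empty hc .nil)).of_eq (by simp) ?_
    rw [← hc]
    simp [hc]
  | cons t a ih =>
    refine (Run.rule (.moveAllStep s d t) (.pop hc (.seq (ih (by simp))
      (.push (n := 0) .nil)))).of_eq (by simp) ?_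
    funext i
    simp only [Function.update_apply]
    split_ifs <;> simp_all

theorem run_clearAll {s} (a : List Token) (hc : c s = a) :
    Run nat [.call (.clearAll s)] c (a.length + 1) (update c s []) := by
  induction a generalizing c with
  | nil =>
    exact (Run.rule (.clearAllDone s) (n := 0) (.empty hc .nil)).of_eq (by simp) (by simp [← hc])
  | cons t a ih =>
    exact (Run.rule (.clearAllStep s t) (.pop hc (ih (by simp)))).of_eq (by simp) (by simp)

end CardVerifier

/-! ### Number of calls for multiplication, terms and formulas. -/

namespace CardVerifier

open StackProgram Token
open Function (update)

variable {nat : Bool} {c c' c₁ : Stack → List Token} {p : List (Instr Stack Token Proc)} {n m : ℕ}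

theorem IsBits.tail {b ok : Bool} {l : List Bool} (h : IsBits ok (b :: l)) : IsBits b l := by
  obtain ⟨⟨n, hn⟩, -⟩ := h
  induction n using Nat.binaryRec' with
  | zero => simp at hn
  | bit b' n hb _ =>
    rw [Nat.bits_append_bit n b' hb] at hn
    obtain ⟨rfl, rfl⟩ := List.cons.inj hn
    refine ⟨⟨n, rfl⟩, fun h => hb ?_⟩
    rw [← bitsVal_bits n, h]
    rfl

theorem isBits_bits {n : ℕ} {ok : Bool} (h : n = 0 → ok = true) : IsBits ok n.bits := by
  refine ⟨⟨n, rfl⟩, fun hn => h ?_⟩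
  rw [← bitsVal_bits n, hn]
  rfl

/-- Numbers are not normalized: each binary digit lengthens the product by one digit for the
doubling and by one for the carry of the addition. -/
theorem run_mul {m : Mode} {ok : Bool} {N : ℕ} (l : List Bool) (r : List Token)
    (t : List SignType) (q : List Token) (hI : c .I = l.map bit ++ sep :: r)
    (hl : m ≠ .vec → IsBits ok l) (hb : Run nat [.call (.base m)] (update c .I r) n c₁)
    (hT : c₁ .T = num t ++ q) (hN : t.length + 2 * l.length ≤ N) :
    ∃ z, val z = bitsVal l * val t ∧ z.length ≤ t.length + 2 * l.length ∧
      Run nat [.call (.mul m ok)] c (n + 1 + l.length * (4 * N + 3))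
        (update c₁ .A (num z ++ c₁ .A)) := by
  induction l generalizing c ok with
  | nil =>
    refine ⟨[], by simp [bitsVal], by simp, (Run.rule (.mulDone m ok) (n := n) ?_).of_eq
      (by simp) rfl⟩
    have hok : (ok || decide (m = .vec)) = true := by
      by_cases hm : m = .vec
      · simp [hm]
      · simp [(hl hm).2 rfl]
    change Run nat (if ok || m = .vec then _ else _) _ _ _
    rw [if_pos hok]
    exact .pop (by simpa using hI) (.seq (m := 0) hb (.push .nil))
  | cons b l ih =>
    simp only [List.length_cons] at hN
    obtain ⟨z, h1, h2, h3⟩ := ih (c := update c .I (l.map bit ++ sep :: r)) (ok := b)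
      (by simp) (fun hm => (hl hm).tail) (by simpa using hb) (by omega)
    have e : (l.length + 1) * (4 * N + 3) = l.length * (4 * N + 3) + (4 * N + 3) := by ring
    cases b with
    | false =>
      refine ⟨0 :: z, ?_, by simp; omega, (Run.rule (.mulStep m ok false)
        (.pop (l := l.map bit ++ sep :: r) (by simpa using hI)
          (.seq h3 (.push (n := 0) .nil)))).of_eq
        (by simp only [List.length_cons, e]; omega) (by simp; rfl)⟩
      simp [h1, bitsVal, Nat.bit_val]; ring
    | true =>
      set c₂ := update c₁ .A (num (0 :: z) ++ c₁ .A) with hc₂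
      have h4 : Run nat [.call (.copyNum .T .B)]
          (update (update c₁ .A (num z ++ c₁ .A)) .A (bit0 :: update c₁ .A (num z ++ c₁ .A) .A))
          (t.length + 1) (update c₂ .B (num t ++ c₂ .B)) := by
        have := run_copyNum (nat := nat) (s := .T) (d := .B) (c := c₂) (by decide) t q
          (by simpa [hc₂] using hT)
        simpa [hc₂, show dig 0 = bit0 from rfl] using this
      obtain ⟨z', h5, h6, h7⟩ := run_add (nat := nat) (x := 0) (N := t.length + 2 * l.length + 1)
        (c := update c₂ .B (num t ++ c₂ .B)) (0 :: z) t (c₁ .A) (c₂ .B)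
        (by simp; omega) (by omega) (by simp [hc₂]) (by simp)
      refine ⟨z', ?_, by simp; omega, (Run.rule (.mulStep m ok true)
        (.pop (l := l.map bit ++ sep :: r) (by simpa using hI)
          (.seq h3 (.push (.seq h4 h7))))).of_eq ?_ ?_⟩
      · simp [h5, h1, bitsVal, Nat.bit_val]; ring
      · simp only [List.length_cons, e]; omega
      · funext i
        cases i <;> simp [hc₂]

/-- The variable `a` has a value of length at most `B` on one of the stacks `U`, `X`, `W`, which
have length at most `E`. -/
def Found {α : Type} (B E : ℕ) (c : Stack → List Token) (var : α → List Token) (ρ : α → ℤ)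
    (a : α) : Prop :=
  ∃ (x : Token × Stack) (L : List (List SignType)) (j : ℕ) (d : List SignType),
    x ∈ [(varU, Stack.U), (varX, .X), (varV, .W)] ∧ c x.2 = nums L ∧ L[j]? = some d ∧
    var a = x.1 :: encodeUnary j ∧ ρ a = val d ∧ d.length ≤ B ∧ (nums L).length ≤ E

theorem Found.congr {α : Type} {B E : ℕ} {var : α → List Token} {ρ : α → ℤ} {a : α}
    (h : Found B E c var ρ a) (hU : c' .U = c .U) (hX : c' .X = c .X) (hW : c' .W = c .W) :
    Found B E c' var ρ a := by
  obtain ⟨x, L, j, d, hx, h1, h2⟩ := h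
  refine ⟨x, L, j, d, hx, ?_, h2⟩
  simp only [List.mem_cons, List.not_mem_nil, or_false] at hx
  rcases hx with rfl | rfl | rfl <;> simp_all

section Formulas

variable {α : Type} {var : α → List Token} {ρ : α → ℤ} {B E S N K : ℕ}

/-- Each token of the text pays for `K` calls and for two digits of the value. Hence all
intermediate values have at most `N` digits, and one operation on such numbers, or one search
through the variables, stays within `K`. In a multiplication by a constant, each binary digit pays
for one addition. -/
theorem run_term (hN : B + 2 * S + 2 ≤ N) (hK : 9 * N + 2 * E + 20 ≤ K) (t : LinTerm α)
    (r : List Token) (hF : ∀ a, (var a).length ≤ S → Found B E c var ρ a)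
    (hS : (t.encode var).length ≤ S) (hI : c .I = t.encode var ++ r) :
    ∃ z, val z = t.value ρ ∧ z.length ≤ B + 2 * (t.encode var).length ∧
      Run nat [.call .term] c ((t.encode var).length * K)
        (update (update c .I r) .A (num z ++ c .A)) := by
  induction t generalizing c r with
  | const a =>
    set l := a.natAbs.bits with hl
    have hE : (LinTerm.const a).encode var = Token.const :: sgn (decide (a < 0)) ::
        (l.map bit ++ [sep]) := by
      simp only [LinTerm.encode, encodeInt, List.cons.injEq, true_and]
      refine ⟨?_, rfl⟩
      by_cases ha : a < 0 <;> simp [ha, sgn]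
    rw [hE] at hS hI ⊢
    simp only [List.length_cons, List.length_append, List.length_map, List.length_nil] at hS ⊢
    have hbits : IsBits (!decide (a < 0)) l := isBits_bits fun h => by
      have : a = 0 := by omega
      simp [this]
    set c₂ := update c .I (l.map bit ++ sep :: r) with hc₂
    have h1 : Run nat [.call (.base (.const (decide (a < 0))))] (update c₂ .I r) 1
        (update (update c .I r) .T (num [flipDig (decide (a < 0)) 1] ++ c .T)) :=
      (Run.rule (.base (.const _)) (n := 0) (.push (.push .nil))).of_eq le_rfl (by simp [hc₂])
    obtain ⟨z, h2, h3, h4⟩ := run_mul (ok := !decide (a < 0)) (N := N) l r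
      [flipDig (decide (a < 0)) 1] (c .T) (by simp [hc₂])
      (fun _ => hbits) h1 (by simp) (by simp; omega)
    simp only [Function.update_of_ne (show Stack.A ≠ .T by decide),
      Function.update_of_ne (show Stack.A ≠ .I by decide)] at h4
    have h5 := run_dropNum (nat := nat) (s := .T) [flipDig (decide (a < 0)) 1] (c .T)
      (c := update (update (update c .I r) .T (num [flipDig (decide (a < 0)) 1] ++ c .T)) .A
        (num z ++ c .A)) (by simp)
    refine ⟨z, ?_, by simp at h3; omega, (Run.rule (.const (decide (a < 0)))
      (.pop (l := sgn (decide (a < 0)) :: (l.map bit ++ sep :: r)) (by simpa using hI)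
      (.pop (l := l.map bit ++ sep :: r) (by simp) (.seq (by simpa [hc₂] using h4) h5)))).of_eq
      ?_ ?_⟩
    · rw [h2, hl, bitsVal_bits]
      by_cases ha : a < 0
      · simp [ha, flipDig, LinTerm.value, abs_of_neg ha]
      · simp [ha, flipDig, LinTerm.value, abs_of_nonneg (not_lt.1 ha)]
    · have : l.length * (4 * N + 3) ≤ l.length * K := Nat.mul_le_mul_left _ (by omega)
      have e : (l.length + (0 + 1) + 1 + 1) * K = l.length * K + 3 * K := by ring
      simp only [e, List.length_cons, List.length_nil]
      omega
    · funext i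
      cases i <;> simp
  | var a =>
    obtain ⟨⟨τ, k⟩, L, j, d, hx, h1, h2, h3, h4, h5, h6⟩ := hF a hS
    simp only [LinTerm.encode, h3, List.cons_append] at hI ⊢
    refine ⟨d, by simp [LinTerm.value, h4], by omega, ?_⟩
    have hlen : 2 * (nums L).length + 1 + 1 ≤ (τ :: encodeUnary j).length * K := by
      simp only [List.length_cons, Nat.add_mul, one_mul]
      omega
    simp only [List.mem_cons, List.not_mem_nil, or_false, Prod.mk.injEq] at hx
    rcases hx with ⟨rfl, rfl⟩ | ⟨rfl, rfl⟩ | ⟨rfl, rfl⟩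
    · exact (Run.rule .varU (.pop hI (run_lookup (by decide) (by decide) j L d r (by simpa using h1)
        h2 (by simp)))).of_eq hlen (by simp)
    · exact (Run.rule .varX (.pop hI (run_lookup (by decide) (by decide) j L d r (by simpa using h1)
        h2 (by simp)))).of_eq hlen (by simp)
    · exact (Run.rule .varV (.pop hI (run_lookup (by decide) (by decide) j L d r (by simpa using h1)
        h2 (by simp)))).of_eq hlen (by simp)
  | add s t ihs iht =>
    simp only [LinTerm.encode, List.length_cons, List.length_append, List.cons_append,
      List.append_assoc] at hS hI ⊢
    obtain ⟨x, h1, h2, h3⟩ := ihs (c := update c .I (s.encode var ++ (t.encode var ++ r))) _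
      (fun a ha => (hF a ha).congr (by simp) (by simp) (by simp)) (by omega) (by simp; rfl)
    set c₂ := update (update c .I (t.encode var ++ r)) .A (num x ++ c .A) with hc₂
    obtain ⟨y, h4, h5, h6⟩ := iht (c := c₂) r
      (fun a ha => (hF a ha).congr (by simp [hc₂]) (by simp [hc₂]) (by simp [hc₂])) (by omega)
      (by simp [hc₂])
    set c₃ := update (update c₂ .I r) .A (num y ++ c₂ .A) with hc₃
    have h7 := run_moveNum (nat := nat) (neg := false) (s := .A) (d := .B) (c := c₃) (by decide) y
      (num x ++ c .A) (by simp [hc₂, hc₃])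
    set c₄ := update (update c₃ .A (num x ++ c .A)) .B (num (y.map (flipDig false)) ++ c₃ .B)
      with hc₄
    obtain ⟨z, h8, h9, h10⟩ := run_add (nat := nat) (x := 0)
      (N := B + 2 * ((s.encode var).length + (t.encode var).length)) (c := c₄) x
      (y.map (flipDig false)) (c .A) (c .B) (by omega) (by simp; omega) (by simp [hc₄])
      (by simp [hc₄, hc₃, hc₂])
    refine ⟨z, ?_, by omega, (Run.rule .sum (.pop hI (.seq (c₁ := c₂) (h3.of_eq le_rfl
      (by simp [hc₂])) (.seq h6 (.seq h7 h10))))).of_eq ?_ ?_⟩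
    · rw [h8, map_flip_false, h1, h4, LinTerm.value]; simp
    · simp only [Nat.add_mul, one_mul]
      omega
    · funext i
      cases i <;> simp [hc₄, hc₃, hc₂]
  | smul a t ih =>
    set l := a.natAbs.bits with hl
    have hE : (LinTerm.smul a t).encode var = Token.smul :: sgn (decide (a < 0)) ::
        (l.map bit ++ sep :: t.encode var) := by
      simp only [LinTerm.encode, encodeInt, List.cons.injEq, true_and, List.cons_append,
        List.append_assoc]
      refine ⟨?_, rfl⟩
      by_cases ha : a < 0 <;> simp [ha, sgn]
    rw [hE] at hS hI ⊢
    simp only [List.length_cons, List.length_append, List.length_map] at hS ⊢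
    have hbits : IsBits (!decide (a < 0)) l := isBits_bits fun h => by
      have : a = 0 := by omega
      simp [this]
    set neg := decide (a < 0) with hneg
    set c₂ := update c .I (l.map bit ++ sep :: (t.encode var ++ r)) with hc₂
    obtain ⟨x, h1, h2, h3⟩ := ih (c := update c₂ .I (t.encode var ++ r)) r
      (fun a ha => (hF a ha).congr (by simp [hc₂]) (by simp [hc₂]) (by simp [hc₂])) (by omega)
      (by simp)
    have h4 := run_moveNum (nat := nat) (neg := neg) (s := .A) (d := .T)
      (c := update (update c .I r) .A (num x ++ c .A)) (by decide) x (c .A) (by simp)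
    have h5 : Run nat [.call (.base (.term neg))] (update c₂ .I (t.encode var ++ r)) _
        (update (update c .I r) .T (num (x.map (flipDig neg)) ++ c .T)) :=
      (Run.rule (.base (.term neg)) (.seq (h3.of_eq le_rfl (by simp [hc₂])) h4)).of_eq le_rfl (by
        funext i
        cases i <;> simp)
    obtain ⟨z, h6, h7, h8⟩ := run_mul (ok := !neg) (N := N) l (t.encode var ++ r)
      (x.map (flipDig neg)) (c .T) (by simp [hc₂]) (fun _ => hbits) h5 (by simp) (by simp; omega)
    simp only [Function.update_of_ne (show Stack.A ≠ .T by decide),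
      Function.update_of_ne (show Stack.A ≠ .I by decide)] at h8
    have h9 := run_dropNum (nat := nat) (s := .T) (x.map (flipDig neg)) (c .T)
      (c := update (update (update c .I r) .T (num (x.map (flipDig neg)) ++ c .T)) .A
        (num z ++ c .A)) (by simp)
    refine ⟨z, ?_, by simp at h7; omega, (Run.rule (.smul neg)
      (.pop (l := sgn neg :: (l.map bit ++ sep :: (t.encode var ++ r))) (by simpa using hI)
      (.pop (l := l.map bit ++ sep :: (t.encode var ++ r)) (by simp)
        (.seq (by simpa [hc₂] using h8) h9)))).of_eq ?_ ?_⟩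
    · rw [h6, hl, bitsVal_bits, val_flip, h1, LinTerm.value]
      by_cases ha : a < 0
      · have : ((a.natAbs : ℕ) : ℤ) = -a := by omega
        simp [ha, hneg, this]
      · have : ((a.natAbs : ℕ) : ℤ) = a := by omega
        simp [ha, hneg, this]
    · have : l.length * (4 * N + 3) ≤ l.length * K := Nat.mul_le_mul_left _ (by omega)
      have e : (l.length + ((t.encode var).length + 1) + 1 + 1) * K =
        l.length * K + (t.encode var).length * K + 3 * K := by ring
      simp only [e, List.length_map]
      omega
    · funext i
      cases i <;> simp

theorem run_compare (hN : B + 2 * S + 2 ≤ N) (hK : 9 * N + 2 * E + 20 ≤ K) (s t : LinTerm α)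
    (rel : Rel) (r : List Token) (hF : ∀ a, (var a).length ≤ S → Found B E c var ρ a)
    (hS : (s.encode var).length + (t.encode var).length ≤ S)
    (hI : c .I = s.encode var ++ (t.encode var ++ r))
    (h : rel.Holds (s.value ρ - t.value ρ)) :
    Run nat [.call .term, .call .term, .call (.moveNum true .A .B), .call (.add 0),
      .call (.chk rel 0)] c (((s.encode var).length + (t.encode var).length) * K + 5 * N + 7)
      (update c .I r) := by
  obtain ⟨x, h1, h2, h3⟩ := run_term (nat := nat) (c := c) hN hK s _ hF (by omega) hI
  set c₂ := update (update c .I (t.encode var ++ r)) .A (num x ++ c .A) with hc₂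
  obtain ⟨y, h4, h5, h6⟩ := run_term (nat := nat) (c := c₂) hN hK t r
    (fun a ha => (hF a ha).congr (by simp [hc₂]) (by simp [hc₂]) (by simp [hc₂])) (by omega)
    (by simp [hc₂])
  set c₃ := update (update c₂ .I r) .A (num y ++ c₂ .A) with hc₃
  have h7 := run_moveNum (nat := nat) (neg := true) (s := .A) (d := .B) (c := c₃) (by decide) y
    (num x ++ c .A) (by simp [hc₂, hc₃])
  set c₄ := update (update c₃ .A (num x ++ c .A)) .B (num (y.map (flipDig true)) ++ c₃ .B)
    with hc₄
  obtain ⟨z, h8, h9, h10⟩ := run_add (nat := nat) (x := 0) (N := N) (c := c₄) x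
    (y.map (flipDig true)) (c .A) (c .B) (by omega) (by simp; omega) (by simp [hc₄])
    (by simp [hc₄, hc₃, hc₂])
  have h11 : Run nat [.call (.chk rel 0)] (update (update c₄ .A (num z ++ c .A)) .B (c .B))
      (z.length + 1) _ := run_chk z (c .A) (by simp) (by
    rw [h8, val_flip, h1, h4]
    simpa [sub_eq_add_neg] using h)
  refine (h3.seq (h6.seq (h7.seq (h10.seq h11)))).of_eq ?_ ?_
  · simp only [Nat.add_mul]
    omega
  · funext i
    cases i <;> simp [hc₄, hc₃, hc₂]

theorem run_tf (hN : B + 2 * S + 2 ≤ N) (hK : 9 * N + 2 * E + 20 ≤ K) (F : QFPA α) (b : Bool)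
    (r : List Token) (hF : ∀ a, (var a).length ≤ S → Found B E c var ρ a)
    (hS : (F.encode var).length ≤ S) (hI : c .I = F.encode var ++ r)
    (h : F.Holds ρ ↔ b = true) :
    Run nat [.call (.tf b)] c ((F.encode var).length * K) (update c .I r) := by
  induction F generalizing c r b with
  | le s t =>
    simp only [QFPA.encode, List.length_cons, List.length_append, List.cons_append,
      List.append_assoc] at hS hI ⊢
    refine (Run.rule (.le b) (.pop hI (run_compare hN hK s t _ r
      (fun a ha => (hF a ha).congr (by simp) (by simp) (by simp)) (by omega) (by simp) ?_))).of_eq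
      ?_ (by simp)
    · cases b <;> simp_all [Rel.Holds, QFPA.Holds]
    · simp only [Nat.add_mul, one_mul]
      omega
  | eq s t =>
    simp only [QFPA.encode, List.length_cons, List.length_append, List.cons_append,
      List.append_assoc] at hS hI ⊢
    have key (rel : Rel) (hr : rel ≠ .le) (hb : decide (rel = .eq) = b)
        (hh : rel.Holds (s.value ρ - t.value ρ)) : Run nat [.call (.tf b)] c
          (((s.encode var).length + (t.encode var).length + 1) * K) (update c .I r) := by
      have h1 := Run.pop (k := .I) hI (run_compare (nat := nat) hN hK s t rel r
        (fun a ha => (hF a ha).congr (by simp) (by simp) (by simp)) (by omega) (by simp) hh)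
      have h2 := Run.rule (nat := nat) (.eq rel) (c := c) (by
        cases rel with
        | le => exact absurd rfl hr
        | gt => exact h1
        | eq => exact h1
        | lt => exact h1)
      rw [← hb]
      refine h2.of_eq ?_ (by simp)
      simp only [Nat.add_mul, one_mul]
      omega
    cases b with
    | true =>
      refine key .eq (by simp) rfl ?_
      simp only [QFPA.Holds, iff_true] at h
      simp [Rel.Holds, h]
    | false =>
      simp only [QFPA.Holds, Bool.false_eq_true, iff_false] at h
      rcases lt_or_gt_of_ne h with h | h
      · exact key .lt (by simp) rfl (by simp [Rel.Holds, h])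
      · exact key .gt (by simp) rfl (by simp [Rel.Holds, h])
  | not F ih =>
    simp only [QFPA.encode, List.length_cons, List.cons_append] at hS hI ⊢
    refine (Run.rule (.not b) (.pop hI (ih (!b) r
      (fun a ha => (hF a ha).congr (by simp) (by simp) (by simp)) (by omega) (by simp) ?_))).of_eq
      ?_ (by simp)
    · cases b <;> simp_all [QFPA.Holds]
    · simp only [Nat.add_mul, one_mul]
      omega
  | and F G ihF ihG =>
    simp only [QFPA.encode, List.length_cons, List.length_append, List.cons_append,
      List.append_assoc] at hS hI ⊢
    classical
    have hb : b = (decide (F.Holds ρ) && decide (G.Holds ρ)) := by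
      rw [Bool.eq_iff_iff, ← h]
      simp [QFPA.Holds]
    rw [hb]
    refine (Run.rule (.and _ _) (.pop hI (.seq (ihF _ _
      (fun a ha => (hF a ha).congr (by simp) (by simp) (by simp)) (by omega)
      (Function.update_self ..) (by simp)) (ihG _ r
      (fun a ha => (hF a ha).congr (by simp) (by simp) (by simp)) (by omega)
      (by simp) (by simp))))).of_eq ?_ (by simp)
    simp only [Nat.add_mul, one_mul]
    omega
  | or F G ihF ihG =>
    simp only [QFPA.encode, List.length_cons, List.length_append, List.cons_append,
      List.append_assoc] at hS hI ⊢
    classical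
    have hb : b = (decide (F.Holds ρ) || decide (G.Holds ρ)) := by
      rw [Bool.eq_iff_iff, ← h]
      simp [QFPA.Holds]
    rw [hb]
    refine (Run.rule (.or _ _) (.pop hI (.seq (ihF _ _
      (fun a ha => (hF a ha).congr (by simp) (by simp) (by simp)) (by omega)
      (Function.update_self ..) (by simp)) (ihG _ r
      (fun a ha => (hF a ha).congr (by simp) (by simp) (by simp)) (by omega)
      (by simp) (by simp))))).of_eq ?_ (by simp)
    simp only [Nat.add_mul, one_mul]
    omega

end Formulas

end CardVerifier

/-! ### Number of calls for the sum constraints and for a whole run. -/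

namespace CardVerifier

open StackProgram Token
open Function (update)

variable {nat : Bool} {c c' c₁ : Stack → List Token} {p : List (Instr Stack Token Proc)} {n m : ℕ}

/-- The digits of an integer. -/
def ofInt (z : ℤ) : List SignType :=
  z.natAbs.bits.map fun b => bif b then (if z < 0 then -1 else 1) else 0

theorem val_ofInt (z : ℤ) : val (ofInt z) = z := by
  have key (l : List Bool) (s : SignType) :
      val (l.map fun b => bif b then s else 0) = bitsVal l * s := by
    induction l with
    | nil => simp [bitsVal]
    | cons b l ih =>
      cases b
      · simp [ih, bitsVal, Nat.bit_val]; ring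
      · simp [ih, bitsVal, Nat.bit_val]; ring
  rw [ofInt, key, bitsVal_bits]
  split_ifs with h
  · simp [abs_of_neg h]
  · simp [abs_of_nonneg (not_lt.1 h)]

theorem ofInt_nonneg {z : ℤ} (h : 0 ≤ z) : ∀ d ∈ ofInt z, 0 ≤ d := by
  intro d hd
  obtain ⟨b, -, rfl⟩ := List.mem_map.1 hd
  rw [if_neg (not_lt.2 h)]
  cases b <;> simp

theorem length_ofInt {z : ℤ} {B : ℕ} (h : z.natAbs < 2 ^ B) : (ofInt z).length ≤ B := by
  rw [ofInt, List.length_map, Nat.size_eq_bits_len]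
  exact Nat.size_le.2 h

theorem num_ofInt_natCast (m : ℕ) : num (ofInt m) = m.bits.map bit ++ [sep] := by
  simp only [num, ofInt, Int.natAbs_natCast, List.map_map]
  congr 1
  refine List.map_congr_left fun b _ => ?_
  cases b
  · rfl
  · simp [dig, bit]
    rfl

theorem length_nums {L : List (List SignType)} {B : ℕ} (h : ∀ d ∈ L, d.length ≤ B) :
    (nums L).length ≤ L.length * (B + 1) := by
  induction L with
  | nil => simp
  | cons d L ih =>
    simp only [List.mem_cons, forall_eq_or_imp] at h
    have := ih h.2
    simp only [nums_cons, List.length_append, List.length_cons, num, List.length_map,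
      List.length_nil, Nat.add_mul, one_mul]
    omega

theorem run_vecUpd {N Q : ℕ} (hQ : N * (4 * N + 3) + 8 * N + 13 ≤ Q) (l : List Bool)
    (r : List Token) (Y L : List (List SignType)) (hU : c .U = nums Y) (hR : c .R = nums L)
    (hM : c .M = l.map bit ++ sep :: r) (hlen : Y.length = L.length)
    (hY : ∀ y ∈ Y, y.length + 2 * l.length ≤ N) (hL : ∀ x ∈ L, x.length ≤ N) :
    ∃ Z, Z.map val = List.zipWith (fun y x => val x - bitsVal l * val y) Y L ∧
      (∀ z ∈ Z, z.length ≤ N + 1) ∧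
      Run nat [.call .vecUpd] c (Y.length * Q + 1) (update (update c .U []) .R (nums Z)) := by
  induction Y generalizing c L with
  | nil =>
    obtain rfl : L = [] := by simpa using hlen.symm
    refine ⟨[], by simp, by simp, (Run.rule .vecUpdDone (n := 0)
      (.empty hU (.empty hR .nil))).of_eq (by simp) ?_⟩
    funext i
    cases i <;> simp_all
  | cons y Y ih =>
    obtain _ | ⟨x, L⟩ := L
    · simp at hlen
    simp only [List.mem_cons, forall_eq_or_imp, List.length_cons, Nat.add_right_cancel_iff]
      at hY hL hlen
    set l' : List SignType := l.map fun b => bif b then 1 else 0 with hl'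
    have hnum : num l' = l.map bit ++ [sep] := by
      simp only [num, hl', List.map_map]
      congr 1
      refine List.map_congr_left fun b _ => ?_
      cases b <;> rfl
    have h1 := run_copyNum (nat := nat) (s := .M) (d := .I) (c := c) (by decide) l' r
      (by simp [hnum, hM])
    set c₁ := update c .I (num l' ++ c .I) with hc₁
    set t := y.map (flipDig true) with ht
    set c₂ := update (update c .U (nums Y)) .T (num t ++ c .T) with hc₂
    have h2 : Run nat [.call (.base .vec)] (update c₁ .I (c .I)) (y.length + 1 + 1) c₂ :=
      Run.rule (.base .vec) ((run_moveNum (by decide) y (nums Y) (by simp [hc₁, hU])).of_eq le_rfl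
        (by simp [hc₁, hc₂, ht]))
    obtain ⟨z, h3, h4, h5⟩ := run_mul (m := .vec) (ok := true) (N := N) l (c .I) t (c .T)
      (by simp [hc₁, hnum]) (by simp) h2 (by simp [hc₂]) (by simpa [ht] using hY.1)
    set c₃ := update c₂ .A (num z ++ c₂ .A) with hc₃
    have h6 := run_dropNum (nat := nat) (s := .T) (c := c₃) t (c .T) (by simp [hc₃, hc₂])
    set c₄ := update c₃ .T (c .T) with hc₄
    have h7 := run_moveNum (nat := nat) (neg := false) (s := .R) (d := .B) (c := c₄) (by decide) x
      (nums L) (by simp [hc₄, hc₃, hc₂, hR])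
    set c₅ := update (update c₄ .R (nums L)) .B (num (x.map (flipDig false)) ++ c₄ .B) with hc₅
    obtain ⟨w, h8, h9, h10⟩ := run_add (nat := nat) (x := 0) (N := N) (c := c₅) z
      (x.map (flipDig false)) (c .A) (c .B) (by simp [ht] at h4; omega) (by simpa using hL.1)
      (by simp [hc₅, hc₄, hc₃, hc₂]) (by simp [hc₅, hc₄, hc₃, hc₂])
    set c₆ := update (update c₅ .A (num w ++ c .A)) .B (c .B) with hc₆
    obtain ⟨Z, h11, h12, h13⟩ := ih (c := c₆) L (by simp [hc₆, hc₅, hc₄, hc₃, hc₂])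
      (by simp [hc₆, hc₅, hc₄, hc₃, hc₂]) (by simp [hc₆, hc₅, hc₄, hc₃, hc₂, hM]) hlen hY.2 hL.2
    have h14 := run_moveNum (nat := nat) (neg := false) (s := .A) (d := .R)
      (c := update (update c₆ .U []) .R (nums Z)) (by decide) w (c .A) (by simp [hc₆])
    refine ⟨w :: Z, ?_, by simpa using ⟨h9.le, h12⟩, (Run.rule .vecUpdStep (.seq h1 (.seq h5
      (.seq h6 (.seq h7 (.seq h10 (.seq h13 h14))))))).of_eq ?_ ?_⟩
    · rw [List.map_cons, h11, h8, List.zipWith_cons_cons, map_flip_false, h3, ht, val_flip]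
      simp
      ring
    · have e1 : l.length * (4 * N + 3) ≤ N * (4 * N + 3) := Nat.mul_le_mul_right _ (by omega)
      have e2 : (Y.length + 1) * Q = Y.length * Q + Q := by ring
      simp only [List.length_cons, e2, h9]
      have e3 : l'.length = l.length := by simp [hl']
      have e4 : t.length = y.length := by simp [ht]
      omega
    · funext i
      cases i <;> simp [hc₆, hc₅, hc₄, hc₃, hc₂, map_flip_false]

theorem run_allZero {N : ℕ} (Y L : List (List SignType)) (hU : c .U = nums Y) (hR : c .R = nums L)
    (hlen : Y.length = L.length) (hY : ∀ y ∈ Y, y.length ≤ N) (hL : ∀ x ∈ L, x.length ≤ N)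
    (h0 : ∀ x ∈ L, val x = 0) :
    Run nat [.call .allZero] c (Y.length * (3 * N + 4) + 1) (update (update c .U []) .R []) := by
  induction Y generalizing c L with
  | nil =>
    obtain rfl : L = [] := by simpa using hlen.symm
    refine (Run.rule .allZeroDone (n := 0) (.empty hU (.empty hR .nil))).of_eq (by simp) ?_
    funext i
    cases i <;> simp_all
  | cons y Y ih =>
    obtain _ | ⟨x, L⟩ := L
    · simp at hlen
    simp only [List.mem_cons, forall_eq_or_imp, List.length_cons, Nat.add_right_cancel_iff]
      at hY hL hlen h0
    have h1 := run_moveNum (nat := nat) (neg := false) (s := .R) (d := .A) (c := c) (by decide) x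
      (nums L) (by simp [hR])
    set c₁ := update (update c .R (nums L)) .A (num (x.map (flipDig false)) ++ c .A) with hc₁
    have h2 := run_chk (nat := nat) (rel := .eq) (x := 0) (c := c₁) (x.map (flipDig false)) (c .A)
      (by simp [hc₁]) (by simp [map_flip_false, Rel.Holds, h0.1])
    have h3 := run_dropNum (nat := nat) (s := .U) (c := update c₁ .A (c .A)) y (nums Y)
      (by simp [hc₁, hU])
    have h4 := ih (c := update (update c₁ .A (c .A)) .U (nums Y)) L (by simp) (by simp [hc₁]) hlen
      hY.2 hL.2 h0.2
    refine (Run.rule .allZeroStep (.seq h1 (.seq h2 (.seq h3 h4)))).of_eq ?_ ?_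
    · simp only [List.length_cons, List.length_map, Nat.add_mul, one_mul]
      omega
    · funext i
      cases i <;> simp [hc₁]

/-- Bounds on the costs of an item. -/
structure Costs (B S N K C : ℕ) : Prop where
  tf : 9 * (B + 2 * S + 2) + 2 * (S * (B + 1)) + 20 ≤ K
  item : S * K + (S + 1) * (N * (4 * N + 3) + 8 * N + 13) +
    2 * (S * (B + 1)) + 4 * S + 2 * B + 12 ≤ C

theorem found_ofFn {k B S : ℕ} {y : Fin k → ℤ} (hy : ∀ j, (y j).natAbs < 2 ^ B) (hk : k ≤ S)
    (hU : c .U = nums (List.ofFn fun j => ofInt (y j))) (a : Fin k) :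
    Found B (S * (B + 1)) c encodeFin y a := by
  refine ⟨(varU, .U), _, a, ofInt (y a), by simp, hU, by simp, rfl, (val_ofInt _).symm,
    length_ofInt (hy a), ?_⟩
  refine (length_nums (B := B) ?_).trans ?_
  · intro d hd
    obtain ⟨j, rfl⟩ := List.mem_ofFn.1 hd
    exact length_ofInt (hy j)
  · rw [List.length_ofFn]
    exact Nat.mul_le_mul_right _ hk

theorem length_nums_ofFn {k B S : ℕ} {y : Fin k → ℤ} (hy : ∀ j, (y j).natAbs < 2 ^ B) (hk : k ≤ S) :
    (nums (List.ofFn fun j => ofInt (y j))).length ≤ S * (B + 1) := by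
  refine (length_nums (B := B) ?_).trans ?_
  · intro d hd
    obtain ⟨j, rfl⟩ := List.mem_ofFn.1 hd
    exact length_ofInt (hy j)
  · rw [List.length_ofFn]
    exact Nat.mul_le_mul_right _ hk

/-- The zero vector serves as the final guess, with whatever truth value the formula has there. -/
theorem run_finish {k B S N K C : ℕ} (hC : Costs B S N K C) (F : QFPA (Fin k)) (r : List Token)
    (x : List SignType) (L : List (List SignType)) (hL : L.length = k) (hU : c .U = [])
    (hR : c .R = nums (x :: L)) (hI : c .I = F.encode encodeFin ++ r) (hk : k ≤ S)
    (hS : (c .I).length ≤ S) (hN : ∀ d ∈ x :: L, d.length ≤ N) (h0 : ∀ d ∈ x :: L, val d = 0) :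
    Run nat [.call .loop] c C (update (update c .I r) .R []) := by
  classical
  set Y : List (List SignType) := List.ofFn fun _ : Fin k => ofInt 0 with hY
  have hlen : (nums Y).length ≤ S * (B + 1) := length_nums_ofFn (y := fun _ => 0) (by simp) hk
  have h1 := run_guessAll (nat := nat) (k := .U) (c := c) Y (by simp [hY, ofInt])
  have h2 := run_tf (nat := nat) (c := update c .U (nums Y ++ c .U)) (B := B) (S := S) le_rfl
    hC.tf F (ρ := fun _ => 0) (decide (F.Holds fun _ => 0)) r
    (fun a _ => found_ofFn (y := fun _ => 0) (by simp) hk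
      (by rw [Function.update_self, hU, List.append_nil]) a)
    (by rw [hI] at hS; simp at hS; omega) (by simp [hI]) (by simp)
  have h3 := run_allZero (nat := nat) (N := N) ([] :: Y) (x :: L)
    (c := update (update (update c .U (nums Y ++ c .U)) .I r) .U (sep :: (nums Y ++ c .U)))
    (by simp [hU]) (by simp [hR]) (by simp [hY, hL]) (by simp [hY, ofInt]) hN h0
  refine (Run.rule (.finish _) (.seq h1 (.seq h2 (.push (by simpa using h3))))).of_eq ?_ ?_
  · have e1 : (F.encode encodeFin).length * K ≤ S * K :=
      Nat.mul_le_mul_right _ (by rw [hI] at hS; simp at hS; omega)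
    have e2 : (k + 1) * (3 * N + 4) ≤ (S + 1) * (N * (4 * N + 3) + 8 * N + 13) :=
      Nat.mul_le_mul (by omega) (by omega)
    have := hC.item
    have e3 : Y.length = k := by simp [hY]
    simp only [e3]
    omega
  · funext i
    cases i <;> simp [hU]

theorem vec_ofFn {k : ℕ} (y : Fin k → ℤ) : vec k (List.ofFn fun j => ofInt (y j)) = y := by
  funext j
  simp [vec, val_ofInt]

theorem vec_of_zipWith {k : ℕ} {m : ℕ} {Y L Z : List (List SignType)} (hY : Y.length = k)
    (hL : L.length = k) (h : Z.map val = List.zipWith (fun y x => val x - m * val y) Y L) :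
    Z.length = k ∧ vec k Z = vec k L - m • vec k Y := by
  have hZ : Z.length = k := by simpa [hY, hL] using congrArg List.length h
  refine ⟨hZ, funext fun j => ?_⟩
  have h1 := congrArg (fun l => l[j.1]?) h
  simp [hY, hL, hZ] at h1
  simp [vec, hY, hL, hZ, h1]

/-- The number `H` bounds the lengths of the residues. A subtraction may lengthen them by one digit,
so `H` grows with each item up to `N`. It is at least `3 * B + 1` because a product of a component
by a multiplicity may need `B + 2 * B` digits, or `1 + 2 * B` for the leading component. -/
theorem run_loop {k B S N K C : ℕ} (hC : Costs B S N K C) (F : QFPA (Fin k)) (r : List Token)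
    (items : List (ℕ × (Fin k → ℤ))) (H : ℕ) (hH : 3 * B + 1 ≤ H) (hHN : H + items.length ≤ N)
    (hit : ∀ it ∈ items, it.1 < 2 ^ B ∧ (∀ j, (it.2 j).natAbs < 2 ^ B) ∧ it.2 ∈ solutions nat F)
    (x : List SignType) (L : List (List SignType)) (hL : L.length = k) (hU : c .U = [])
    (hJ : c .J = []) (hR : c .R = nums (x :: L)) (hI : c .I = F.encode encodeFin ++ r) (hk : k ≤ S)
    (hS : (c .I).length ≤ S) (hN : ∀ d ∈ x :: L, d.length ≤ H)
    (hx : val x = ((items.map Prod.fst).sum : ℕ))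
    (hsum : vec k L = (items.map fun it => it.1 • it.2).sum) :
    Run nat [.call .loop] c ((items.length + 1) * C) (update (update c .I r) .R []) := by
  induction items generalizing c H x L with
  | nil =>
    simp only [List.length_nil, zero_add, one_mul]
    refine run_finish hC F r x L hL hU hR hI hk hS
      (fun d hd => (hN d hd).trans (by simpa using hHN)) ?_
    intro d hd
    rcases List.mem_cons.1 hd with rfl | hd
    · simpa using hx
    · obtain ⟨i, hi, rfl⟩ := List.mem_iff_getElem.1 hd
      have := congrFun hsum ⟨i, hL ▸ hi⟩
      simpa [vec, hi] using this
  | cons it items ih =>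
    obtain ⟨m, y⟩ := it
    simp only [List.mem_cons, forall_eq_or_imp, List.length_cons] at hit hHN hN
    obtain ⟨⟨hm, hyB, hyF⟩, hit⟩ := hit
    set Y : List (List SignType) := List.ofFn fun j => ofInt (y j) with hY
    have hYlen : (nums Y).length ≤ S * (B + 1) := length_nums_ofFn hyB hk
    have h1 := run_copyAll (nat := nat) (s := .I) (d := .J) (c := c) (by decide) _ rfl
    set c₁ := update c .J (c .I) with hc₁
    have h2 := run_guessAll (nat := nat) (k := .U) (c := c₁) Y (by
      intro hnat d hd
      obtain ⟨j, rfl⟩ := List.mem_ofFn.1 hd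
      exact ofInt_nonneg (hyF.1 j hnat))
    set c₂ := update c₁ .U (nums Y) with hc₂
    have h3 := run_tf (nat := nat) (c := c₂) (B := B) (S := S) le_rfl hC.tf F (ρ := y) true r
      (fun a _ => found_ofFn hyB hk (by simp [hc₂, hY]) a)
      (by rw [hI] at hS; simp at hS; omega) (by simp [hc₂, hc₁, hI]) (by simpa using hyF.2)
    have h4 := run_clearAll (nat := nat) (s := .I) (c := update c₂ .I r) r (by simp)
    have h5 := run_moveAll (nat := nat) (s := .J) (d := .I)
      (c := update (update c₂ .I r) .I []) (by decide) (c .I) (by simp [hc₂, hc₁])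
    set c₃ := update c .U (nums ([1] :: Y)) with hc₃
    have h6 := run_guess (nat := nat) (nn := true) (k := .M) (c := c₃) (ofInt m)
      (fun _ => ofInt_nonneg (by positivity))
    set c₄ := update c₃ .M (num (ofInt m) ++ c .M) with hc₄
    have hmB : m.bits.length ≤ B := by
      have := length_ofInt (z := m) (B := B) (by simpa using hm)
      simpa [ofInt] using this
    obtain ⟨Z, h7, h8, h9⟩ := run_vecUpd (nat := nat) (c := c₄) (N := H) le_rfl m.bits (c .M)
      ([1] :: Y) (x :: L) (by simp [hc₄, hc₃]) (by simp [hc₄, hc₃, hR])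
      (by simp [hc₄, num_ofInt_natCast]) (by simp [hY, hL]) (by
        intro d hd
        rcases List.mem_cons.1 hd with rfl | hd
        · simp; omega
        · obtain ⟨j, rfl⟩ := List.mem_ofFn.1 hd
          have := length_ofInt (hyB j)
          omega) (by simpa using hN)
    have h10 := run_dropNum (nat := nat) (s := .M) (c := update (update c₄ .U []) .R (nums Z))
      (ofInt m) (c .M) (by simp [hc₄])
    obtain _ | ⟨x', Z⟩ := Z
    · simp at h7
    simp only [List.map_cons, List.zipWith_cons_cons, List.cons.injEq, bitsVal_bits] at h7
    obtain ⟨hZ, hvec⟩ := vec_of_zipWith (k := k) (by simp [hY]) hL h7.2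
    have h11 := ih (c := update c .R (nums (x' :: Z))) (H + 1) (by omega) (by omega) hit x' Z hZ
      (by simp [hU]) (by simp [hJ]) (by simp) (by simp [hI]) (by simpa using hS) h8
      (by rw [h7.1, hx]; simp) (by rw [hvec, hsum, hY, vec_ofFn]; simp)
    refine (Run.rule .item (.seq (c₁ := c₁) (h1.of_eq le_rfl (by simp [hc₁, hJ]))
      (.seq (c₁ := c₂) (h2.of_eq le_rfl (by simp [hc₂, hc₁, hU])) (.seq h3 (.seq h4
      (.seq h5 (.push (.push (.seq (c₁ := c₄) (n := (ofInt m).length + 1) ?_ (.seq h9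
      (.seq (c₁ := update c .R (nums (x' :: Z)))
      (h10.of_eq le_rfl ?_) h11))))))))))).of_eq ?_ ?_
    · convert h6 using 1
      funext i
      · cases i <;> simp [hc₃, hc₂, hc₁, hJ, show dig 1 = bit1 from rfl]
      · simp [hc₄, hc₃]
    · funext i
      cases i <;> simp [hc₄, hc₃, hU]
    · have e1 : (F.encode encodeFin).length * K ≤ S * K :=
        Nat.mul_le_mul_right _ (by rw [hI] at hS; simp at hS; omega)
      have e2 : (k + 1) * (H * (4 * H + 3) + 8 * H + 13) ≤
          (S + 1) * (N * (4 * N + 3) + 8 * N + 13) := by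
        have : H ≤ N := by omega
        gcongr
      have e3 : ([1] :: Y).length = k + 1 := by simp [hY]
      have e4 : (ofInt m).length ≤ B := length_ofInt (by simpa using hm)
      have e5 : r.length ≤ S := by rw [hI] at hS; simp at hS; omega
      have := hC.item
      have e6 : (items.length + 1 + 1) * C = (items.length + 1) * C + C := by ring
      simp only [List.length_cons] at e3 ⊢
      rw [e3, e6]
      omega
    · funext i
      cases i <;> simp

/-- A list of multiplicities and small solutions that represents the vector `u`. -/
structure Represents (nat : Bool) (B Q : ℕ) {k : ℕ} (F : QFPA (Fin k)) (u : Fin k → ℤ)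
    (items : List (ℕ × (Fin k → ℤ))) : Prop where
  length_le : items.length ≤ Q
  small : ∀ it ∈ items, it.1 < 2 ^ B ∧ (∀ j, (it.2 j).natAbs < 2 ^ B) ∧ it.2 ∈ solutions nat F
  count_lt : (items.map Prod.fst).sum < 2 ^ B
  sum_eq : u = (items.map fun it => it.1 • it.2).sum

theorem run_phases {k B S N K C Q : ℕ} (hC : Costs B S N K C) (hN : 3 * B + 1 + Q ≤ N)
    (L : List (List SignType)) (hL : L.length = k) (hLB : ∀ d ∈ L, d.length ≤ B)
    (D : List (QFPA (Fin k) × List (ℕ × (Fin k → ℤ))))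
    (hD : ∀ d ∈ D, Represents nat B Q d.1 (vec k L) d.2)
    (hXS : c .XS = nums (D.map fun d => ofInt ((d.2.map Prod.fst).sum : ℕ)))
    (hI : c .I = (D.map fun d => d.1.encode encodeFin).flatten) (hUS : c .US = nums L)
    (hR : c .R = []) (hJ : c .J = []) (hU : c .U = []) (hS : (c .I).length ≤ S) (hk : k ≤ S) :
    ∃ c', Run nat [.call .phases] c (D.length * ((Q + 2) * C) + 1) c' := by
  induction D generalizing c with
  | nil =>
    exact ⟨c, (Run.rule .phasesDone (n := 0) (.empty (by simpa using hXS)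
      (.empty (by simpa using hI) .nil))).of_eq (by simp) rfl⟩
  | cons d D ih =>
    obtain ⟨F, items⟩ := d
    simp only [List.mem_cons, forall_eq_or_imp] at hD
    obtain ⟨hd, hD⟩ := hD
    simp only [List.map_cons, nums_cons, List.flatten_cons] at hXS hI
    set x := ofInt ((items.map Prod.fst).sum : ℕ) with hx
    have hxB : x.length ≤ B := length_ofInt (by
      rw [Int.natAbs_natCast]
      exact hd.count_lt)
    have h1 := run_copyAll (nat := nat) (s := .US) (d := .R) (c := c) (by decide) _ hUS
    have h2 := run_moveNum (nat := nat) (neg := false) (s := .XS) (d := .R)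
      (c := update c .R (nums L ++ c .R)) (by decide) x
      (nums (D.map fun d => ofInt ((d.2.map Prod.fst).sum : ℕ)))
      (by rw [Function.update_of_ne (by decide), hXS])
    set r := (D.map fun d => d.1.encode encodeFin).flatten with hr
    have h3 := run_loop (nat := nat) (c := update (update (update c .R (nums L ++ c .R)) .XS
        (nums (D.map fun d => ofInt ((d.2.map Prod.fst).sum : ℕ)))) .R
        (num (x.map (flipDig false)) ++ update c .R (nums L ++ c .R) .R)) hC F r items (3 * B + 1)
      le_rfl ((Nat.add_le_add_left hd.length_le _).trans hN) hd.small x L hL (by simp [hU])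
      (by simp [hJ]) (by simp [hR, map_flip_false]) (by simp [hI]) hk (by simpa using hS)
      (by
        intro d hd
        rcases List.mem_cons.1 hd with rfl | hd
        · omega
        · exact (hLB d hd).trans (by omega))
      (by rw [hx, val_ofInt]) hd.sum_eq
    have hlen : (nums L).length ≤ S * (B + 1) := (length_nums hLB).trans
      (Nat.mul_le_mul_right _ (hL.trans_le hk))
    obtain ⟨c', h4⟩ := ih (c := update (update c .XS
        (nums (D.map fun d => ofInt ((d.2.map Prod.fst).sum : ℕ)))) .I r) hD (by simp)
      (by simp [hr]) (by simp [hUS]) (by simp [hR]) (by simp [hJ]) (by simp [hU])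
      (by rw [hI] at hS; simp at hS; simp; omega)
    refine ⟨c', (Run.rule .phase (.seq h1 (.seq h2 (.seq (h3.of_eq le_rfl ?_) h4)))).of_eq ?_ rfl⟩
    · funext i
      cases i <;> simp [hR]
    · have e1 : (items.length + 1) * C ≤ (Q + 1) * C :=
        Nat.mul_le_mul_right _ (Nat.add_le_add_right hd.length_le 1)
      have e2 : (D.length + 1) * ((Q + 2) * C) = D.length * ((Q + 2) * C) + (Q + 1) * C + C := by
        ring
      have := hC.item
      rw [List.length_cons, e2]
      omega

/-- There are at most `S` constraints. Each is charged `Q + 1` rounds and one more `C` for copying;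
the preparations and the check of `F₀` fit into `8 * C`. -/
theorem run_main {B S N K C Q : ℕ} (hC : Costs B S N K C) (hN : 3 * B + 1 + Q ≤ N) (φ : LIACard)
    (hS : φ.encode.length ≤ S) (u : Fin φ.k → ℤ) (x : Fin φ.n → ℕ) (v : ℕ → ℤ)
    (hu : ∀ j, u j ∈ dom nat ∧ (u j).natAbs < 2 ^ B)
    (hv : ∀ l, v l ∈ dom nat ∧ (v l).natAbs < 2 ^ B)
    (hF : φ.F₀.Holds (CardVar.assign u x v)) (items : Fin φ.n → List (ℕ × (Fin φ.k → ℤ)))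
    (hi : ∀ i, Represents nat B Q (φ.F i) u (items i))
    (hx : ∀ i, x i = ((items i).map Prod.fst).sum) :
    ∃ c', Run nat [.call .main] (start .J φ.encode) ((S * (Q + 2) + 8) * C) c' := by
  set s := φ.encode with hs
  set LU : List (List SignType) := List.ofFn fun j => ofInt (u j) with hLU
  set LX : List (List SignType) := List.ofFn fun i => ofInt (x i : ℤ) with hLX
  -- Indices are written in unary, so a further variable that occurs in the formula has an index
  -- below `S`.
  set LW : List (List SignType) := List.ofFn fun l : Fin S => ofInt (v l) with hLW
  set t := (List.ofFn fun i => (φ.F i).encode encodeFin).flatten with ht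
  have hs' : s = encodeUnary φ.k ++ (encodeUnary φ.n ++ (φ.F₀.encode CardVar.encode ++ t)) := by
    simp [hs, LIACard.encode, ht]
  have hslen := congrArg List.length hs'
  simp only [encodeUnary, List.length_append, List.length_replicate, List.length_cons,
    List.length_nil] at hslen
  have hkS : φ.k ≤ S := by omega
  have hnS : φ.n ≤ S := by omega
  have hxB (i) : (x i : ℤ).natAbs < 2 ^ B := by
    rw [hx, Int.natAbs_natCast]
    exact (hi i).count_lt
  have lenU : (nums LU).length ≤ S * (B + 1) := length_nums_ofFn (fun j => (hu j).2) hkS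
  have lenX : (nums LX).length ≤ S * (B + 1) := length_nums_ofFn hxB hnS
  have lenW : (nums LW).length ≤ S * (B + 1) := length_nums_ofFn (fun l => (hv l).2) le_rfl
  have h1 := run_rev (nat := nat) (c := start .J s) s.reverse (by simp [start])
  set c₁ : Stack → List Token := update (fun _ => []) .I s with hc₁
  have h2 := run_init (nat := nat) (nn := nat) (k := .U) (c := c₁) (by decide) LU
    (encodeUnary φ.n ++ (φ.F₀.encode CardVar.encode ++ t)) (by
      intro h d hd
      obtain ⟨j, rfl⟩ := List.mem_ofFn.1 hd
      exact ofInt_nonneg ((hu j).1 h)) (by simp [hc₁, hs', hLU])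
  set c₂ := update (update c₁ .I (encodeUnary φ.n ++ (φ.F₀.encode CardVar.encode ++ t))) .U
    (nums LU ++ c₁ .U) with hc₂
  have h3 := run_init (nat := nat) (nn := true) (k := .X) (c := c₂) (by decide) LX
    (φ.F₀.encode CardVar.encode ++ t) (by
      intro _ d hd
      obtain ⟨j, rfl⟩ := List.mem_ofFn.1 hd
      exact ofInt_nonneg (by positivity)) (by simp [hc₂, hLX])
  set c₃ := update (update c₂ .I (φ.F₀.encode CardVar.encode ++ t)) .X (nums LX ++ c₂ .X) with hc₃
  have h4 := run_guessAll (nat := nat) (k := .W) (c := c₃) LW (by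
      intro h d hd
      obtain ⟨j, rfl⟩ := List.mem_ofFn.1 hd
      exact ofInt_nonneg ((hv j).1 h))
  set c₄ := update c₃ .W (nums LW ++ c₃ .W) with hc₄
  have hU : c₄ .U = nums LU := by simp [hc₄, hc₃, hc₂, hc₁]
  have hX : c₄ .X = nums LX := by simp [hc₄, hc₃, hc₂, hc₁]
  have hW : c₄ .W = nums LW := by simp [hc₄, hc₃, hc₂, hc₁]
  have h5 := run_tf (nat := nat) (c := c₄) (B := B) (S := S) le_rfl hC.tf φ.F₀
    (ρ := CardVar.assign u x v) (var := CardVar.encode) true t (by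
      intro a ha
      cases a with
      | u j =>
        exact ⟨(varU, .U), LU, j, ofInt (u j), by simp, hU, by simp [hLU], rfl, (val_ofInt _).symm,
          length_ofInt (hu j).2, lenU⟩
      | x i =>
        exact ⟨(varX, .X), LX, i, ofInt (x i), by simp, hX, by simp [hLX], rfl, (val_ofInt _).symm,
          length_ofInt (hxB i), lenX⟩
      | v l =>
        have : l < S := by simp [CardVar.encode, encodeUnary] at ha; omega
        exact ⟨(varV, .W), LW, l, ofInt (v l), by simp, hW, by simp [hLW, this], rfl,
          (val_ofInt _).symm, length_ofInt (hv l).2, lenW⟩)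
    (by omega) (by simp [hc₄, hc₃]) (by simpa using hF)
  set c₅ := update c₄ .I t with hc₅
  have h6 := run_clearAll (nat := nat) (s := .W) (c := c₅) (nums LW) (by simp [hc₅, hW])
  have h7 := run_moveAll (nat := nat) (s := .U) (d := .US) (c := update c₅ .W []) (by decide)
    (nums LU) (by simp [hc₅, hU])
  set c₆ := update (update (update c₅ .W []) .US (nums LU ++ update c₅ .W [] .US)) .U [] with hc₆
  have h8 := run_moveAll (nat := nat) (s := .X) (d := .XS) (c := c₆) (by decide)
    (nums LX) (by simp [hc₆, hc₅, hX])
  set c₇ := update (update c₆ .XS (nums LX ++ c₆ .XS)) .X [] with hc₇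
  obtain ⟨c', h9⟩ := run_phases (nat := nat) (c := c₇) hC hN LU (by simp [hLU]) (by
      intro d hd
      obtain ⟨j, rfl⟩ := List.mem_ofFn.1 hd
      exact length_ofInt (hu j).2) (List.ofFn fun i => (φ.F i, items i)) (by
      intro d hd
      obtain ⟨i, rfl⟩ := List.mem_ofFn.1 hd
      simpa [hLU, vec_ofFn] using hi i)
    (by simp [hc₇, hc₆, hc₅, hc₄, hc₃, hc₂, hc₁, hLX, List.map_ofFn, Function.comp_def, hx])
    (by simp [hc₇, hc₆, hc₅, ht, List.map_ofFn, Function.comp_def])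
    (by simp [hc₇, hc₆, hc₅, hc₄, hc₃, hc₂, hc₁])
    (by simp [hc₇, hc₆, hc₅, hc₄, hc₃, hc₂, hc₁])
    (by simp [hc₇, hc₆, hc₅, hc₄, hc₃, hc₂, hc₁])
    (by simp [hc₇, hc₆, hc₅, hc₄, hc₃, hc₂, hc₁])
    (by simp [hc₇, hc₆, hc₅]; omega) hkS
  refine ⟨c', (Run.rule .main (.seq (h1.of_eq le_rfl ?_) (.seq h2 (.seq h3 (.seq h4 (.seq h5
    (.seq h6 (.seq h7 (.seq h8 h9))))))))).of_eq ?_ rfl⟩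
  · funext i
    cases i <;> simp [start, hc₁]
  · have e1 : (φ.F₀.encode CardVar.encode).length * K ≤ S * K := Nat.mul_le_mul_right _ (by omega)
    have e2 : φ.n * ((Q + 2) * C) ≤ S * ((Q + 2) * C) := Nat.mul_le_mul_right _ hnS
    have e3 : (S * (Q + 2) + 8) * C = S * ((Q + 2) * C) + 8 * C := by ring
    have := hC.item
    simp only [List.length_reverse, List.length_ofFn]
    rw [e3]
    omega

end CardVerifier

/-! ### Small solutions of homogeneous linear systems -/

namespace SmallSolutions

section Siegel

attribute [local instance] Matrix.seminormedAddCommGroup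

/-- This is Siegel's lemma with a cruder but integral bound. A system without equations is treated
separately, by a unit vector. -/
theorem exists_int_vec_le {α β : Type} [Fintype α] [Fintype β] (A : Matrix α β ℤ) {K : ℕ}
    (hK : 1 ≤ K) (hA : ∀ i j, (A i j).natAbs ≤ K) (h : Fintype.card α < Fintype.card β) :
    ∃ t : β → ℤ, t ≠ 0 ∧ A.mulVec t = 0 ∧
      ∀ j, (t j).natAbs ≤ (Fintype.card β * K) ^ Fintype.card β := by
  classical
  rcases Nat.eq_zero_or_pos (Fintype.card α) with h0 | h0
  · have : IsEmpty α := Fintype.card_eq_zero_iff.1 h0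
    obtain ⟨j⟩ : Nonempty β := Fintype.card_pos_iff.1 (by omega)
    refine ⟨Pi.single j 1, by simp, Subsingleton.elim _ _, fun i => ?_⟩
    have h1 : ((Pi.single j 1 : β → ℤ) i).natAbs ≤ 1 := by
      by_cases hi : i = j
      · subst hi; simp
      · simp [Pi.single_eq_of_ne hi]
    refine h1.trans (Nat.one_le_pow _ _ (Nat.mul_pos (by omega) hK))
  · obtain ⟨t, ht, hAt, hn⟩ := Int.Matrix.exists_ne_zero_int_vec_norm_le A h h0
    refine ⟨t, ht, hAt, fun j => ?_⟩
    have hA' : max 1 ‖A‖ ≤ K := by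
      refine max_le (by exact_mod_cast hK) ((Matrix.norm_le_iff (by positivity)).2 fun i j => ?_)
      rw [Int.norm_eq_abs, ← Int.cast_abs, Int.abs_eq_natAbs]
      exact_mod_cast hA i j
    have h1 : (1 : ℝ) ≤ Fintype.card β * K := by
      have : 1 ≤ Fintype.card β * K := Nat.mul_pos (by omega) hK
      exact_mod_cast this
    have h2 : ‖t j‖ ≤ ((Fintype.card β * K : ℕ) : ℝ) ^ Fintype.card β := by
      refine (norm_le_pi_norm t j).trans (hn.trans ?_)
      -- The denominator of Siegel's exponent is at least one, so the exponent is at most the number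
      -- of unknowns.
      have h3 : (Fintype.card α : ℝ) / (Fintype.card β - Fintype.card α) ≤ Fintype.card β := by
        have : (1 : ℝ) ≤ Fintype.card β - Fintype.card α := by
          have : (Fintype.card α : ℝ) + 1 ≤ Fintype.card β := by exact_mod_cast h
          linarith
        refine (div_le_self (by positivity) this).trans ?_
        exact_mod_cast h.le
      calc _ ≤ ((Fintype.card β : ℝ) * K) ^ ((Fintype.card α : ℝ) /
            (Fintype.card β - Fintype.card α)) := by
            refine Real.rpow_le_rpow (by positivity) ?_ ?_
            · gcongr
            · refine div_nonneg (by positivity) (sub_nonneg.2 ?_)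
              exact_mod_cast h.le
        _ ≤ ((Fintype.card β : ℝ) * K) ^ (Fintype.card β : ℝ) :=
            Real.rpow_le_rpow_of_exponent_le h1 h3
        _ = _ := by rw [Real.rpow_natCast]; push_cast; rfl
    rw [Int.norm_eq_abs, ← Int.cast_abs, Int.abs_eq_natAbs] at h2
    exact_mod_cast h2

end Siegel

variable {ι κ : Type} [Fintype ι] {M : κ → ι → ℤ} {K : ℕ}

/-- The rows lie in the hyperplane orthogonal to `z`, so a maximal independent set of rows has fewer
members than there are unknowns, and Siegel's lemma applies to it. The other rows are combinations
of these, so the bound does not depend on the number of rows. -/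
theorem exists_int_vec_of_kernel (hK : 1 ≤ K) (hM : ∀ k i, (M k i).natAbs ≤ K) (z : ι → ℚ)
    (hz : z ≠ 0) (hMz : ∀ k, ∑ i, M k i * z i = 0) :
    ∃ t : ι → ℤ, t ≠ 0 ∧ (∀ k, ∑ i, M k i * t i = 0) ∧
      ∀ i, (t i).natAbs ≤ (Fintype.card ι * K) ^ Fintype.card ι := by
  classical
  let v : κ → ι → ℚ := fun k i => M k i
  obtain ⟨β, a, -, hspan, hind⟩ := exists_linearIndependent' ℚ v
  have : Finite β := hind.finite
  have : Fintype β := Fintype.ofFinite β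
  let φ (z : ι → ℚ) : (ι → ℚ) →ₗ[ℚ] ℚ := ∑ i, z i • LinearMap.proj i
  have hφ (z w : ι → ℚ) : φ z w = ∑ i, w i * z i := by simp [φ, mul_comm]
  have hcard : Fintype.card β < Fintype.card ι := by
    have h1 : Submodule.span ℚ (Set.range (v ∘ a)) ≤ LinearMap.ker (φ z) := by
      rw [Submodule.span_le]
      rintro _ ⟨j, rfl⟩
      simp [hφ, v, hMz]
    have h2 : LinearMap.ker (φ z) < ⊤ := by
      refine lt_top_iff_ne_top.2 fun h => hz (funext fun i => ?_)
      have : Pi.single i 1 ∈ LinearMap.ker (φ z) := h ▸ Submodule.mem_top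
      simpa [hφ, Pi.single_apply] using this
    have h3 := Submodule.finrank_lt h2.ne
    rw [Module.finrank_pi] at h3
    have h4 := Submodule.finrank_mono h1
    rw [finrank_span_eq_card hind] at h4
    omega
  obtain ⟨t, ht, hAt, hb⟩ := exists_int_vec_le (Matrix.of fun (j : β) i => M (a j) i) hK
    (fun j i => hM _ _) hcard
  refine ⟨t, ht, fun k => ?_, hb⟩
  have h1 : Submodule.span ℚ (Set.range v) ≤ LinearMap.ker (φ fun i => t i) := by
    rw [← hspan, Submodule.span_le]
    rintro _ ⟨j, rfl⟩
    have := congrFun hAt j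
    simp only [Matrix.mulVec, dotProduct, Matrix.of_apply, Pi.zero_apply] at this
    simp only [SetLike.mem_coe, LinearMap.mem_ker, hφ, v, Function.comp_apply]
    exact_mod_cast this
  have h2 := h1 (Submodule.subset_span ⟨k, rfl⟩)
  simp only [LinearMap.mem_ker, hφ, v] at h2
  exact_mod_cast h2

/-- The zeros of `z` are imposed by unit vectors as additional rows, at no cost since the number of
rows does not matter. -/
theorem exists_int_vec_of_kernel_of_support (hK : 1 ≤ K) (hM : ∀ k i, (M k i).natAbs ≤ K)
    (z : ι → ℚ) (hz : z ≠ 0) (hMz : ∀ k, ∑ i, M k i * z i = 0) :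
    ∃ t : ι → ℤ, t ≠ 0 ∧ (∀ k, ∑ i, M k i * t i = 0) ∧ (∀ i, z i = 0 → t i = 0) ∧
      ∀ i, (t i).natAbs ≤ (Fintype.card ι * K) ^ Fintype.card ι := by
  classical
  obtain ⟨t, h1, h2, h3⟩ := exists_int_vec_of_kernel (K := K)
    (M := Sum.elim M fun (j : {i // z i = 0}) => Pi.single j.1 1) hK (by
      rintro (k | j) i
      · exact hM k i
      · simp only [Sum.elim_inr, Pi.single_apply]
        split_ifs <;> simp [hK]) z hz (by
      rintro (k | ⟨j, hj⟩)
      · exact hMz k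
      · simp [Pi.single_apply, hj])
  refine ⟨t, h1, fun k => h2 (.inl k), fun i hi => ?_, h3⟩
  simpa [Pi.single_apply] using h2 (.inr ⟨i, hi⟩)

/-- The bound on the entries of small rays. -/
def rayBound (N K : ℕ) : ℕ := (N * K) ^ N

/-- Carathéodory's argument. A small kernel vector `t` supported where `z` is either is
non-negative, or one moves from `z` along `t` until a coordinate vanishes and repeats with smaller
support. The choice of a `t` with a positive entry keeps the moved vector from becoming zero. -/
theorem exists_ray (hK : 1 ≤ K) (hM : ∀ k i, (M k i).natAbs ≤ K) (z : ι → ℚ) (h0 : ∀ i, 0 ≤ z i)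
    (hz : z ≠ 0) (hMz : ∀ k, ∑ i, M k i * z i = 0) :
    ∃ r : ι → ℤ, r ≠ 0 ∧ (∀ i, 0 ≤ r i) ∧ (∀ k, ∑ i, M k i * r i = 0) ∧ (∀ i, z i = 0 → r i = 0) ∧
      ∀ i, r i ≤ rayBound (Fintype.card ι) K := by
  classical
  induction hn : (Finset.univ.filter fun i => z i ≠ 0).card using Nat.strong_induction_on
    generalizing z with
  | _ n ih =>
    subst hn
    obtain ⟨t, ht0, ht, hts, htb⟩ : ∃ t : ι → ℤ, (∃ i, 0 < t i) ∧ (∀ k, ∑ i, M k i * t i = 0) ∧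
        (∀ i, z i = 0 → t i = 0) ∧ ∀ i, (t i).natAbs ≤ rayBound (Fintype.card ι) K := by
      obtain ⟨t, h1, h2, h3, h4⟩ := exists_int_vec_of_kernel_of_support hK hM z hz hMz
      obtain ⟨i, hi⟩ := Function.ne_iff.1 h1
      rcases lt_or_gt_of_ne hi with hi | hi
      · refine ⟨-t, ⟨i, by simpa using hi⟩, fun k => ?_, fun i hi => by simp [h3 i hi], fun i => ?_⟩
        · simpa using h2 k
        · simpa [rayBound] using h4 i
      · exact ⟨t, ⟨i, hi⟩, h2, h3, h4⟩
    by_cases hneg : ∀ i, 0 ≤ t i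
    · refine ⟨t, ?_, hneg, ht, hts, fun i => ?_⟩
      · rintro rfl
        simp at ht0
      · have := htb i
        have := hneg i
        omega
    push Not at hneg
    obtain ⟨i₀, hi₀, hmin⟩ := Finset.exists_min_image (Finset.univ.filter fun i => t i < 0)
      (fun i => z i / -(t i : ℚ)) (by obtain ⟨i, hi⟩ := hneg; exact ⟨i, by simpa using hi⟩)
    simp only [Finset.mem_filter, Finset.mem_univ, true_and] at hi₀ hmin
    have hq (i) (hi : t i < 0) : (0 : ℚ) < -(t i : ℚ) := by
      have : (t i : ℚ) < 0 := by exact_mod_cast hi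
      linarith
    -- The largest step that keeps all coordinates non-negative; it annihilates coordinate `i₀`.
    set lam := z i₀ / -(t i₀ : ℚ) with hlam
    have hlam0 : 0 ≤ lam := div_nonneg (h0 _) (hq _ hi₀).le
    obtain ⟨j, hj⟩ := ht0
    have hzj : 0 < z j := (h0 j).lt_of_ne fun h => by simp [hts j h.symm] at hj
    have hi₀z : z i₀ ≠ 0 := fun h => by simp [hts _ h] at hi₀
    have hi₀' : z i₀ + lam * t i₀ = 0 := by
      have : lam * -(t i₀ : ℚ) = z i₀ := div_mul_cancel₀ _ (hq _ hi₀).ne'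
      linarith
    have hcard : (Finset.univ.filter fun i => z i + lam * t i ≠ 0).card <
        (Finset.univ.filter fun i => z i ≠ 0).card := by
      refine Finset.card_lt_card ⟨?_, fun h => ?_⟩
      · intro i
        simp only [Finset.mem_filter, Finset.mem_univ, true_and]
        intro h hi
        simp [hi, hts i hi] at h
      · have := @h i₀ (by simpa using hi₀z)
        simp [hi₀'] at this
    have hnn : ∀ i, 0 ≤ z i + lam * t i := by
      intro i
      rcases lt_or_ge (t i) 0 with hi | hi
      · have h6 := hmin i hi
        rw [le_div_iff₀ (hq i hi)] at h6
        linarith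
      · have : (0 : ℚ) ≤ t i := by exact_mod_cast hi
        have := h0 i
        positivity
    have hne : (fun i => z i + lam * t i) ≠ 0 := by
      intro h
      have h6 := congrFun h j
      have : (0 : ℚ) < t j := by exact_mod_cast hj
      have : z j + lam * t j > 0 := by positivity
      simp only [Pi.zero_apply] at h6
      linarith
    have hker : ∀ k, ∑ i, M k i * (z i + lam * t i) = 0 := by
      intro k
      simp only [mul_add, Finset.sum_add_distrib, hMz, zero_add, mul_left_comm _ lam]
      rw [← Finset.mul_sum]
      have := ht k
      have h6 : ∑ i, (M k i : ℚ) * t i = 0 := by exact_mod_cast this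
      rw [h6, mul_zero]
    obtain ⟨r, h1, h2, h3, h4, h5⟩ := ih _ hcard (fun i => z i + lam * t i) hnn hne hker rfl
    refine ⟨r, h1, h2, h3, fun i hi => h4 i ?_, h5⟩
    simp [hi, hts i hi]

/-- Either a small ray can be subtracted or all entries are small. -/
theorem exists_ray_le_or (hK : 1 ≤ K) (hM : ∀ k i, (M k i).natAbs ≤ K) (z : ι → ℚ)
    (h0 : ∀ i, 0 ≤ z i) (hMz : ∀ k, ∑ i, M k i * z i = 0) :
    (∃ r : ι → ℤ, r ≠ 0 ∧ (∀ i, 0 ≤ r i) ∧ (∀ k, ∑ i, M k i * r i = 0) ∧ (∀ i, (r i : ℚ) ≤ z i) ∧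
      ∀ i, r i ≤ rayBound (Fintype.card ι) K) ∨
    ∀ i, z i ≤ (Finset.univ.filter fun i => z i ≠ 0).card * (rayBound (Fintype.card ι) K : ℚ) := by
  classical
  induction hn : (Finset.univ.filter fun i => z i ≠ 0).card using Nat.strong_induction_on
    generalizing z with
  | _ n ih =>
    by_cases hz : z = 0
    · right
      intro i
      simp only [hz, Pi.zero_apply]
      positivity
    obtain ⟨r, h1, h2, h3, h4, h5⟩ := exists_ray hK hM z h0 hz hMz
    obtain ⟨i₀, hi₀, hmin⟩ := Finset.exists_min_image (Finset.univ.filter fun i => 0 < r i)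
      (fun i => z i / (r i : ℚ)) (by
        obtain ⟨i, hi⟩ := Function.ne_iff.1 h1
        exact ⟨i, by simpa using (h2 i).lt_of_ne (Ne.symm hi)⟩)
    simp only [Finset.mem_filter, Finset.mem_univ, true_and] at hi₀ hmin
    have hq (i) (hi : 0 < r i) : (0 : ℚ) < r i := by exact_mod_cast hi
    have hq0 (i) : (0 : ℚ) ≤ r i := by exact_mod_cast h2 i
    -- This is the largest multiple of `r` below `z`. If it is at least one, then `r` itself fits.
    -- Otherwise subtracting it removes a coordinate from the support and less than one copy of `r`
    -- from `z`, so in the end `z` is bounded by the size of its support times the bound for rays.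
    set lam := z i₀ / (r i₀ : ℚ) with hlam
    have hlam0 : 0 ≤ lam := div_nonneg (h0 _) (hq _ hi₀).le
    have hle (i) : lam * r i ≤ z i := by
      rcases (h2 i).lt_or_eq with hi | hi
      · have := hmin i hi
        rwa [le_div_iff₀ (hq i hi)] at this
      · rw [← hi]
        simpa using h0 i
    rcases le_or_gt 1 lam with hl | hl
    · left
      refine ⟨r, h1, h2, h3, fun i => ?_, h5⟩
      exact (le_mul_of_one_le_left (hq0 i) hl).trans (hle i)
    have hi₀z : z i₀ ≠ 0 := fun h => by simp [h4 _ h] at hi₀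
    have hcard : (Finset.univ.filter fun i => z i - lam * r i ≠ 0).card < n := by
      rw [← hn]
      refine Finset.card_lt_card ⟨?_, fun h => ?_⟩
      · intro i
        simp only [Finset.mem_filter, Finset.mem_univ, true_and]
        intro h hi
        simp [hi, h4 i hi] at h
      · have := @h i₀ (by simpa using hi₀z)
        rw [hlam, Finset.mem_filter, div_mul_cancel₀ _ (hq _ hi₀).ne'] at this
        simp at this
    rcases ih _ hcard (fun i => z i - lam * r i) (fun i => sub_nonneg.2 (hle i)) (by
      intro k
      simp only [mul_sub, Finset.sum_sub_distrib, hMz, zero_sub, mul_left_comm _ lam]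
      rw [← Finset.mul_sum]
      have := h3 k
      have h6 : ∑ i, (M k i : ℚ) * r i = 0 := by exact_mod_cast this
      rw [h6, mul_zero, neg_zero]) rfl with ⟨r', g1, g2, g3, g4, g5⟩ | g
    · left
      refine ⟨r', g1, g2, g3, fun i => (g4 i).trans ?_, g5⟩
      have := hq0 i
      have : 0 ≤ lam * r i := by positivity
      linarith
    · right
      intro i
      have h6 := g i
      have h7 : (r i : ℚ) ≤ rayBound (Fintype.card ι) K := by exact_mod_cast h5 i
      have h8 : lam * r i ≤ r i := mul_le_of_le_one_left (hq0 i) hl.le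
      have h9 : ((Finset.univ.filter fun i => z i - lam * r i ≠ 0).card : ℚ) + 1 ≤ n := by
        exact_mod_cast hcard
      have h10 : (0 : ℚ) ≤ rayBound (Fintype.card ι) K := by positivity
      nlinarith

/-- Every natural solution is a sum of small ones. -/
theorem exists_sum_rays (hK : 1 ≤ K) (hM : ∀ k i, (M k i).natAbs ≤ K) (z : ι → ℤ)
    (h0 : ∀ i, 0 ≤ z i) (hMz : ∀ k, ∑ i, M k i * z i = 0) :
    ∃ L : List (ι → ℤ), z = L.sum ∧ ∀ r ∈ L, (∀ i, 0 ≤ r i) ∧ (∀ k, ∑ i, M k i * r i = 0) ∧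
      ∀ i, r i ≤ Fintype.card ι * rayBound (Fintype.card ι) K := by
  classical
  induction hn : (∑ i, z i).toNat using Nat.strong_induction_on generalizing z with
  | _ n ih =>
    -- Subtracting an integral ray preserves integrality and decreases the sum of the entries. When
    -- no ray fits, what is left is small and becomes the last part.
    rcases exists_ray_le_or hK hM (fun i => (z i : ℚ)) (fun i => by exact_mod_cast h0 i)
      (fun k => by exact_mod_cast hMz k) with ⟨r, h1, h2, h3, h4, h5⟩ | h
    · have h4' (i) : r i ≤ z i := by exact_mod_cast h4 i
      have hpos : 0 < ∑ i, r i := by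
        obtain ⟨i, hi⟩ := Function.ne_iff.1 h1
        exact Finset.sum_pos' (fun i _ => h2 i) ⟨i, by simp, (h2 i).lt_of_ne (Ne.symm hi)⟩
      have hle : ∑ i, r i ≤ ∑ i, z i := Finset.sum_le_sum fun i _ => h4' i
      obtain ⟨L, hL, hL'⟩ := ih (∑ i, (z - r) i).toNat (by
        simp only [Pi.sub_apply, Finset.sum_sub_distrib]
        omega) (z - r) (fun i => sub_nonneg.2 (h4' i)) (fun k => by
        simp [mul_sub, Finset.sum_sub_distrib, hMz, h3]) rfl
      refine ⟨r :: L, by rw [List.sum_cons, ← hL]; abel, ?_⟩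
      rintro s (_ | ⟨_, hs⟩)
      · refine ⟨h2, h3, fun i => (h5 i).trans ?_⟩
        have : 0 < Fintype.card ι := Fintype.card_pos_iff.2 ⟨i⟩
        have : (1 : ℤ) ≤ Fintype.card ι := by exact_mod_cast this
        exact le_mul_of_one_le_left (by positivity) this
      · exact hL' s hs
    · refine ⟨[z], by simp, ?_⟩
      rintro s (_ | ⟨_, hs⟩)
      · refine ⟨h0, hMz, fun i => ?_⟩
        have h6 := h i
        have h7 : (Finset.univ.filter fun i => (z i : ℚ) ≠ 0).card ≤ Fintype.card ι :=
          Finset.card_le_univ _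
        have h8 : (z i : ℚ) ≤ Fintype.card ι * (rayBound (Fintype.card ι) K : ℚ) := by
          refine h6.trans (mul_le_mul_of_nonneg_right ?_ (by positivity))
          exact_mod_cast h7
        exact_mod_cast h8
      · cases hs

end SmallSolutions

/-! ### Generators of integer points of polyhedra, and sparse sums. -/

namespace SmallSolutions

/-- With the homogenizing coordinate as `f`, this singles out the one part that is a point of the
polyhedron; the other parts are directions. -/
theorem exists_perm_of_sum_eq_one {β : Type} (f : β → ℤ) (L : List β) (h0 : ∀ r ∈ L, 0 ≤ f r)
    (h : (L.map f).sum = 1) :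
    ∃ r L', L.Perm (r :: L') ∧ f r = 1 ∧ ∀ s ∈ L', f s = 0 := by
  induction L with
  | nil => simp at h
  | cons r L ih =>
    simp only [List.mem_cons, forall_eq_or_imp, List.map_cons, List.sum_cons] at h0 h
    have hL : ∀ x ∈ L.map f, 0 ≤ x := by simpa using h0.2
    have hnn : 0 ≤ (L.map f).sum := List.sum_nonneg hL
    obtain hr | hr : f r = 0 ∨ f r = 1 := by omega
    · obtain ⟨s, L', h1, h2, h3⟩ := ih h0.2 (by omega)
      refine ⟨s, r :: L', (h1.cons r).trans (.swap _ _ _), h2, ?_⟩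
      simpa [hr] using h3
    · refine ⟨r, L, .refl _, hr, fun s hs => le_antisymm ?_ (h0.2 s hs)⟩
      have := List.single_le_sum hL (f s) (List.mem_map_of_mem hs)
      omega

variable {ι κ : Type} [Fintype ι] [Fintype κ] {A : κ → ι → ℤ} {b : κ → ℤ} {K : ℕ}

/-- The bound on the generators of the integer points of a polyhedron. -/
def genBound (N K : ℕ) : ℕ := N * rayBound N K

/-- Every integer point of a polyhedron is the sum of a small integer point and of small integer
directions of recession. -/
theorem exists_generators (hK : 1 ≤ K) (hA : ∀ k i, (A k i).natAbs ≤ K) (hb : ∀ k, (b k).natAbs ≤ K)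
    (y : ι → ℤ) (hy : ∀ k, 0 ≤ b k + ∑ i, A k i * y i) :
    ∃ (a : ι → ℤ) (L : List (ι → ℤ)), y = a + L.sum ∧
      ((∀ k, 0 ≤ b k + ∑ i, A k i * a i) ∧ (∀ i, 0 ≤ y i → 0 ≤ a i) ∧
        ∀ i, (a i).natAbs ≤ genBound (Fintype.card ι + Fintype.card κ + 1) K) ∧
      ∀ r ∈ L, (∀ k, 0 ≤ ∑ i, A k i * r i) ∧ (∀ i, 0 ≤ y i → 0 ≤ r i) ∧
        ∀ i, (r i).natAbs ≤ genBound (Fintype.card ι + Fintype.card κ + 1) K := by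
  classical
  -- The signs of `y` make all unknowns non-negative. They also ensure that point and directions
  -- stay in the orthant of `y`, so that solutions over `ℕ` remain over `ℕ`.
  set s : ι → ℤ := fun i => if 0 ≤ y i then 1 else -1 with hs
  have hss (i) : s i * s i = 1 := by simp only [hs]; split_ifs <;> rfl
  have hsa (i) : s i * y i = |y i| := by
    simp only [hs]
    split_ifs with h
    · rw [abs_of_nonneg h, one_mul]
    · rw [abs_of_neg (not_le.1 h), neg_one_mul]
  have hsn (i) (z : ℤ) : (s i * z).natAbs = z.natAbs := by
    simp only [hs]
    split_ifs <;> simp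
  -- The inequalities become homogeneous equations with one coordinate for the constant terms and
  -- one slack variable per inequality.
  let M : κ → Option (ι ⊕ κ) → ℤ := fun k => fun
    | none => b k
    | some (.inl i) => A k i * s i
    | some (.inr l) => if l = k then -1 else 0
  have hMsum (k) (w : Option (ι ⊕ κ) → ℤ) : ∑ j, M k j * w j =
      b k * w none + ∑ i, A k i * (s i * w (some (.inl i))) - w (some (.inr k)) := by
    simp [M, Fintype.sum_option, Fintype.sum_sum_type, mul_assoc, sub_eq_add_neg, add_assoc]
  let z : Option (ι ⊕ κ) → ℤ := fun
    | none => 1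
    | some (.inl i) => |y i|
    | some (.inr k) => b k + ∑ i, A k i * y i
  obtain ⟨L, hL, hL'⟩ := exists_sum_rays (M := M) hK (by
      rintro k (_ | i | l)
      · exact hb k
      · change (A k i * s i).natAbs ≤ K
        rw [mul_comm, hsn]
        exact hA k i
      · simp only [M]
        split_ifs <;> simp [hK]) z (by
      rintro (_ | i | k)
      · simp [z]
      · simp [z]
      · exact hy k) (by
      intro k
      rw [hMsum]
      simp only [z, ← hsa, ← mul_assoc (s _), hss]
      simp)
  have hcard : Fintype.card (Option (ι ⊕ κ)) = Fintype.card ι + Fintype.card κ + 1 := by simp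
  rw [hcard] at hL'
  obtain ⟨r, L', hperm, hr, hL0⟩ := exists_perm_of_sum_eq_one (fun w : Option (ι ⊕ κ) → ℤ => w none)
    L (fun r hr => (hL' r hr).1 none) (by
      have := congrFun hL none
      simpa [z, Pi.list_sum_apply] using this.symm)
  let π : (Option (ι ⊕ κ) → ℤ) →+ (ι → ℤ) :=
    { toFun := fun w i => s i * w (some (.inl i))
      map_zero' := by funext; simp
      map_add' := fun v w => by funext; simp [mul_add] }
  have hmem : ∀ w ∈ r :: L', w ∈ L := fun w hw => hperm.mem_iff.2 hw
  have hpos (w) (hw : w ∈ L) : (∀ k, 0 ≤ b k * w none + ∑ i, A k i * π w i) ∧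
      (∀ i, 0 ≤ y i → 0 ≤ π w i) ∧
      ∀ i, (π w i).natAbs ≤ genBound (Fintype.card ι + Fintype.card κ + 1) K := by
    obtain ⟨h1, h2, h3⟩ := hL' w hw
    refine ⟨fun k => ?_, fun i hi => ?_, fun i => ?_⟩
    · have h4 := h2 k
      rw [hMsum] at h4
      have := h1 (some (.inr k))
      change 0 ≤ b k * w none + ∑ i, A k i * (s i * w (some (.inl i)))
      omega
    · change 0 ≤ s i * _
      simpa [hs, hi] using h1 (some (.inl i))
    · change (s i * _).natAbs ≤ _
      rw [hsn]
      have := h1 (some (.inl i))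
      have := h3 (some (.inl i))
      rw [genBound]
      zify
      rw [abs_of_nonneg (h1 _)]
      exact_mod_cast this
  refine ⟨π r, L'.map π, ?_, ?_, ?_⟩
  · have h1 : π z = y := by
      funext i
      change s i * |y i| = y i
      rw [← hsa, ← mul_assoc, hss, one_mul]
    rw [← h1, hL, hperm.sum_eq, List.sum_cons, map_add, map_list_sum]
  · have := hpos r (hmem r (by simp))
    simpa [hr] using this
  · intro w hw
    obtain ⟨w, hw', rfl⟩ := List.mem_map.1 hw
    have := hpos w (hmem w (List.mem_cons_of_mem _ hw'))
    simpa [hL0 w hw'] using this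

/-! ### Sparse sums -/

/-- A sum of vectors with small entries and multiplicities only needs few of the vectors. -/
theorem exists_sparse_sum {ι : Type} [Fintype ι] (X : Finset (ι → ℤ)) (M : ℕ)
    (hX : ∀ v ∈ X, ∀ i, (v i).natAbs ≤ M) (μ : (ι → ℤ) → ℕ) :
    ∃ Y ⊆ X, ∃ ν : (ι → ℤ) → ℕ, ∑ v ∈ Y, ν v • v = ∑ v ∈ X, μ v • v ∧
      2 ^ Y.card ≤ (2 * (Y.card * M) + 1) ^ Fintype.card ι := by
  classical
  induction hn : X.card using Nat.strong_induction_on generalizing X μ with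
  | _ n ih =>
    by_cases hlt : 2 ^ X.card ≤ (2 * (X.card * M) + 1) ^ Fintype.card ι
    · exact ⟨X, subset_rfl, μ, rfl, hlt⟩
    push Not at hlt
    -- There are more subsets of `X` than possible values of their sums, so two different subsets
    -- have the same sum.
    obtain ⟨P, hP, Q, hQ, hne, hsum⟩ := Finset.exists_ne_map_eq_of_card_lt_of_maps_to
      (s := X.powerset) (t := Fintype.piFinset fun _ : ι =>
        Finset.Icc (-((X.card * M : ℕ) : ℤ)) (X.card * M : ℕ)) (f := fun P => ∑ v ∈ P, v) (by
        rw [Finset.card_powerset, Fintype.card_piFinset]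
        simp only [Int.card_Icc, Finset.prod_const, Finset.card_univ]
        have e : (((X.card * M : ℕ) : ℤ) + 1 - -((X.card * M : ℕ) : ℤ)).toNat =
          2 * (X.card * M) + 1 := by
          generalize X.card * M = m
          omega
        rwa [e]) (by
        intro P hP
        have hP' : P ⊆ X := by simpa using hP
        simp only [Fintype.coe_piFinset, Set.mem_pi, Finset.mem_coe, Finset.mem_Icc,
          Finset.sum_apply, ← abs_le]
        intro i _
        refine (Finset.abs_sum_le_sum_abs _ _).trans ?_
        refine (Finset.sum_le_card_nsmul P _ (M : ℤ) fun v hv => ?_).trans ?_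
        · have := hX v (hP' hv) i
          zify at this
          exact this
        · have := Finset.card_le_card hP'
          push_cast
          rw [nsmul_eq_mul]
          gcongr)
    wlog hPQ : (P \ Q).Nonempty generalizing P Q
    · refine this Q hQ P hP hne.symm hsum.symm ?_
      rw [Finset.not_nonempty_iff_eq_empty, Finset.sdiff_eq_empty_iff_subset] at hPQ
      rw [Finset.sdiff_nonempty]
      exact fun h => hne (hPQ.antisymm h)
    simp only [Finset.mem_powerset] at hP hQ
    have hsum' : ∑ v ∈ P \ Q, v = ∑ v ∈ Q \ P, v := by
      have h1 := Finset.sum_sdiff_sub_sum_sdiff (s₁ := Q) (s₂ := P) (f := fun v : ι → ℤ => v)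
      have h2 : ∑ v ∈ P, v = ∑ v ∈ Q, v := hsum
      rwa [h2, sub_self, sub_eq_zero] at h1
    obtain ⟨v₀, hv₀, hmin⟩ := Finset.exists_min_image (P \ Q) μ hPQ
    -- Multiplicity is shifted from `P \ Q` to `Q \ P`, which have equal sums. The amount is the
    -- least multiplicity on `P \ Q`, so nothing becomes negative and `v₀` drops out.
    let ν : (ι → ℤ) → ℕ := fun v =>
      if v ∈ P \ Q then μ v - μ v₀ else if v ∈ Q \ P then μ v + μ v₀ else μ v
    have hν (v) : (ν v : ℤ) = μ v - (if v ∈ P \ Q then (μ v₀ : ℤ) else 0) +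
        (if v ∈ Q \ P then (μ v₀ : ℤ) else 0) := by
      simp only [ν]
      by_cases h1 : v ∈ P \ Q
      · have h2 : v ∉ Q \ P := by simp_all
        rw [if_pos h1, if_pos h1, if_neg h2, Nat.cast_sub (hmin v h1)]
        simp
      · rw [if_neg h1, if_neg h1]
        split_ifs <;> simp
    have hsumX (R : Finset (ι → ℤ)) (hR : R ⊆ X) :
        ∑ v ∈ X, (if v ∈ R then (μ v₀ : ℤ) else 0) • v = (μ v₀ : ℤ) • ∑ v ∈ R, v := by
      simp only [ite_smul, zero_smul]
      rw [← Finset.sum_filter, Finset.filter_mem_eq_inter, Finset.inter_eq_right.2 hR,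
        Finset.smul_sum]
    have hνX : ∑ v ∈ X, ν v • v = ∑ v ∈ X, μ v • v := by
      simp only [← natCast_zsmul, hν, add_smul, sub_smul, Finset.sum_add_distrib,
        Finset.sum_sub_distrib]
      rw [hsumX _ (Finset.sdiff_subset.trans hP), hsumX _ (Finset.sdiff_subset.trans hQ), hsum']
      abel
    have hv₀X : v₀ ∈ X := hP (Finset.mem_sdiff.1 hv₀).1
    have hν₀ : ν v₀ = 0 := by simp only [ν, if_pos hv₀, Nat.sub_self]
    obtain ⟨Y, hY, ν', h1, h2⟩ := ih _ (hn ▸ Finset.card_erase_lt_of_mem hv₀X) (X.erase v₀)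
      (fun v hv => hX v (Finset.mem_of_mem_erase hv)) ν rfl
    refine ⟨Y, hY.trans (Finset.erase_subset _ _), ν', ?_, h2⟩
    rw [h1, ← hνX, ← Finset.add_sum_erase _ _ hv₀X, hν₀, zero_smul, zero_add]

/-- The bound on the number of vectors in sparse sums of `d`-dimensional vectors with entries
of at most `b` bits. -/
def sparseBound (d b : ℕ) : ℕ := d * (8 * d + 3 * b + 20)

/-- Taking logarithms gives `c ≤ (c.size + b + 1) * d`. Since `c.size` is logarithmic in `c`, its
square is bounded by a constant multiple of `c`, up to lower-order terms, and this bounds `c.size`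
linearly in `d` and `b`. -/
theorem le_sparseBound {c d b M : ℕ} (hM : M ≤ 2 ^ b) (h : 2 ^ c ≤ (2 * (c * M) + 1) ^ d) :
    c ≤ sparseBound d b := by
  have hs : c < 2 ^ c.size := Nat.lt_size_self c
  have h1 : 2 * (c * M) + 1 ≤ 2 ^ (c.size + b + 1) := by
    have : c * M + 1 ≤ 2 ^ c.size * 2 ^ b := by
      calc c * M + 1 ≤ c * 2 ^ b + 2 ^ b := by
            have := Nat.mul_le_mul_left c hM
            have := Nat.one_le_two_pow (n := b)
            omega
        _ = (c + 1) * 2 ^ b := by ring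
        _ ≤ _ := Nat.mul_le_mul_right _ hs
    rw [pow_succ, pow_add]
    omega
  have h2 : c ≤ (c.size + b + 1) * d := by
    rw [← Nat.pow_le_pow_iff_right (a := 2) (by norm_num), pow_mul]
    exact h.trans (Nat.pow_le_pow_left h1 d)
  have h3 (s : ℕ) : s * s ≤ 2 ^ (s + 1) := by
    rcases lt_or_ge s 4 with hs | hs
    · interval_cases s <;> norm_num
    · induction s, hs using Nat.le_induction with
      | base => norm_num
      | succ s hs ih => rw [pow_succ]; nlinarith
  rw [sparseBound]
  by_cases hc : c = 0
  · simp [hc]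
  obtain ⟨s, hs'⟩ : ∃ s, c.size = s + 1 := ⟨c.size - 1, by
    have : c.size ≠ 0 := by simpa [Nat.size_eq_zero] using hc
    omega⟩
  have h4 : 2 ^ s ≤ c := Nat.lt_size.1 (by omega)
  have h5 := h3 s
  rw [hs'] at h2
  rw [pow_succ] at h5
  have h6 : s ≤ 2 * d + b + 1 + 2 * d := by
    by_contra hlt
    push Not at hlt
    nlinarith
  nlinarith

end SmallSolutions

/-! ### Linear systems of formulas -/

namespace CardVerifier

open SmallSolutions

variable {α ι : Type} [Fintype ι]

/-- The assignment in which the variables of `α` have the values of variables of `ι` or zero. -/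
def extend (p : α → Option ι) (ρ : ι → ℤ) (a : α) : ℤ := (p a).elim 0 ρ

theorem natAbs_lt_two_pow (c : ℤ) : c.natAbs < 2 ^ (encodeBits c.natAbs).length := by
  rw [encodeBits, List.length_map, Nat.size_eq_bits_len]
  exact Nat.lt_size_self _

/-- Constants are written in binary, so under multiplication bit lengths add up, as do lengths of
texts; nested multiplications thus stay within the bound. -/
theorem LinTerm.exists_coeff (var : α → List Token) (p : α → Option ι) (t : LinTerm α) :
    ∃ (e : ι → ℤ) (e₀ : ℤ), (∀ i, (e i).natAbs ≤ 2 ^ (t.encode var).length) ∧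
      e₀.natAbs ≤ 2 ^ (t.encode var).length ∧
      ∀ ρ, t.value (extend p ρ) = e₀ + ∑ i, e i * ρ i := by
  classical
  induction t with
  | const c =>
    refine ⟨0, c, by simp, ?_, by simp [LinTerm.value]⟩
    refine (natAbs_lt_two_pow c).le.trans (Nat.pow_le_pow_right (by norm_num) ?_)
    simp [LinTerm.encode, encodeInt]; omega
  | var a =>
    cases h : p a with
    | none => exact ⟨0, 0, by simp, by simp, by simp [LinTerm.value, extend, h]⟩
    | some j =>
      refine ⟨Pi.single j 1, 0, fun i => ?_, by simp,
        by simp [LinTerm.value, extend, h, Pi.single_apply]⟩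
      have := Nat.one_le_two_pow (n := ((LinTerm.var a).encode var).length)
      rw [Pi.single_apply]
      split_ifs <;> simp [Nat.one_le_two_pow]
  | add s t ihs iht =>
    obtain ⟨e, e₀, h1, h2, h3⟩ := ihs
    obtain ⟨f, f₀, g1, g2, g3⟩ := iht
    have key (x y : ℤ) (hx : x.natAbs ≤ 2 ^ (s.encode var).length)
        (hy : y.natAbs ≤ 2 ^ (t.encode var).length) :
        (x + y).natAbs ≤ 2 ^ ((LinTerm.add s t).encode var).length := by
      have h4 := Nat.one_le_two_pow (n := (s.encode var).length)
      have h5 := Nat.one_le_two_pow (n := (t.encode var).length)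
      have := Int.natAbs_add_le x y
      simp only [LinTerm.encode, List.length_cons, List.length_append, pow_succ, pow_add]
      nlinarith
    refine ⟨e + f, e₀ + f₀, fun i => key _ _ (h1 i) (g1 i), key _ _ h2 g2, fun ρ => ?_⟩
    simp only [LinTerm.value, h3, g3, Pi.add_apply, add_mul, Finset.sum_add_distrib]
    ring
  | smul c t ih =>
    obtain ⟨f, f₀, g1, g2, g3⟩ := ih
    have key (y : ℤ) (hy : y.natAbs ≤ 2 ^ (t.encode var).length) :
        (c * y).natAbs ≤ 2 ^ ((LinTerm.smul c t).encode var).length := by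
      rw [Int.natAbs_mul]
      refine (Nat.mul_le_mul (natAbs_lt_two_pow c).le hy).trans ?_
      rw [← pow_add]
      refine Nat.pow_le_pow_right (by norm_num) ?_
      simp [LinTerm.encode, encodeInt]; omega
    refine ⟨fun i => c * f i, c * f₀, fun i => key _ (g1 i), key _ g2, fun ρ => ?_⟩
    simp only [LinTerm.value, g3, mul_add, Finset.mul_sum, mul_assoc]

/-- The truth of a formula is constant on a polyhedron around each assignment. -/
theorem QFPA.exists_system (var : α → List Token) (p : α → Option ι) (F : QFPA α) (ρ : ι → ℤ) :
    ∃ L : List ((ι → ℤ) × ℤ), L.length ≤ 2 * (F.encode var).length ∧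
      (∀ e ∈ L, (∀ i, (e.1 i).natAbs ≤ 2 ^ ((F.encode var).length + 1)) ∧
        e.2.natAbs ≤ 2 ^ ((F.encode var).length + 1)) ∧
      (∀ e ∈ L, 0 ≤ e.2 + ∑ i, e.1 i * ρ i) ∧
      ∀ ρ', (∀ e ∈ L, 0 ≤ e.2 + ∑ i, e.1 i * ρ' i) →
        (F.Holds (extend p ρ') ↔ F.Holds (extend p ρ)) := by
  -- The shift `d` of the constant term is used for strict inequalities, which over `ℤ` are weak
  -- ones with the constant lowered by one.
  have atom (s t : LinTerm α) : ∃ (e : ι → ℤ) (e₀ : ℤ),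
      (∀ (d : ℤ), d.natAbs ≤ 1 → (∀ i, (e i).natAbs ≤
        2 ^ ((s.encode var).length + (t.encode var).length + 2)) ∧
        (e₀ + d).natAbs ≤ 2 ^ ((s.encode var).length + (t.encode var).length + 2)) ∧
      ∀ ρ, t.value (extend p ρ) - s.value (extend p ρ) = e₀ + ∑ i, e i * ρ i := by
    obtain ⟨e, e₀, h1, h2, h3⟩ := LinTerm.exists_coeff var p s
    obtain ⟨f, f₀, g1, g2, g3⟩ := LinTerm.exists_coeff var p t
    have key (x y : ℤ) (hx : x.natAbs ≤ 2 ^ (s.encode var).length)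
        (hy : y.natAbs ≤ 2 ^ (t.encode var).length) (d : ℤ) (hd : d.natAbs ≤ 1) :
        (y - x + d).natAbs ≤ 2 ^ ((s.encode var).length + (t.encode var).length + 2) := by
      have h4 := Nat.one_le_two_pow (n := (s.encode var).length)
      have h5 := Nat.one_le_two_pow (n := (t.encode var).length)
      have : (y - x + d).natAbs ≤ y.natAbs + x.natAbs + d.natAbs := by omega
      simp only [pow_succ, pow_add]
      nlinarith
    refine ⟨f - e, f₀ - e₀, fun d hd => ⟨fun i => ?_, key _ _ h2 g2 d hd⟩, fun ρ => ?_⟩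
    · simpa using key _ _ (h1 i) (g1 i) 0 (by simp)
    · simp only [h3, g3, Pi.sub_apply, sub_mul, Finset.sum_sub_distrib]
      ring
  induction F with
  | le s t =>
    have hlen : ((QFPA.le s t).encode var).length + 1 =
        (s.encode var).length + (t.encode var).length + 2 := by simp [QFPA.encode]
    rw [hlen]
    by_cases h : s.value (extend p ρ) ≤ t.value (extend p ρ)
    · obtain ⟨e, e₀, h1, h2⟩ := atom s t
      have h3 := h1 0 (by simp)
      refine ⟨[(e, e₀)], by simp [QFPA.encode]; omega, by simpa using h3, ?_, fun ρ' hρ' => ?_⟩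
      · have := h2 ρ
        simp only [List.mem_singleton, forall_eq]
        omega
      · have := h2 ρ'
        simp only [List.mem_singleton, forall_eq] at hρ'
        simp only [QFPA.Holds, h, iff_true]
        omega
    · obtain ⟨e, e₀, h1, h2⟩ := atom t s
      have h3 := h1 (-1) (by simp)
      rw [add_comm (t.encode var).length] at h3
      refine ⟨[(e, e₀ + -1)], by simp [QFPA.encode]; omega, by simpa using h3, ?_,
        fun ρ' hρ' => ?_⟩
      · have := h2 ρ
        simp only [List.mem_singleton, forall_eq]
        omega
      · have := h2 ρ'
        simp only [List.mem_singleton, forall_eq] at hρ'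
        simp only [QFPA.Holds, h, iff_false]
        omega
  | eq s t =>
    have hlen : ((QFPA.eq s t).encode var).length + 1 =
        (s.encode var).length + (t.encode var).length + 2 := by simp [QFPA.encode]
    rw [hlen]
    -- A disequation is not convex, so only the side on which the given assignment lies is kept.
    rcases lt_trichotomy (s.value (extend p ρ)) (t.value (extend p ρ)) with h | h | h
    · obtain ⟨e, e₀, h1, h2⟩ := atom s t
      have h3 := h1 (-1) (by simp)
      refine ⟨[(e, e₀ + -1)], by simp [QFPA.encode]; omega, by simpa using h3, ?_,
        fun ρ' hρ' => ?_⟩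
      · have := h2 ρ
        simp only [List.mem_singleton, forall_eq]
        omega
      · have := h2 ρ'
        simp only [List.mem_singleton, forall_eq] at hρ'
        simp only [QFPA.Holds, h.ne, iff_false]
        omega
    · obtain ⟨e, e₀, h1, h2⟩ := atom s t
      obtain ⟨f, f₀, g1, g2⟩ := atom t s
      have h3 := h1 0 (by simp)
      have g3 := g1 0 (by simp)
      rw [add_comm (t.encode var).length] at g3
      rw [add_zero] at h3 g3
      refine ⟨[(e, e₀), (f, f₀)], by simp [QFPA.encode], by simpa using ⟨h3, g3⟩, ?_,
        fun ρ' hρ' => ?_⟩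
      · have := h2 ρ
        have := g2 ρ
        simp only [List.mem_cons, List.not_mem_nil, or_false, forall_eq_or_imp, forall_eq]
        omega
      · have := h2 ρ'
        have := g2 ρ'
        simp only [List.mem_cons, List.not_mem_nil, or_false, forall_eq_or_imp, forall_eq] at hρ'
        simp only [QFPA.Holds, h, iff_true]
        omega
    · obtain ⟨e, e₀, h1, h2⟩ := atom t s
      have h3 := h1 (-1) (by simp)
      rw [add_comm (t.encode var).length] at h3
      refine ⟨[(e, e₀ + -1)], by simp [QFPA.encode]; omega, by simpa using h3, ?_,
        fun ρ' hρ' => ?_⟩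
      · have := h2 ρ
        simp only [List.mem_singleton, forall_eq]
        omega
      · have := h2 ρ'
        simp only [List.mem_singleton, forall_eq] at hρ'
        simp only [QFPA.Holds, h.ne', iff_false]
        omega
  | not F ih =>
    obtain ⟨L, h1, h2, h3, h4⟩ := ih
    refine ⟨L, by simp [QFPA.encode]; omega, fun e he => ?_, h3,
      fun ρ' hρ' => not_congr (h4 ρ' hρ')⟩
    have hle : 2 ^ ((F.encode var).length + 1) ≤ 2 ^ (((QFPA.not F).encode var).length + 1) :=
      Nat.pow_le_pow_right (by norm_num) (by simp [QFPA.encode])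
    exact ⟨fun i => ((h2 e he).1 i).trans hle, (h2 e he).2.trans hle⟩
  | and F G ihF ihG =>
    obtain ⟨L, h1, h2, h3, h4⟩ := ihF
    obtain ⟨L', g1, g2, g3, g4⟩ := ihG
    have hle : 2 ^ ((F.encode var).length + 1) ≤ 2 ^ (((QFPA.and F G).encode var).length + 1) :=
      Nat.pow_le_pow_right (by norm_num) (by simp [QFPA.encode]; omega)
    have gle : 2 ^ ((G.encode var).length + 1) ≤ 2 ^ (((QFPA.and F G).encode var).length + 1) :=
      Nat.pow_le_pow_right (by norm_num) (by simp [QFPA.encode]; omega)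
    refine ⟨L ++ L', by simp [QFPA.encode]; omega, fun e he => ?_, fun e he => ?_, fun ρ' hρ' => ?_⟩
    · rcases List.mem_append.1 he with he | he
      · exact ⟨fun i => ((h2 e he).1 i).trans hle, (h2 e he).2.trans hle⟩
      · exact ⟨fun i => ((g2 e he).1 i).trans gle, (g2 e he).2.trans gle⟩
    · rcases List.mem_append.1 he with he | he
      · exact h3 e he
      · exact g3 e he
    · exact and_congr (h4 ρ' fun e he => hρ' e (by simp [he]))
        (g4 ρ' fun e he => hρ' e (by simp [he]))
  | or F G ihF ihG =>
    obtain ⟨L, h1, h2, h3, h4⟩ := ihF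
    obtain ⟨L', g1, g2, g3, g4⟩ := ihG
    have hle : 2 ^ ((F.encode var).length + 1) ≤ 2 ^ (((QFPA.or F G).encode var).length + 1) :=
      Nat.pow_le_pow_right (by norm_num) (by simp [QFPA.encode]; omega)
    have gle : 2 ^ ((G.encode var).length + 1) ≤ 2 ^ (((QFPA.or F G).encode var).length + 1) :=
      Nat.pow_le_pow_right (by norm_num) (by simp [QFPA.encode]; omega)
    refine ⟨L ++ L', by simp [QFPA.encode]; omega, fun e he => ?_, fun e he => ?_, fun ρ' hρ' => ?_⟩
    · rcases List.mem_append.1 he with he | he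
      · exact ⟨fun i => ((h2 e he).1 i).trans hle, (h2 e he).2.trans hle⟩
      · exact ⟨fun i => ((g2 e he).1 i).trans gle, (g2 e he).2.trans gle⟩
    · rcases List.mem_append.1 he with he | he
      · exact h3 e he
      · exact g3 e he
    · exact or_congr (h4 ρ' fun e he => hρ' e (by simp [he]))
        (g4 ρ' fun e he => hρ' e (by simp [he]))

theorem LinTerm.value_congr {var : α → List Token} {ρ ρ' : α → ℤ} {S : ℕ}
    (h : ∀ a, (var a).length ≤ S → ρ a = ρ' a) (t : LinTerm α) (ht : (t.encode var).length ≤ S) :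
    t.value ρ = t.value ρ' := by
  induction t with
  | const c => rfl
  | var a => exact h a ht
  | add s t ihs iht =>
    simp only [LinTerm.encode, List.length_cons, List.length_append] at ht
    simp only [LinTerm.value, ihs (by omega), iht (by omega)]
  | smul c t ih =>
    simp only [LinTerm.encode, List.length_cons, List.length_append] at ht
    simp only [LinTerm.value, ih (by omega)]

/-- A variable that occurs in a formula has a code no longer than the formula. This reduces the
infinitely many further variables to finitely many. -/
theorem QFPA.holds_congr {var : α → List Token} {ρ ρ' : α → ℤ} {S : ℕ}
    (h : ∀ a, (var a).length ≤ S → ρ a = ρ' a) (F : QFPA α) (hF : (F.encode var).length ≤ S) :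
    F.Holds ρ ↔ F.Holds ρ' := by
  induction F with
  | le s t | eq s t =>
    simp only [QFPA.encode, List.length_cons, List.length_append] at hF
    simp only [QFPA.Holds, LinTerm.value_congr h s (by omega), LinTerm.value_congr h t (by omega)]
  | not F ih =>
    simp only [QFPA.encode, List.length_cons] at hF
    exact not_congr (ih (by omega))
  | and F G ihF ihG =>
    simp only [QFPA.encode, List.length_cons, List.length_append] at hF
    exact and_congr (ihF (by omega)) (ihG (by omega))
  | or F G ihF ihG =>
    simp only [QFPA.encode, List.length_cons, List.length_append] at hF
    exact or_congr (ihF (by omega)) (ihG (by omega))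

theorem genBound_le {N N' k : ℕ} (h : N ≤ N') : genBound N (2 ^ k) ≤ 2 ^ (N' * (N' + k + 1)) := by
  have h1 : N ≤ 2 ^ N' := h.trans Nat.lt_two_pow_self.le
  calc genBound N (2 ^ k) = N * (N * 2 ^ k) ^ N := rfl
    _ ≤ 2 ^ N' * (2 ^ N' * 2 ^ k) ^ N := by gcongr
    _ ≤ 2 ^ N' * (2 ^ N' * 2 ^ k) ^ N' :=
      Nat.mul_le_mul_left _ (Nat.pow_le_pow_right (by positivity) h)
    _ = _ := by rw [← pow_add, ← pow_mul, ← pow_add]; congr 1; ring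

/-- The bound on the bit length of generators of the solutions of a formula. -/
def rayBits (S : ℕ) : ℕ := (3 * S + 1) * (4 * S + 3)

/-- The polyhedron around `y` on which the truth of `F` is constant contains `a` and is closed under
its directions of recession. Hence every combination of them, and not only the one that gives `y`,
leads to a solution. -/
theorem exists_generators_of_mem_solutions {nat : Bool} {k S : ℕ} {F : QFPA (Fin k)}
    (hF : (F.encode encodeFin).length ≤ S) (hk : k ≤ S) {y : Fin k → ℤ} (hy : y ∈ solutions nat F) :
    ∃ (a : Fin k → ℤ) (L : List (Fin k → ℤ)), y = a + L.sum ∧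
      (∀ v ∈ AddSubmonoid.closure {r | r ∈ L}, a + v ∈ solutions nat F) ∧
      (∀ i, (a i).natAbs ≤ 2 ^ rayBits S) ∧ ∀ r ∈ L, ∀ i, (r i).natAbs ≤ 2 ^ rayBits S := by
  have hext (ρ : Fin k → ℤ) : extend some ρ = ρ := rfl
  obtain ⟨C, h1, h2, h3, h4⟩ := QFPA.exists_system encodeFin some F y
  have hle : 2 ^ ((F.encode encodeFin).length + 1) ≤ 2 ^ (S + 1) :=
    Nat.pow_le_pow_right (by norm_num) (by omega)
  obtain ⟨a, L, g1, ⟨g2, g3, g4⟩, g5⟩ := exists_generators (κ := Fin C.length) (K := 2 ^ (S + 1))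
    (A := fun e => C[e].1) (b := fun e => C[e].2) Nat.one_le_two_pow
    (fun e i => ((h2 _ (List.getElem_mem _)).1 i).trans hle)
    (fun e => (h2 _ (List.getElem_mem _)).2.trans hle) y
    (fun e => h3 _ (List.getElem_mem _))
  have hB : genBound (Fintype.card (Fin k) + Fintype.card (Fin C.length) + 1) (2 ^ (S + 1)) ≤
      2 ^ rayBits S := by
    -- At most `S` unknowns, at most `2 * S` inequalities and the homogenizing coordinate.
    refine (genBound_le (N' := 3 * S + 1) (by simp; omega)).trans
      (Nat.pow_le_pow_right (by norm_num) ?_)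
    rw [rayBits]
    exact Nat.mul_le_mul_left _ (by omega)
  refine ⟨a, L, g1, fun v hv => ?_, fun i => (g4 i).trans hB,
    fun r hr i => ((g5 r hr).2.2 i).trans hB⟩
  have hv' : (∀ e : Fin C.length, 0 ≤ ∑ i, C[e].1 i * v i) ∧ ∀ i, 0 ≤ y i → 0 ≤ v i := by
    induction hv using AddSubmonoid.closure_induction with
    | mem r hr => exact ⟨(g5 r hr).1, (g5 r hr).2.1⟩
    | zero => simp
    | add v w _ _ hv hw =>
      refine ⟨fun e => ?_, fun i hi => add_nonneg (hv.2 i hi) (hw.2 i hi)⟩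
      simp only [Pi.add_apply, mul_add, Finset.sum_add_distrib]
      exact add_nonneg (hv.1 e) (hw.1 e)
  refine ⟨fun j hnat => add_nonneg (g3 j (hy.1 j hnat)) (hv'.2 j (hy.1 j hnat)), ?_⟩
  have := h4 (a + v) (by
    intro e he
    obtain ⟨j, hj, rfl⟩ := List.mem_iff_getElem.1 he
    have e1 := g2 ⟨j, hj⟩
    have e2 := hv'.1 ⟨j, hj⟩
    simp only [Fin.getElem_fin] at e1 e2
    simp only [Pi.add_apply, mul_add, Finset.sum_add_distrib]
    omega)
  rw [hext, hext] at this
  exact this.2 hy.2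

end CardVerifier

/-! ### Sums of solutions as linear families with free multiplicities. -/

namespace CardVerifier

open SmallSolutions

/-- The number of vectors in a representation of a sum of solutions. -/
def itemBound (S : ℕ) : ℕ := 2 * sparseBound (S + 1) (rayBits S)

/-- A family of sums of solutions: for all multiplicities `μ` the vector `base + ∑ j, μ j • gen j`
is a sum of `count + ∑ j, μ j * weight j` solutions. -/
structure Template (nat : Bool) (S : ℕ) {k : ℕ} (F : QFPA (Fin k)) where
  J : Type
  fintype : Fintype J
  base : Fin k → ℤ
  count : ℕ
  gen : J → Fin k → ℤ
  weight : J → ℕ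
  card_le : Fintype.card J ≤ itemBound S
  base_le : ∀ i, (base i).natAbs ≤ 2 ^ (itemBound S + rayBits S)
  count_le : count ≤ itemBound S
  gen_le : ∀ j i, (gen j i).natAbs ≤ 2 ^ rayBits S
  weight_le : ∀ j, weight j ≤ 1
  represents : ∀ (μ : J → ℕ) (T : ℕ), (∀ j, μ j ≤ 2 ^ T) → ∃ items,
    Represents nat (rayBits S + T + itemBound S + 1) (itemBound S) F (base + ∑ j, μ j • gen j)
      items ∧
      (items.map Prod.fst).sum = count + ∑ j, μ j * weight j

attribute [instance] Template.fintype

theorem abs_sum_le {β : Type} (s : Finset β) (f : β → ℤ) {M : ℕ} (h : ∀ i ∈ s, (f i).natAbs ≤ M) :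
    (∑ i ∈ s, f i).natAbs ≤ s.card * M := by
  refine (Int.natAbs_sum_le s f).trans ?_
  simpa using Finset.sum_le_card_nsmul s _ M h

theorem sparseBound_mono {d d' b : ℕ} (h : d ≤ d') : sparseBound d b ≤ sparseBound d' b := by
  unfold sparseBound
  gcongr

theorem mul_two_pow_lt {q m T b : ℕ} (hm : m ≤ q) :
    2 ^ b + m * (2 ^ T * 2 ^ b) < 2 ^ (b + T + q + 1) := by
  have h1 : q + 1 ≤ 2 ^ q := Nat.lt_two_pow_self
  have h2 : 1 ≤ 2 ^ T := Nat.one_le_two_pow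
  calc 2 ^ b + m * (2 ^ T * 2 ^ b) ≤ (q + 1) * (2 ^ T * 2 ^ b) := by
        have := Nat.mul_le_mul_right (2 ^ T * 2 ^ b) hm
        have := Nat.mul_le_mul_right (2 ^ b) h2
        rw [add_mul]
        omega
    _ ≤ 2 ^ q * (2 ^ T * 2 ^ b) := Nat.mul_le_mul_right _ h1
    _ = 2 ^ (b + T + q) := by rw [← pow_add, ← pow_add]; congr 1; ring
    _ < _ := Nat.pow_lt_pow_right (by norm_num) (by omega)

/-- Directions may be redistributed among summands only if each stays with a summand from whose
polyhedron it came. Fixing one owner per direction suffices for this, and there are at most as many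
owners as directions. The owners form `base` and `count`; generators of weight `0` are directions,
those of weight `1` are the points of the other summands. -/
theorem exists_template {nat : Bool} {k S x : ℕ} {F : QFPA (Fin k)}
    (hF : (F.encode encodeFin).length ≤ S) (hk : k ≤ S) {u : Fin k → ℤ}
    (hu : u ∈ sumPow (solutions nat F) x) :
    ∃ (t : Template nat S F) (μ : t.J → ℕ), u = t.base + ∑ j, μ j • t.gen j ∧
      x = t.count + ∑ j, μ j * t.weight j := by
  classical
  obtain ⟨y, hy, rfl⟩ := hu
  choose a L hyaL hsol ha hL using fun p => exists_generators_of_mem_solutions hF hk (hy p)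
  have hsol₀ (p) : a p ∈ solutions nat F := by simpa using hsol p 0 (zero_mem _)
  -- the rays
  set R := (List.ofFn L).flatten with hR
  have hmemR (v) : v ∈ R ↔ ∃ p, v ∈ L p := by
    simp [hR, List.mem_flatten, List.mem_ofFn]
  have hsumR : R.sum = ∑ p, (L p).sum := by
    rw [hR, List.sum_flatten, List.map_ofFn, List.sum_ofFn]
    rfl
  -- Sparsification applies to the pooled directions of all summands, so that `Y` is small
  -- independently of the number `x` of summands.
  obtain ⟨Y, hY, ν, hν, hYcard⟩ := exists_sparse_sum R.toFinset (2 ^ rayBits S) (by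
    intro v hv
    obtain ⟨p, hp⟩ := (hmemR v).1 (List.mem_toFinset.1 hv)
    exact hL p v hp) R.count
  rw [← Finset.sum_list_count, hsumR] at hν
  choose o ho using fun v : Y => (hmemR v).1 (List.mem_toFinset.1 (hY v.2))
  set P := Finset.univ.image o with hP
  -- the points
  let h : Fin x → Option (Fin k) → ℤ := fun p i => i.elim 1 (a p)
  set H := Pᶜ.toList.map h with hH
  have hmemH (v) (hv : v ∈ H) : ∃ p, v = h p := by
    obtain ⟨p, -, rfl⟩ := List.mem_map.1 hv
    exact ⟨p, rfl⟩
  -- The additional coordinate `1` of `h` makes the exchange preserve the number of summands, and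
  -- not only their sum.
  obtain ⟨Z, hZ, ν', hν', hZcard⟩ := exists_sparse_sum H.toFinset (2 ^ rayBits S) (by
    intro v hv
    obtain ⟨p, rfl⟩ := hmemH v (List.mem_toFinset.1 hv)
    rintro (_ | i)
    · simpa [h] using Nat.one_le_two_pow
    · exact ha p i) H.count
  rw [← Finset.sum_list_count, hH, Finset.sum_map_toList] at hν'
  choose o' ho' using fun v : Z => hmemH v (List.mem_toFinset.1 (hZ v.2))
  have hY' : Y.card ≤ sparseBound (S + 1) (rayBits S) := by
    refine (le_sparseBound le_rfl hYcard).trans (sparseBound_mono ?_)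
    rw [Fintype.card_fin]
    omega
  have hZ' : Z.card ≤ sparseBound (S + 1) (rayBits S) := by
    refine (le_sparseBound le_rfl hZcard).trans (sparseBound_mono ?_)
    rw [Fintype.card_option, Fintype.card_fin]
    omega
  have hPY : P.card ≤ Y.card := by
    refine Finset.card_image_le.trans_eq ?_
    rw [Finset.card_univ, Fintype.card_coe]
  have hoP (v) : o v ∈ P := Finset.mem_image_of_mem o (Finset.mem_univ v)
  have hνZ : ∑ v : Z, ν' v • h (o' v) = ∑ p ∈ Pᶜ, h p := by
    rw [← hν', ← Finset.sum_coe_sort Z]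
    exact Finset.sum_congr rfl fun v _ => by rw [← ho']
  have hνZ₀ : x = P.card + ∑ v : Z, ν' v := by
    have h1 := congrFun hνZ none
    simp only [Finset.sum_apply, Pi.smul_apply] at h1
    simp only [show ∀ p, h p none = 1 from fun _ => rfl, nsmul_eq_mul, mul_one,
      Finset.sum_const, ← Nat.cast_sum, Nat.cast_inj, Finset.card_compl, Fintype.card_fin] at h1
    have h2 := Finset.card_le_univ P
    rw [Fintype.card_fin] at h2
    omega
  have hνZ' : ∑ v : Z, ν' v • a (o' v) = ∑ p ∈ Pᶜ, a p := by
    funext i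
    have h1 := congrFun hνZ (some i)
    simpa [h] using h1
  let t : Template nat S F :=
    { J := Y ⊕ Z
      fintype := inferInstance
      base := ∑ p ∈ P, a p
      count := P.card
      gen := Sum.elim Subtype.val fun v => a (o' v)
      weight := Sum.elim 0 1
      card_le := by
        simp only [Fintype.card_sum, Fintype.card_coe, itemBound]
        omega
      base_le := by
        intro i
        rw [Finset.sum_apply]
        refine (abs_sum_le P _ fun p _ => ha p i).trans ?_
        rw [pow_add]
        refine Nat.mul_le_mul_right _ ?_
        refine le_trans ?_ Nat.lt_two_pow_self.le
        simp only [itemBound]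
        omega
      count_le := by
        simp only [itemBound]
        omega
      gen_le := by
        rintro (v | v) i
        · exact hL _ _ (ho v) i
        · exact ha _ i
      weight_le := by rintro (v | v) <;> simp
      represents := by
        intro μ T hμ
        have hcount : ((P.toList.map (fun p => (1, a p + ∑ v with o v = p, μ (.inl v) • v.1)) ++
            Finset.univ.toList.map fun v => (μ (.inr v), a (o' v))).map Prod.fst).sum =
            P.card + ∑ j, μ j * (Sum.elim 0 1 : Y ⊕ Z → ℕ) j := by
          simp [List.map_map, Function.comp_def, Fintype.sum_sum_type]
        -- Each owner occurs once, together with all the directions that it owns; the points of `Z`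
        -- occur with their own multiplicities, possibly zero.
        refine ⟨P.toList.map (fun p => (1, a p + ∑ v with o v = p, μ (.inl v) • v.1)) ++
          Finset.univ.toList.map fun v => (μ (.inr v), a (o' v)), ⟨?_, ?_, ?_, ?_⟩, ?_⟩
        · simp only [List.length_append, List.length_map, Finset.length_toList, Finset.card_univ,
            Fintype.card_coe, itemBound]
          omega
        · intro it hit
          rcases List.mem_append.1 hit with hit | hit
          · obtain ⟨p, -, rfl⟩ := List.mem_map.1 hit
            refine ⟨Nat.one_lt_two_pow (by omega), fun i => ?_, hsol p _ (sum_mem fun v hv =>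
              nsmul_mem (AddSubmonoid.subset_closure ?_) _)⟩
            · simp only [Pi.add_apply, Finset.sum_apply, Pi.smul_apply]
              refine (Int.natAbs_add_le _ _).trans_lt (lt_of_le_of_lt (Nat.add_le_add (ha p i)
                (abs_sum_le _ _ (M := 2 ^ T * 2 ^ rayBits S) fun v _ => ?_)) (mul_two_pow_lt ?_))
              · rw [nsmul_eq_mul, Int.natAbs_mul, Int.natAbs_natCast]
                exact Nat.mul_le_mul (hμ _) (hL _ _ (ho v) i)
              · refine (Finset.card_le_univ _).trans ?_
                rw [Fintype.card_coe, itemBound]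
                omega
            · rw [← (Finset.mem_filter.1 hv).2]
              exact ho v
          · obtain ⟨v, -, rfl⟩ := List.mem_map.1 hit
            refine ⟨(hμ _).trans_lt (Nat.pow_lt_pow_right (by norm_num) (by omega)),
              fun i => (ha _ i).trans_lt (Nat.pow_lt_pow_right (by norm_num) (by omega)), hsol₀ _⟩
        · rw [hcount]
          refine lt_of_le_of_lt ?_ (mul_two_pow_lt (q := itemBound S) (m := itemBound S)
            (b := rayBits S) le_rfl)
          have h1 : ∑ j, μ j * (Sum.elim 0 1 : Y ⊕ Z → ℕ) j ≤ Z.card * 2 ^ T := by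
            simp only [Fintype.sum_sum_type, Sum.elim_inl, Sum.elim_inr, Pi.zero_apply, mul_zero,
              Finset.sum_const_zero, zero_add, Pi.one_apply, mul_one]
            refine (Finset.sum_le_card_nsmul _ _ (2 ^ T) fun v _ => hμ _).trans_eq ?_
            rw [Finset.card_univ, Fintype.card_coe, smul_eq_mul]
          have h2 : (Y.card + Z.card) * (2 ^ T * 1) ≤ itemBound S * (2 ^ T * 2 ^ rayBits S) :=
            Nat.mul_le_mul (by rw [itemBound]; omega)
              (Nat.mul_le_mul_left _ Nat.one_le_two_pow)
          have h3 := Nat.mul_le_mul_left Y.card (Nat.one_le_two_pow (n := T))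
          rw [mul_one, add_mul] at h2
          have h4 := Nat.zero_le (2 ^ rayBits S)
          linarith
        · simp only [List.map_append, List.map_map, List.sum_append, Finset.sum_map_toList,
            Function.comp_apply, one_smul, Finset.sum_add_distrib, Fintype.sum_sum_type,
            Sum.elim_inl, Sum.elim_inr]
          rw [Finset.sum_fiberwise_of_maps_to (fun v _ => hoP v), add_assoc]
        · exact hcount }
  refine ⟨t, Sum.elim (fun v => ν v) fun v => ν' v, ?_, ?_⟩
  · change ∑ p, y p = ∑ p ∈ P, a p + ∑ j : Y ⊕ Z, _ • (Sum.elim Subtype.val fun v => a (o' v) :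
      Y ⊕ Z → Fin k → ℤ) j
    simp only [Fintype.sum_sum_type, Sum.elim_inl, Sum.elim_inr]
    rw [hνZ', Finset.sum_coe_sort Y (fun v => ν v • v), hν, add_left_comm,
      Finset.sum_add_sum_compl, add_comm, ← Finset.sum_add_distrib]
    exact Finset.sum_congr rfl fun p _ => hyaL p
  · change x = P.card + ∑ j : Y ⊕ Z, _ * (Sum.elim 0 1 : Y ⊕ Z → ℕ) j
    simpa [Fintype.sum_sum_type] using hνZ₀

end CardVerifier

/-! ### The linear system of a formula and its small solutions. -/

namespace CardVerifier

open SmallSolutions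

def sysSize (S : ℕ) : ℕ := S * itemBound S + 2 * S * S + 7 * S + 1

/-- The bound on the bit lengths of coefficients. -/
def coeffBits (S : ℕ) : ℕ := itemBound S + rayBits S + S + 1

/-- The bound on the bit lengths of the values of the variables. -/
def valueBits (S : ℕ) : ℕ := sysSize S * (sysSize S + coeffBits S + 1)

def witnessBits (S : ℕ) : ℕ := rayBits S + valueBits S + itemBound S + 1

section System

variable {nat : Bool} {S k n : ℕ} {F : Fin n → QFPA (Fin k)}

/-- The variables of the system of a formula. -/
abbrev SysVar (t : ∀ i, Template nat S (F i)) : Type :=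
  (Fin k ⊕ Fin n) ⊕ (Fin S ⊕ Σ i, (t i).J)

/-- Further variables of index at least `S` do not occur in a formula of length at most `S`;
`extend` gives them the value zero. -/
def sysVar (t : ∀ i, Template nat S (F i)) : CardVar k n → Option (SysVar t)
  | .u j => some (.inl (.inl j))
  | .x i => some (.inl (.inr i))
  | .v l => if h : l < S then some (.inr (.inl ⟨l, h⟩)) else none

/-- The coefficients of the equations for `u` and the exponents. -/
def sysCoeff (t : ∀ i, Template nat S (F i)) : (Fin n × Fin k) ⊕ Fin n → SysVar t → ℤ
  | .inl (_, j), .inl (.inl j') => if j = j' then 1 else 0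
  | .inr i, .inl (.inr i') => if i = i' then 1 else 0
  | .inl (i, j), .inr (.inr q) => if i = q.1 then -(t q.1).gen q.2 j else 0
  | .inr i, .inr (.inr q) => if i = q.1 then -(t q.1).weight q.2 else 0
  | _, _ => 0

def sysConst (t : ∀ i, Template nat S (F i)) : (Fin n × Fin k) ⊕ Fin n → ℤ
  | .inl (i, j) => -(t i).base j
  | .inr i => -(t i).count

theorem sys_inl (t : ∀ i, Template nat S (F i)) (ρ : SysVar t → ℤ) (i : Fin n) (j : Fin k) :
    sysConst t (.inl (i, j)) + ∑ q, sysCoeff t (.inl (i, j)) q * ρ q =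
      ρ (.inl (.inl j)) - ((t i).base j + ∑ l, ρ (.inr (.inr ⟨i, l⟩)) * (t i).gen l j) := by
  have h : ∑ q : Σ i, (t i).J, (if i = q.1 then -(t q.1).gen q.2 j else 0) * ρ (.inr (.inr q)) =
      -∑ l, ρ (.inr (.inr ⟨i, l⟩)) * (t i).gen l j := by
    rw [Fintype.sum_sigma, Finset.sum_eq_single i]
    · simp [mul_comm]
    · intro i' _ hi'
      simp [hi'.symm]
    · simp
  simp only [Fintype.sum_sum_type, sysCoeff, sysConst, h]
  simp
  ring

theorem sys_inr (t : ∀ i, Template nat S (F i)) (ρ : SysVar t → ℤ) (i : Fin n) :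
    sysConst t (.inr i) + ∑ q, sysCoeff t (.inr i) q * ρ q =
      ρ (.inl (.inr i)) - ((t i).count + ∑ l, ρ (.inr (.inr ⟨i, l⟩)) * (t i).weight l) := by
  have h : ∑ q : Σ i, (t i).J, (if i = q.1 then -((t q.1).weight q.2 : ℤ) else 0) *
      ρ (.inr (.inr q)) = -∑ l, ρ (.inr (.inr ⟨i, l⟩)) * (t i).weight l := by
    rw [Fintype.sum_sigma, Finset.sum_eq_single i]
    · simp [mul_comm]
    · intro i' _ hi'
      simp [hi'.symm]
    · simp
  simp only [Fintype.sum_sum_type, sysCoeff, sysConst, h]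
  simp
  ring

theorem sysCoeff_le (t : ∀ i, Template nat S (F i)) (e q) :
    (sysCoeff t e q).natAbs ≤ 2 ^ coeffBits S := by
  have h1 : 1 ≤ 2 ^ coeffBits S := Nat.one_le_two_pow
  have h2 : 2 ^ rayBits S ≤ 2 ^ coeffBits S :=
    Nat.pow_le_pow_right (by norm_num) (by rw [coeffBits]; omega)
  rcases e with ⟨i, j⟩ | i <;> rcases q with (j' | i') | (l | q) <;> simp only [sysCoeff]
  · split_ifs <;> simp [h1]
  · simp
  · simp
  · split_ifs
    · rw [Int.natAbs_neg]
      exact ((t q.1).gen_le _ _).trans h2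
    · simp
  · simp
  · split_ifs <;> simp [h1]
  · simp
  · split_ifs
    · rw [Int.natAbs_neg, Int.natAbs_natCast]
      exact ((t q.1).weight_le _).trans h1
    · simp

theorem sysConst_le (t : ∀ i, Template nat S (F i)) (e) :
    (sysConst t e).natAbs ≤ 2 ^ coeffBits S := by
  rcases e with ⟨i, j⟩ | i <;> simp only [sysConst, Int.natAbs_neg, Int.natAbs_natCast]
  · refine ((t i).base_le j).trans (Nat.pow_le_pow_right (by norm_num) ?_)
    rw [coeffBits]
    omega
  · refine (t i).count_le.trans (Nat.lt_two_pow_self.le.trans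
      (Nat.pow_le_pow_right (by norm_num) ?_))
    rw [coeffBits]
    omega

end System

/-- A satisfiable formula has a small witness. -/
theorem exists_small_witness {nat : Bool} {S : ℕ} (φ : LIACard) (hS : φ.encode.length ≤ S)
    (h : φ.Satisfiable (dom nat)) :
    ∃ (u : Fin φ.k → ℤ) (x : Fin φ.n → ℕ) (v : ℕ → ℤ) (items : Fin φ.n → List (ℕ × (Fin φ.k → ℤ))),
      (∀ j, u j ∈ dom nat ∧ (u j).natAbs < 2 ^ witnessBits S) ∧
      (∀ l, v l ∈ dom nat ∧ (v l).natAbs < 2 ^ witnessBits S) ∧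
      φ.F₀.Holds (CardVar.assign u x v) ∧
      (∀ i, Represents nat (witnessBits S) (itemBound S) (φ.F i) u (items i)) ∧
      ∀ i, x i = ((items i).map Prod.fst).sum := by
  classical
  obtain ⟨k, n, F₀, F⟩ := φ
  obtain ⟨u, x, v, hu, hv, hF₀, hsum⟩ := h
  dsimp only at u x hu hF₀ hsum ⊢
  have hlen : k + n + 2 + (F₀.encode CardVar.encode).length +
      ∑ i, ((F i).encode encodeFin).length ≤ S := by
    refine le_trans (le_of_eq ?_) hS
    simp [LIACard.encode, encodeUnary, List.length_flatten, List.map_ofFn, List.sum_ofFn]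
    omega
  have hFS (i) : ((F i).encode encodeFin).length ≤ S := by
    have := Finset.single_le_sum (f := fun i => ((F i).encode encodeFin).length)
      (fun _ _ => Nat.zero_le _) (Finset.mem_univ i)
    omega
  -- The templates are fixed according to the given, possibly huge, solution; from here on only the
  -- values of the variables and the multiplicities change.
  choose t μ h1 h2 using fun i => exists_template (nat := nat) (hFS i) (by omega : k ≤ S) (hsum i)
  let ρ : SysVar t → ℤ := Sum.elim (Sum.elim u fun i => x i)
    (Sum.elim (fun l => v l) fun q => μ q.1 q.2)
  have hρ : F₀.Holds (extend (sysVar t) ρ) := by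
    refine (QFPA.holds_congr (var := CardVar.encode) (S := S) ?_ F₀ (by omega)).1 hF₀
    rintro (j | i | l) ha
    · rfl
    · rfl
    · have : l < S := by simp [CardVar.encode, encodeUnary] at ha; omega
      simp [extend, sysVar, this, ρ, CardVar.assign]
  obtain ⟨L, g1, g2, g3, g4⟩ := QFPA.exists_system CardVar.encode (sysVar t) F₀ ρ
  have hle : 2 ^ ((F₀.encode CardVar.encode).length + 1) ≤ 2 ^ coeffBits S :=
    Nat.pow_le_pow_right (by norm_num) (by rw [coeffBits]; omega)
  have hsys (e) : sysConst t e + ∑ q, sysCoeff t e q * ρ q = 0 := by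
    rcases e with ⟨i, j⟩ | i
    · rw [sys_inl, sub_eq_zero]
      have := congrFun (h1 i) j
      simpa [ρ] using this
    · rw [sys_inr, sub_eq_zero]
      have := h2 i
      simp only [ρ, Sum.elim_inl, Sum.elim_inr]
      exact_mod_cast this
  -- Each equation enters as two inequalities. Only the small point is needed and the directions are
  -- discarded. Since it inherits non-negativity from `ρ`, exponents and multiplicities remain
  -- natural numbers.
  obtain ⟨a, -, -, ⟨c1, c2, c3⟩, -⟩ := exists_generators
    (κ := Fin L.length ⊕ ((Fin n × Fin k) ⊕ Fin n) × Bool) (K := 2 ^ coeffBits S)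
    (A := Sum.elim (fun e => L[e].1) fun e => bif e.2 then sysCoeff t e.1 else -sysCoeff t e.1)
    (b := Sum.elim (fun e => L[e].2) fun e => bif e.2 then sysConst t e.1 else -sysConst t e.1)
    Nat.one_le_two_pow (by
      rintro (e | ⟨e, _ | _⟩) q
      · exact ((g2 _ (List.getElem_mem _)).1 q).trans hle
      · simpa using sysCoeff_le t e q
      · simpa using sysCoeff_le t e q) (by
      rintro (e | ⟨e, _ | _⟩)
      · exact (g2 _ (List.getElem_mem _)).2.trans hle
      · simpa using sysConst_le t e
      · simpa using sysConst_le t e) ρ (by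
      rintro (e | ⟨e, _ | _⟩)
      · exact g3 _ (List.getElem_mem _)
      · have := hsys e
        simp only [Sum.elim_inr, cond_false, Pi.neg_apply, neg_mul, Finset.sum_neg_distrib]
        omega
      · exact (hsys e).ge)
  have hN : Fintype.card (SysVar t) +
      Fintype.card (Fin L.length ⊕ ((Fin n × Fin k) ⊕ Fin n) × Bool) + 1 ≤ sysSize S := by
    have e1 : ∑ i, Fintype.card (t i).J ≤ n * itemBound S := by
      simpa using Finset.sum_le_card_nsmul Finset.univ (fun i => Fintype.card (t i).J) _
        fun i _ => (t i).card_le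
    have e2 : n * itemBound S ≤ S * itemBound S := Nat.mul_le_mul_right _ (by omega)
    have e3 : n * k ≤ S * S := Nat.mul_le_mul (by omega) (by omega)
    simp only [Fintype.card_sum, Fintype.card_fin, Fintype.card_sigma, Fintype.card_prod,
      Fintype.card_bool, sysSize]
    have e4 : L.length ≤ 2 * S := by omega
    have e5 : k + n ≤ S := by omega
    have e6 : (n * k + n) * 2 ≤ 2 * S * S + 2 * S := by nlinarith
    omega
  have ha (q) : (a q).natAbs ≤ 2 ^ valueBits S := (c3 q).trans (genBound_le hN)
  have hlt : 2 ^ valueBits S < 2 ^ witnessBits S :=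
    Nat.pow_lt_pow_right (by norm_num) (by rw [witnessBits]; omega)
  have hx0 (i) : 0 ≤ a (.inl (.inr i)) := c2 _ (by simp [ρ])
  have hμ0 (q) : 0 ≤ a (.inr (.inr q)) := c2 _ (by simp [ρ])
  have hsys' (e) : sysConst t e + ∑ q, sysCoeff t e q * a q = 0 := by
    have e1 := c1 (.inr (e, true))
    have e2 := c1 (.inr (e, false))
    simp only [Sum.elim_inr, cond_false, cond_true, Pi.neg_apply, neg_mul,
      Finset.sum_neg_distrib] at e1 e2
    omega
  have hF₀' : F₀.Holds (extend (sysVar t) a) := by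
    refine (g4 a fun e he => ?_).2 hρ
    obtain ⟨j, hj, rfl⟩ := List.mem_iff_getElem.1 he
    exact c1 (.inl ⟨j, hj⟩)
  let u' : Fin k → ℤ := fun j => a (.inl (.inl j))
  let x' : Fin n → ℕ := fun i => (a (.inl (.inr i))).toNat
  let v' : ℕ → ℤ := fun l => if h : l < S then a (.inr (.inl ⟨l, h⟩)) else 0
  let μ' (i) (j : (t i).J) : ℕ := (a (.inr (.inr ⟨i, j⟩))).toNat
  have hμ' (i) (j : (t i).J) : (μ' i j : ℤ) = a (.inr (.inr ⟨i, j⟩)) := Int.toNat_of_nonneg (hμ0 _)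
  -- The new multiplicities are put into the same templates, and freedom of the multiplicities turns
  -- the small point back into sums of solutions.
  choose items hi hi' using fun i => (t i).represents (μ' i) (valueBits S) fun j => by
    have := ha (.inr (.inr ⟨i, j⟩))
    have := hμ' i j
    omega
  have hu' (i) : u' = (t i).base + ∑ j, μ' i j • (t i).gen j := by
    funext j
    have := hsys' (.inl (i, j))
    rw [sys_inl, sub_eq_zero] at this
    simpa [hμ', u'] using this
  refine ⟨u', x', v', items, fun j => ⟨fun hnat => c2 _ (hu j hnat), (ha _).trans_lt hlt⟩,
    fun l => ?_, ?_, fun i => ?_, fun i => ?_⟩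
  · by_cases hl : l < S
    · simp only [v', hl, dite_true]
      exact ⟨fun hnat => c2 _ (hv l hnat), (ha _).trans_lt hlt⟩
    · simp [v', hl, dom]
  · convert hF₀' using 1
    funext b
    rcases b with j | i | l
    · rfl
    · exact Int.toNat_of_nonneg (hx0 i)
    · by_cases hl : l < S
      · simp [CardVar.assign, v', hl, extend, sysVar]
      · simp [CardVar.assign, v', hl, extend, sysVar]
  · rw [hu' i]
    exact hi i
  · have := hsys' (.inr i)
    rw [sys_inr, sub_eq_zero] at this
    rw [hi']
    have hx' : (x' i : ℤ) = a (.inl (.inr i)) := Int.toNat_of_nonneg (hx0 i)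
    zify
    simp only [hμ', hx', this]

end CardVerifier

/-! ### Polynomial bounds and the conclusion. -/

namespace CardVerifier

open StackProgram

/-- The function `f` is a polynomial with natural coefficients. -/
def IsPoly (f : ℕ → ℕ) : Prop := ∃ p : Polynomial ℕ, ∀ n, p.eval n = f n

namespace IsPoly

variable {f g : ℕ → ℕ}

theorem const (c : ℕ) : IsPoly fun _ => c := ⟨.C c, by simp⟩

theorem id : IsPoly fun n => n := ⟨.X, by simp⟩

theorem add (hf : IsPoly f) (hg : IsPoly g) : IsPoly fun n => f n + g n := by
  obtain ⟨p, hp⟩ := hf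
  obtain ⟨q, hq⟩ := hg
  exact ⟨p + q, by simp [hp, hq]⟩

theorem mul (hf : IsPoly f) (hg : IsPoly g) : IsPoly fun n => f n * g n := by
  obtain ⟨p, hp⟩ := hf
  obtain ⟨q, hq⟩ := hg
  exact ⟨p * q, by simp [hp, hq]⟩

end IsPoly

theorem isPoly_rayBits : IsPoly rayBits :=
  (((IsPoly.const 3).mul .id).add (.const 1)).mul (((IsPoly.const 4).mul .id).add (.const 3))

theorem isPoly_itemBound : IsPoly itemBound :=
  (IsPoly.const 2).mul ((IsPoly.id.add (.const 1)).mul ((((IsPoly.const 8).mul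
    (IsPoly.id.add (.const 1))).add ((IsPoly.const 3).mul isPoly_rayBits)).add (.const 20)))

theorem isPoly_sysSize : IsPoly sysSize :=
  (((IsPoly.id.mul isPoly_itemBound).add (((IsPoly.const 2).mul .id).mul .id)).add
    ((IsPoly.const 7).mul .id)).add (.const 1)

theorem isPoly_coeffBits : IsPoly coeffBits :=
  ((isPoly_itemBound.add isPoly_rayBits).add .id).add (.const 1)

theorem isPoly_valueBits : IsPoly valueBits :=
  isPoly_sysSize.mul ((isPoly_sysSize.add isPoly_coeffBits).add (.const 1))

theorem isPoly_witnessBits : IsPoly witnessBits :=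
  ((isPoly_rayBits.add isPoly_valueBits).add isPoly_itemBound).add (.const 1)

def numBound (S : ℕ) : ℕ := 3 * witnessBits S + 1 + itemBound S

def termCost (S : ℕ) : ℕ :=
  9 * (witnessBits S + 2 * S + 2) + 2 * (S * (witnessBits S + 1)) + 20

def itemCost (S : ℕ) : ℕ :=
  S * termCost S + (S + 1) * (numBound S * (4 * numBound S + 3) + 8 * numBound S + 13) +
    2 * (S * (witnessBits S + 1)) + 4 * S + 2 * witnessBits S + 12

/-- The bound on the length of the certificates. -/
def certBound (S : ℕ) : ℕ := (S * (itemBound S + 2) + 8) * itemCost S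

theorem isPoly_numBound : IsPoly numBound :=
  (((IsPoly.const 3).mul isPoly_witnessBits).add (.const 1)).add isPoly_itemBound

theorem isPoly_termCost : IsPoly termCost :=
  (((IsPoly.const 9).mul ((isPoly_witnessBits.add ((IsPoly.const 2).mul .id)).add (.const 2))).add
    ((IsPoly.const 2).mul (IsPoly.id.mul (isPoly_witnessBits.add (.const 1))))).add (.const 20)

theorem isPoly_itemCost : IsPoly itemCost :=
  (((((IsPoly.id.mul isPoly_termCost).add ((IsPoly.id.add (.const 1)).mul
    (((isPoly_numBound.mul (((IsPoly.const 4).mul isPoly_numBound).add (.const 3))).add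
    ((IsPoly.const 8).mul isPoly_numBound)).add (.const 13)))).add
    ((IsPoly.const 2).mul (IsPoly.id.mul (isPoly_witnessBits.add (.const 1))))).add
    ((IsPoly.const 4).mul .id)).add ((IsPoly.const 2).mul isPoly_witnessBits)).add (.const 12)

theorem isPoly_certBound : IsPoly certBound :=
  ((IsPoly.id.mul (isPoly_itemBound.add (.const 2))).add (.const 8)).mul isPoly_itemCost

theorem costs (S : ℕ) : Costs (witnessBits S) S (numBound S) (termCost S) (itemCost S) where
  tf := le_rfl
  item := le_rfl

instance : Inhabited Token := ⟨.sep⟩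

/-- All bounds are taken at the length of the formula, with `numBound`, `termCost` and `itemCost`
chosen as the least values that `Costs` and `run_main` allow. -/
theorem inNP_satLanguage (nat : Bool) : InNP (LIACard.satLanguage (dom nat)) := by
  obtain ⟨p, hp⟩ := isPoly_certBound
  refine inNP_of_rules (prog nat) .J .main _ p (fun s w c' h => mem_satLanguage_of_eval h) ?_
  rintro s ⟨φ, rfl, hφ⟩
  obtain ⟨u, x, v, items, hu, hv, hF, hi, hx⟩ := exists_small_witness φ le_rfl hφ
  obtain ⟨c', w, hw, h⟩ := run_main (costs _) le_rfl φ le_rfl u x v hu hv hF items hi hx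
  exact ⟨w, c', by rw [hp]; exact hw, h⟩

end CardVerifier

/-- Satisfiability of linear arithmetic formulas with sum cardinalities is in NP, over the natural
numbers and over the integers. -/
theorem mainTheorem1 :
    InNP (LIACard.satLanguage {z : ℤ | 0 ≤ z}) ∧
    InNP (LIACard.satLanguage (Set.univ : Set ℤ)) := by
  refine ⟨?_, ?_⟩
  · convert CardVerifier.inNP_satLanguage true using 2
    ext z
    simp [CardVerifier.dom]
  · convert CardVerifier.inNP_satLanguage false using 2
    ext z
    simp [CardVerifier.dom]
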